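/- **Model.** Let $T$ be a treatment with support $\mathcal T=[0,1]$, $X\in\mathbb R^r$ covariates with compact support $\mathcal X$, $\{Y(t)\}_{t\in\mathcal T}$ potential outcomes (a measurable process with respect to the $\sigma$-algebra it generates), and $Y=Y(T)$. From the infinite i.i.d. sequence $(T_i,X_i,Y_i)$ of copies of $(T,X,Y)$ the first $N$ terms are observed. Put $\bar F_t(y)=P(Y(t)\ge y)$, $q_t(\alpha)=\inf\{y:\bar F_t(y)\le 1-\alpha\}$, $\mathrm{TM}_t(\alpha)=E\{Y(t)\mid Y(t)>q_t(\alpha)\}$, $\pi_0(t,x)=f_T(t)/f_{T|X}(t|x)$. Assume: 1. $\bar F_t(y)$ is $C^1$ in $y$, and $C^3$ in $t\in\mathcal T$; with the density $f_{Y(t)}=-\partial_y\bar F_t$ there is $\gamma(t)\in(0,1/2)$ such that $y f_{Y(t)}(y)/\bar F_t(y)\to1/\gamma(t)$ as $y\to\infty$, for all $t\in\mathcal T$. 2. Given $X$, $T$ is independent of $\{Y(t)\}_{t\in\mathcal T}$. 3. $0<\eta_1\le\pi_0\le\eta_2<\infty$ on $\mathcal T\times\mathcal X$; $f_T$ is $C^3$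 on $\mathcal T$ with $0<\eta_3\le f_T\le\eta_4<\infty$; the conditional distribution function $F_{Y|T,X}(y|t,x)$ is continuous in $y$ for $(t,x)\in\mathcal T\times\mathcal X$ and, for each $y$, $C^1$ in $(t,x)\in\mathcal T\times\mathcal X$. 4. The kernel $K\ge0$ is bounded, symmetric, supported in $[-1,1]$, $\int K=1$, $\int u^2K(u)\,du\in(0,\infty)$, $\int K^2<\infty$. 5. There are $\rho(t)<0$ and functions $A_t$, eventually positive or eventually negative, with $A_t(y)\to0$ as $y\to\infty$, such that for all $t\in\mathcal T$ and $z>0$ $$\lim_{y\to\infty}\frac{\bar F_t(zy)/\bar F_t(y)-z^{-1/\gamma(t)}}{A_t(1/\bar F_t(y))}=z^{-1/\gamma(t)}\frac{z^{\rho(t)/\gamma(t)}-1}{\gamma(t)\rho(t)}.$$ 6. The weight estimator $\hat\pi$ satisfies $\sup_{i\le N}|\hat\pi(T_i,X_i)-\pi_0(T_i,X_i)|=O_p(\delta_N)$, where $\delta_N\ge0$, $\delta_N\to0$. 7. As $N\to\infty$: $\alpha_N\in(0,1)$, $\alpha_N\to1$, $h=h_N>0$, $h\to0$, $k_N\to\infty$,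 $Nh(1-\alpha_N)\to c\in[0,\infty)$, $k_N/N\to0$, $k_Nh\to\infty$, $k_Nh^3\to0$, $k_Nh\delta_N^2\to0$ and $\sqrt{k_Nh}/\log(k_N/\{N(1-\alpha_N)\})\to\infty$. 8. Let $\omega_t(y,h)=\sup\{|\log(\bar F_{s}(z)/\bar F_t(z))|/\log z:\ z\ge y,\ s\in\mathcal T,\ |s-t|\le h\}$. For every $t\in\mathcal T$, $\sqrt{k_Nh}\,A_t(N/k_N)\to0$, and for some $b=b(t)\in(0,1)$, with $\omega_N=\omega_t(b\,q_t(1-k_N/N),h)$, both $\omega_N\log(k_N/N)\to0$ and $\sqrt{k_Nh}\,\omega_N\log(k_N/N)\to0$. 9. The estimator $\hat\gamma(t)$ and random variables $\Gamma(t)$, $t\in\mathcal T$, are such that, for all $t_1\ne t_2$ in $\mathcal T$, $\Gamma(t_1)$ and $\Gamma(t_2)$ are independent and $\sqrt{k_Nh}\,(\hat\gamma(t_1)-\gamma(t_1),\hat\gamma(t_2)-\gamma(t_2))\to(\Gamma(t_1),\Gamma(t_2))$ in distribution. **Estimators.** $$\widehat{\bar F}_{t,h}(y)=\frac{\sum_{i\le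 N}\hat\pi(T_i,X_i)\mathbf 1(Y_i>y)K((T_i-t)/h)}{\sum_{i\le N}\hat\pi(T_i,X_i)K((T_i-t)/h)},\qquad \hat q_{t,h}(\alpha)=\inf\{z:\widehat{\bar F}_{t,h}(z)\le1-\alpha\},$$ $$\hat q^E_{t,h}(\alpha)=\hat q_{t,h}(1-k_N/N)\Bigl(\frac{k_N}{N(1-\alpha)}\Bigr)^{\hat\gamma(t)},\qquad \widehat{\mathrm{TM}}_{t,h}(\alpha)=\frac{\hat q^E_{t,h}(\alpha)}{1-\hat\gamma(t)}.$$ **Theorem.** Fix $\Delta_0\in(0,1)$ and for $\upsilon\in[\Delta_0,1]$ let $$\mathcal M_{t,h}(\upsilon)=\frac{\sqrt{k_Nh}}{\log(k_N/\{N\upsilon(1-\alpha_N)\})}\left\{\frac{\widehat{\mathrm{TM}}_{t,h}\{1-\upsilon(1-\alpha_N)\}}{\mathrm{TM}_t\{1-\upsilon(1-\alpha_N)\}}-1\right\}.$$ Then for all $t_1\ne t_2$ in $\mathcal T$, $(\mathcal M_{t_1,h},\mathcal M_{t_2,h})$ converges weakly (in the Hoffmann-Jørgensen sense) in $\ell^\infty([\Delta_0,1])$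 to the process $(\Gamma(t_1),\Gamma(t_2))$, which is constant in $\upsilon$, and $\Gamma(t_1)$, $\Gamma(t_2)$ are independent. -/

import Mathlib

open MeasureTheory ProbabilityTheory Filter Topology Set
open scoped ENNReal

noncomputable section

namespace ExtremeTE

/-- The space of covariate vectors. -/
abbrev Cov (r : ℕ) : Type := EuclideanSpace ℝ (Fin r)

/-- The support of the treatment variable. -/
abbrev treatments : Set ℝ := Icc (0 : ℝ) 1

/-! ### Population quantities of the potential outcomes -/

section Population

variable {Ω₀ : Type*} [MeasurableSpace Ω₀]

/-- Counterfactual survival function `P (Y(t) ≥ y)`. -/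
def survival (P : Measure Ω₀) (Y : ℝ → Ω₀ → ℝ) (t y : ℝ) : ℝ :=
  P.real {ω | y ≤ Y t ω}

/-- Quantile function `inf {y : P (Y(t) ≥ y) ≤ 1 - a}`. -/
def quantile (P : Measure Ω₀) (Y : ℝ → Ω₀ → ℝ) (t a : ℝ) : ℝ :=
  sInf {y | survival P Y t y ≤ 1 - a}

/-- Tail mean `E (Y(t) | Y(t) > q_t(a))`: the mean under the elementary conditional probability. -/
def tailMean (P : Measure Ω₀) (Y : ℝ → Ω₀ → ℝ) (t a : ℝ) : ℝ :=
  ∫ ω, Y t ω ∂(ProbabilityTheory.cond P {ω | quantile P Y t a < Y t ω})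

/-- Density of `Y(t)`, for a continuously differentiable survival function. -/
def outcomeDensity (P : Measure Ω₀) (Y : ℝ → Ω₀ → ℝ) (t y : ℝ) : ℝ :=
  -deriv (survival P Y t) y

/-- Oscillation in the treatment, within radius `h` of `t`, of the survival function above the
level `y`; it takes values in `[0, ∞]`, so that an unbounded set has supremum `∞`. -/
def oscillation (P : Measure Ω₀) (Y : ℝ → Ω₀ → ℝ) (t y h : ℝ) : ℝ≥0∞ :=
  ⨆ (z : ℝ) (_ : y ≤ z) (s : ℝ) (_ : s ∈ treatments ∧ |s - t| ≤ h),
    ENNReal.ofReal (|Real.log (survival P Y s z / survival P Y t z)| / Real.log z)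

/-- Smoothness and heavy tails of the potential outcomes, with tail index function `γ`. -/
structure HeavyTails (P : Measure Ω₀) (Y : ℝ → Ω₀ → ℝ) (γ : ℝ → ℝ) : Prop where
  smooth_outcome : ∀ t ∈ treatments, ContDiff ℝ 1 (fun y => survival P Y t y)
  smooth_treatment : ∀ y, ContDiffOn ℝ 3 (fun t => survival P Y t y) treatments
  index_pos : ∀ t ∈ treatments, 0 < γ t
  von_mises : ∀ t ∈ treatments,
    Tendsto (fun y => y * outcomeDensity P Y t y / survival P Y t y) atTop (𝓝 (1 / γ t))

/-- Second-order condition on the survival functions, with auxiliary functions `A t`. -/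
structure SecondOrder (P : Measure Ω₀) (Y : ℝ → Ω₀ → ℝ) (γ ρ : ℝ → ℝ) (A : ℝ → ℝ → ℝ) :
    Prop where
  rho_neg : ∀ t ∈ treatments, ρ t < 0
  eventual_sign : ∀ t ∈ treatments, (∀ᶠ y in atTop, 0 < A t y) ∨ (∀ᶠ y in atTop, A t y < 0)
  tendsto_zero : ∀ t ∈ treatments, Tendsto (A t) atTop (𝓝 0)
  limit : ∀ t ∈ treatments, ∀ z : ℝ, 0 < z →
    Tendsto
      (fun y => (survival P Y t (z * y) / survival P Y t y - z ^ (-1 / γ t))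
        / A t (1 / survival P Y t y)) atTop
      (𝓝 (z ^ (-1 / γ t) * ((z ^ (ρ t / γ t) - 1) / (γ t * ρ t))))

/-- The sigma-algebra generated by the potential outcomes `Y(t)`, `t` in the support. -/
abbrev outcomeSigma (Y : ℝ → Ω₀ → ℝ) : MeasurableSpace Ω₀ :=
  ⨆ t ∈ treatments, MeasurableSpace.comap (Y t) inferInstance

/-- Conditional independence of the sigma-algebras `m₁` and `m₂` given `m`. -/
def CondIndepGiven (P : Measure Ω₀) (m m₁ m₂ : MeasurableSpace Ω₀) : Prop :=
  ∀ A B : Set Ω₀, MeasurableSet[m₁] A → MeasurableSet[m₂] B →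
    P[(A ∩ B).indicator (fun _ => (1 : ℝ)) | m] =ᵐ[P]
      P[A.indicator (fun _ => (1 : ℝ)) | m] * P[B.indicator (fun _ => (1 : ℝ)) | m]

/-- `T`, `X` and the potential outcomes are random variables, and the potential outcomes form a
measurable process (so that `Y(T)` is defined by the process and by `T`). -/
structure MeasurableModel {r : ℕ} (T : Ω₀ → ℝ) (X : Ω₀ → Cov r) (Y : ℝ → Ω₀ → ℝ) : Prop where
  treatment : Measurable T
  covariate : Measurable X
  outcome : ∀ t ∈ treatments, Measurable (Y t)
  process :
    @Measurable (treatments × Ω₀) ℝ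
      (@Prod.instMeasurableSpace treatments Ω₀ inferInstance (outcomeSigma Y)) inferInstance
      (fun p => Y p.1 p.2)

/-- Unconfoundedness: given `X`, the treatment is independent of `(Y(t))_t`. -/
def Unconfounded {r : ℕ} (P : Measure Ω₀) (T : Ω₀ → ℝ) (X : Ω₀ → Cov r) (Y : ℝ → Ω₀ → ℝ) :
    Prop :=
  CondIndepGiven P (MeasurableSpace.comap X inferInstance)
    (MeasurableSpace.comap T inferInstance) (outcomeSigma Y)

/-- Observed data `(T, X, Y(T))` of one unit. -/
def observation {r : ℕ} (T : Ω₀ → ℝ) (X : Ω₀ → Cov r) (Y : ℝ → Ω₀ → ℝ) (ω : Ω₀) :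
    ℝ × Cov r × ℝ :=
  (T ω, X ω, Y (T ω) ω)

/-- Support of the covariates. -/
def covSupport {r : ℕ} (P : Measure Ω₀) (X : Ω₀ → Cov r) : Set (Cov r) :=
  (P.map X).support

/-- Stabilized weight `f_T(t) / f_{T|X}(t|x)`. -/
def stabWeight {r : ℕ} (fT : ℝ → ℝ) (fTX : ℝ → Cov r → ℝ) (t : ℝ) (x : Cov r) : ℝ :=
  fT t / fTX t x

/-- `fT` is a density of `T`, and `fTX` a conditional density of `T` given `X`; both are with
respect to Lebesgue measure on the support of `T`. -/
structure TreatmentDensities {r : ℕ} (P : Measure Ω₀) (T : Ω₀ → ℝ) (X : Ω₀ → Cov r)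
    (fT : ℝ → ℝ) (fTX : ℝ → Cov r → ℝ) : Prop where
  law_treatment :
    P.map T = (volume.restrict treatments).withDensity (fun t => ENNReal.ofReal (fT t))
  measurable_cond : Measurable (Function.uncurry fTX)
  law_joint : P.map (fun ω => (T ω, X ω)) =
    ((volume.restrict treatments).prod (P.map X)).withDensity
      (fun p => ENNReal.ofReal (fTX p.1 p.2))

/-- Compact covariate support and stabilized weights bounded away from `0` and `∞`. -/
structure Overlap {r : ℕ} (P : Measure Ω₀) (X : Ω₀ → Cov r) (fT : ℝ → ℝ)
    (fTX : ℝ → Cov r → ℝ) : Prop where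
  compact_support : IsCompact (covSupport P X)
  weight_bounds : ∃ η₁ η₂ : ℝ, 0 < η₁ ∧ ∀ t ∈ treatments, ∀ x ∈ covSupport P X,
    η₁ ≤ stabWeight fT fTX t x ∧ stabWeight fT fTX t x ≤ η₂

/-- Regularity of the conditional law `κ` of the observed outcome given `(T, X)`, and of `f_T`. -/
structure RegularLaw {r : ℕ} (P : Measure Ω₀) (T : Ω₀ → ℝ) (X : Ω₀ → Cov r)
    (Y : ℝ → Ω₀ → ℝ) (fT : ℝ → ℝ) (κ : Kernel (ℝ × Cov r) ℝ) : Prop where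
  markov : IsMarkovKernel κ
  disintegration : P.map (fun ω => ((T ω, X ω), Y (T ω) ω)) =
    (P.map (fun ω => (T ω, X ω))) ⊗ₘ κ
  continuous_outcome : ∀ t ∈ treatments, ∀ x ∈ covSupport P X,
    Continuous (fun y : ℝ => (κ (t, x)).real (Iic y))
  smooth_cond : ∀ y : ℝ, ContDiffOn ℝ 1 (fun p : ℝ × Cov r => (κ p).real (Iic y))
    (treatments ×ˢ covSupport P X)
  smooth_density : ContDiffOn ℝ 3 fT treatments
  density_bounds : ∃ η₃ η₄ : ℝ, 0 < η₃ ∧ ∀ t ∈ treatments, η₃ ≤ fT t ∧ fT t ≤ η₄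

end Population

/-- Kernel functions: bounded symmetric probability densities on `[-1, 1]` with positive finite
second moment and finite squared integral. -/
structure IsSmoothingKernel (K : ℝ → ℝ) : Prop where
  measurable : Measurable K
  nonneg : ∀ u, 0 ≤ K u
  bounded : ∃ C, ∀ u, K u ≤ C
  symmetric : ∀ u, K (-u) = K u
  support : Function.support K ⊆ Icc (-1) 1
  integral_one : ∫ u, K u = 1
  second_moment_pos : 0 < ∫ u, u ^ 2 * K u
  second_moment_finite : Integrable (fun u => u ^ 2 * K u)
  square_finite : Integrable (fun u => K u ^ 2)

/-! ### Estimators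

They are functions of the bandwidth `h`, of the weights `w i`, treatments `T i` and outcomes `Y i`
of the units `i < N`. -/

/-- Weighted kernel estimator of the survival function. -/
def survivalHat (K : ℝ → ℝ) (h : ℝ) (N : ℕ) (w T Y : ℕ → ℝ) (t y : ℝ) : ℝ :=
  (∑ i ∈ Finset.range N, w i * (if y < Y i then 1 else 0) * K ((T i - t) / h)) /
    ∑ i ∈ Finset.range N, w i * K ((T i - t) / h)

/-- Intermediate quantile estimator. -/
def quantileHat (K : ℝ → ℝ) (h : ℝ) (N : ℕ) (w T Y : ℕ → ℝ) (t a : ℝ) : ℝ :=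
  sInf {z | survivalHat K h N w T Y t z ≤ 1 - a}

/-- Extrapolated extreme quantile estimator, with tail index estimate `g` and threshold `k`. -/
def extremeQuantileHat (K : ℝ → ℝ) (h : ℝ) (N : ℕ) (w T Y : ℕ → ℝ) (k g t a : ℝ) : ℝ :=
  quantileHat K h N w T Y t (1 - k / N) * (k / (N * (1 - a))) ^ g

/-- Extreme tail mean estimator. -/
def tailMeanHat (K : ℝ → ℝ) (h : ℝ) (N : ℕ) (w T Y : ℕ → ℝ) (k g t a : ℝ) : ℝ :=
  extremeQuantileHat K h N w T Y k g t a / (1 - g)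

/-- Normalized relative error of a tail mean estimator `TMhat` at the levels `1 - υ (1 - a)`. -/
def tailMeanError (h : ℝ) (N : ℕ) (k a : ℝ) (TMhat TM : ℝ → ℝ) (υ : ℝ) : ℝ :=
  Real.sqrt (k * h) / Real.log (k / (N * υ * (1 - a))) *
    (TMhat (1 - υ * (1 - a)) / TM (1 - υ * (1 - a)) - 1)

/-! ### Stochastic orders and weak convergence of processes -/

/-- `Z N = O_p(δ N)`. -/
def IsBigOp {Ω : Type*} [MeasurableSpace Ω] (P : Measure Ω) (Z : ℕ → Ω → ℝ) (δ : ℕ → ℝ) : Prop :=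
  ∀ ε : ℝ, 0 < ε → ∃ M : ℝ, ∀ᶠ N in atTop, P {ω | M * δ N < Z N ω} ≤ ENNReal.ofReal ε

/-- Outer expectation of a bounded function, which need not be measurable. -/
def outerExpectation {Ω : Type*} [MeasurableSpace Ω] (P : Measure Ω) (f : Ω → ℝ) : ℝ :=
  sInf {c | ∃ g : Ω → ℝ, Integrable g P ∧ (∀ ω, f ω ≤ g ω) ∧ c = ∫ ω, g ω ∂P}

/-- The space of bounded functions `S → ℝ × ℝ` with the supremum norm. -/
abbrev LInf (S : Type*) : Type _ := lp (fun _ : S => ℝ × ℝ) ⊤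

open Classical in
/-- A bounded function as an element of `LInf S` (and `0` for an unbounded one). -/
def toLInf {S : Type*} (f : S → ℝ × ℝ) : LInf S :=
  if hf : Memℓp f ⊤ then ⟨f, hf⟩ else 0

/-- Weak convergence (in the sense of Hoffmann-Jørgensen) of the pairs of processes `Z N`, with
index set `S`, to `L` in the space of bounded functions: the sample paths of `Z N` are bounded for
all large `N`, those of `L` are bounded, `L` is Borel measurable with separable range up to null
sets, and the outer expectations of bounded continuous functionals converge. -/
structure WeakConvLInf {Ω Ω' S : Type*} [MeasurableSpace Ω] [MeasurableSpace Ω']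
    (P : Measure Ω) (P' : Measure Ω') (Z : ℕ → Ω → S → ℝ × ℝ) (L : Ω' → S → ℝ × ℝ) : Prop where
  bounded : ∀ᶠ N in atTop, ∀ ω, Memℓp (Z N ω) ⊤
  bounded_limit : ∀ ω, Memℓp (L ω) ⊤
  measurable_limit : AEStronglyMeasurable (fun ω => toLInf (L ω)) P'
  tendsto : ∀ φ : BoundedContinuousFunction (LInf S) ℝ,
    Tendsto (fun N => outerExpectation P (fun ω => φ (toLInf (Z N ω)))) atTop
      (𝓝 (∫ ω, φ (toLInf (L ω)) ∂P'))

/-! ### Rates -/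

/-- Rate conditions of the extreme case for the levels `α`, bandwidths `h`, thresholds `k` and the
rate `δ` of the weight estimator. -/
structure ExtremeRates (α h k δ : ℕ → ℝ) : Prop where
  level_mem : ∀ N, α N ∈ Ioo (0 : ℝ) 1
  level : Tendsto α atTop (𝓝 1)
  bandwidth_pos : ∀ N, 0 < h N
  bandwidth : Tendsto h atTop (𝓝 0)
  threshold : Tendsto k atTop atTop
  extreme : ∃ c : ℝ, 0 ≤ c ∧ Tendsto (fun N : ℕ => N * h N * (1 - α N)) atTop (𝓝 c)
  threshold_fraction : Tendsto (fun N : ℕ => k N / N) atTop (𝓝 0)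
  effective_size : Tendsto (fun N => k N * h N) atTop atTop
  undersmoothing : Tendsto (fun N => k N * h N ^ 3) atTop (𝓝 0)
  weight_rate : Tendsto (fun N => k N * h N * δ N ^ 2) atTop (𝓝 0)
  extrapolation : Tendsto
    (fun N : ℕ => Real.sqrt (k N * h N) / Real.log (k N / (N * (1 - α N)))) atTop atTop

/-- Bias conditions at treatment `t`. The oscillation is taken above a fixed fraction `b < 1` of
the intermediate quantile, so that a neighbourhood of this quantile is covered. -/
structure NegligibleBias {Ω₀ : Type*} [MeasurableSpace Ω₀] (P : Measure Ω₀) (Y : ℝ → Ω₀ → ℝ)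
    (A : ℝ → ℝ → ℝ) (h k : ℕ → ℝ) (t : ℝ) : Prop where
  oscillation : ∃ b ∈ Ioo (0 : ℝ) 1,
    Tendsto (fun N : ℕ => ExtremeTE.oscillation P Y t (b * quantile P Y t (1 - k N / N)) (h N) *
      ENNReal.ofReal |Real.log (k N / N)|) atTop (𝓝 0) ∧
    Tendsto (fun N : ℕ => ENNReal.ofReal (Real.sqrt (k N * h N)) *
      ExtremeTE.oscillation P Y t (b * quantile P Y t (1 - k N / N)) (h N) *
      ENNReal.ofReal |Real.log (k N / N)|) atTop (𝓝 0)
  second_order : Tendsto (fun N : ℕ => Real.sqrt (k N * h N) * A t (N / k N)) atTop (𝓝 0)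

end ExtremeTE

end

/-! Write `s = √(k h)`, `ℓ = log (k / (N (1 - α)))`, `R = k / (N υ (1 - α))` and `G = s (γ̂ - γ)`.
The logarithm of the ratio of the estimated to the true tail mean is the sum of `(γ̂ - γ) log R`,
the log error of the intermediate quantile estimator, `log (1 - γ) - log (1 - γ̂)`, and a
deterministic extrapolation bias. Multiplied by `s / log R`, the first term is exactly `G`, whatever
`υ` is. The other terms need only be `o(ℓ / s)`, since `ℓ ≤ log R ≤ 2 ℓ` for large `N`, uniformly in
`υ ∈ [Δ₀, 1]`, and `ℓ → ∞`. As `ℓ / s → 0`, the whole logarithm tends to zero in probability, so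
exponentiating it adds only a quadratic error. Hence the limit process is constant in `υ`.

Three ingredients carry this. The bias (`exists_tailMean_expansion`): in the variable `x = log y`,
the second-order condition describes the increments of `log F + x / γ` relative to the auxiliary
function. As `ρ < 0`, these increments decay geometrically, so their sums converge and `F z = exp ℓ₀
* z ^ (-1 / γ)` up to a relative error of order `A (1 / F y)`, uniformly over `z ≥ y`. This one
estimate controls both the extreme quantile and the integral defining the tail mean. The condition
is only pointwise in the increment; continuity of `F` and the Baire category theorem supply the
uniformity (`potter_bound`, `limit_of_increments`).

The quantile estimator (`quantileHat_consistent`): no limit law is needed, only a relative error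
below every rate slower than `1 / s`. The estimated survival function being monotone, it suffices to
control it at the two points `q exp (± x)`. The stabilized weights turn the joint law of treatment
and outcome into a product law, so the means of the kernel sums are averages of `F` over treatments
near `t`. Chebyshev's inequality bounds their relative fluctuations by order `1 / s`, and the von
Mises condition converts a relative error of the survival function into one of the quantile.

Weak convergence (`weakConvLInf_of_approx_const`): the embedding of `ℝ × ℝ` as constant functions is
continuous, so the pairs `G` converge weakly as constant processes; uniform approximation in outer
probability then transfers this to the errors. -/

namespace ExtremeTE

/-! ### Asymptotics of increments at infinity -/

/-- A continuous function which is multiplicatively of exponential type at infinity satisfies a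
one-sided Potter bound. -/
lemma potter_bound {g : ℝ → ℝ} (hg : Continuous g) {β : ℝ} (hβ : 0 < β)
    (hg0 : ∀ᶠ x in atTop, g x ≠ 0)
    (h : ∀ u, Tendsto (fun x => g (x + u) / g x) atTop (𝓝 (Real.exp (-β * u)))) :
    ∃ C x₀ : ℝ, 0 ≤ C ∧ ∀ x, x₀ ≤ x → ∀ v, 0 ≤ v → |g (x + v)| ≤ C * |g x| := by
  -- Baire category: these closed sets cover the line because the ratio converges for each fixed
  -- `u`, so one of them contains an interval. This is how a pointwise limit yields a uniform bound.
  let E : ℕ → Set ℝ := fun n => {u | ∀ x, (n : ℝ) ≤ x → |g (x + u)| ≤ n * |g x|}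
  have hE : ∀ n, IsClosed (E n) := by
    intro n
    have : E n = ⋂ x : ℝ, ⋂ _ : (n : ℝ) ≤ x, {u | |g (x + u)| ≤ n * |g x|} := by
      ext u; simp [E]
    rw [this]
    refine isClosed_iInter fun x => isClosed_iInter fun _ => ?_
    exact isClosed_le (by fun_prop) continuous_const
  have hU : ⋃ n, E n = univ := by
    refine eq_univ_of_forall fun u => ?_
    have h1 := (h u).abs.eventually_lt_const (lt_add_one _)
    obtain ⟨x₁, hx₁⟩ := eventually_atTop.1 (h1.and hg0)
    obtain ⟨n, hn⟩ := exists_nat_ge (max x₁ (|Real.exp (-β * u)| + 1))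
    refine mem_iUnion.2 ⟨n, fun x hx => ?_⟩
    obtain ⟨h2, h3⟩ := hx₁ x ((le_max_left _ _).trans (hn.trans hx))
    rw [abs_div, div_lt_iff₀ (abs_pos.2 h3)] at h2
    exact h2.le.trans (mul_le_mul_of_nonneg_right ((le_max_right _ _).trans hn) (abs_nonneg _))
  obtain ⟨n, u₀, hu₀⟩ := nonempty_interior_of_iUnion_of_closed hE hU
  obtain ⟨ε, hε, hball⟩ := Metric.mem_nhds_iff.1 (mem_interior_iff_mem_nhds.1 hu₀)
  set d := ε / 2 with hd
  have hd0 : 0 < d := by positivity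
  have hin : ∀ v, 0 ≤ v → v ≤ d → ∀ x, (n : ℝ) ≤ x → |g (x + (u₀ + v))| ≤ n * |g x| := by
    intro v hv hvd
    apply hball
    rw [Metric.mem_ball, Real.dist_eq, add_sub_cancel_left, abs_of_nonneg hv]
    linarith
  -- The interval lies around an unknown shift `u₀`; this inequality undoes the shift at the cost of
  -- a constant.
  have hlow : ∀ᶠ x in atTop, |g x| ≤ 2 * Real.exp (β * u₀) * |g (x + u₀)| := by
    have hpos : Real.exp (-β * u₀) / 2 < |Real.exp (-β * u₀)| := by
      rw [abs_of_pos (Real.exp_pos _)]; linarith [Real.exp_pos (-β * u₀)]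
    filter_upwards [(h u₀).abs.eventually_const_lt hpos, hg0] with x h2 h3
    rw [abs_div, lt_div_iff₀ (abs_pos.2 h3)] at h2
    have h4 : Real.exp (β * u₀) * Real.exp (-β * u₀) = 1 := by
      rw [← Real.exp_add]; simp
    have h5 := mul_le_mul_of_nonneg_left h2.le (Real.exp_pos (β * u₀)).le
    have h6 : Real.exp (β * u₀) * (Real.exp (-β * u₀) / 2 * |g x|) = |g x| / 2 := by
      linear_combination (|g x| / 2) * h4
    linarith
  -- Since `β > 0`, a step of length `d` eventually does not increase `|g|`; iterating it covers
  -- arbitrarily large `v`.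
  have hstep : ∀ᶠ x in atTop, |g (x + d)| ≤ |g x| := by
    have hlt : |Real.exp (-β * d)| < 1 := by
      rw [abs_of_pos (Real.exp_pos _), Real.exp_lt_one_iff]
      have := mul_pos hβ hd0
      linarith
    filter_upwards [(h d).abs.eventually_lt_const hlt, hg0] with x h2 h3
    rw [abs_div, div_lt_iff₀ (abs_pos.2 h3)] at h2
    linarith
  obtain ⟨x₁, hx₁⟩ := eventually_atTop.1 (hlow.and hstep)
  refine ⟨n * (2 * Real.exp (β * u₀)), max x₁ (max (n : ℝ) x₁ + u₀), by positivity,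
    fun x hx v hv => ?_⟩
  have hxm : ∀ m : ℕ, |g (x + m * d)| ≤ |g x| := by
    intro m
    induction m with
    | zero => simp
    | succ m ih =>
      refine le_trans ?_ ih
      have h2 := (hx₁ (x + m * d) (by
        have : 0 ≤ (m : ℝ) * d := by positivity
        linarith [(le_max_left _ _).trans hx])).2
      have e : x + (m + 1 : ℕ) * d = x + m * d + d := by push_cast; ring
      rwa [e]
  set m := ⌊v / d⌋₊ with hm
  have hm1 : (m : ℝ) * d ≤ v := by
    have := Nat.floor_le (div_nonneg hv hd0.le)
    rwa [le_div_iff₀ hd0] at this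
  have hm2 : v - m * d ≤ d := by
    have := (Nat.lt_floor_add_one (v / d)).le
    rw [div_le_iff₀ hd0] at this
    linarith
  -- Whole steps of length `d` lead to `x + m d`, and the remainder `v - m d ∈ [0, d]` is reached
  -- from `y` by a shift in the Baire interval.
  set y := x + m * d - u₀ with hy
  have hymax : max (n : ℝ) x₁ ≤ y := by
    have : 0 ≤ (m : ℝ) * d := by positivity
    linarith [(le_max_right _ _).trans hx]
  have h2 := hin (v - m * d) (by linarith) hm2 y ((le_max_left _ _).trans hymax)
  have h3 := (hx₁ y ((le_max_right _ _).trans hymax)).1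
  have e1 : y + (u₀ + (v - m * d)) = x + v := by rw [hy]; ring
  have e2 : y + u₀ = x + m * d := by rw [hy]; ring
  rw [e1] at h2
  rw [e2] at h3
  calc |g (x + v)| ≤ n * |g y| := h2
    _ ≤ n * (2 * Real.exp (β * u₀) * |g x|) := by
        gcongr
        exact h3.trans (mul_le_mul_of_nonneg_left (hxm m) (by positivity))
    _ = _ := by ring

/-- A continuous function whose increments are asymptotically `c (1 - exp (-β u)) a` converges,
at a rate given by `a`. -/
lemma limit_of_increments {f a : ℝ → ℝ} (hf : Continuous f) {β c : ℝ} (hβ : 0 < β) (hc : c ≠ 0)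
    (ha : ∀ᶠ x in atTop, a x ≠ 0) (ha0 : Tendsto a atTop (𝓝 0))
    (h : ∀ u, Tendsto (fun x => (f (x + u) - f x) / a x) atTop
      (𝓝 (c * (1 - Real.exp (-β * u))))) :
    ∃ ℓ C x₀ : ℝ, 0 ≤ C ∧ ∀ x, x₀ ≤ x → ∀ y, x ≤ y → |f y - ℓ| ≤ C * |a x| := by
  -- Nothing is known about the regularity of `a`. The unit increments `D` are continuous,
  -- comparable to `a`, and have limiting ratios `exp (-β u)`, so the Potter bound is applied to
  -- them instead.
  set D : ℝ → ℝ := fun x => f (x + 1) - f x with hDdef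
  have hDa : ∀ u, Tendsto (fun x => D (x + u) / a x) atTop
      (𝓝 (c * (1 - Real.exp (-β)) * Real.exp (-β * u))) := by
    intro u
    have h1 := (h (u + 1)).sub (h u)
    have e : c * (1 - Real.exp (-β * (u + 1))) - c * (1 - Real.exp (-β * u)) =
        c * (1 - Real.exp (-β)) * Real.exp (-β * u) := by
      rw [mul_add, mul_one, Real.exp_add]; ring
    rw [e] at h1
    refine h1.congr fun x => ?_
    simp only [hDdef]
    rw [← sub_div, add_assoc]
    ring_nf
  have hb : Real.exp (-β) < 1 := by rw [Real.exp_lt_one_iff]; linarith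
  have hl : c * (1 - Real.exp (-β)) ≠ 0 := mul_ne_zero hc (by linarith)
  have hD1 : Tendsto (fun x => D x / a x) atTop (𝓝 (c * (1 - Real.exp (-β)))) := by
    simpa using hDa 0
  have hD0 : ∀ᶠ x in atTop, D x ≠ 0 := by
    filter_upwards [hD1.eventually_ne hl] with x hx h0
    exact hx (by rw [h0, zero_div])
  have hratio : ∀ u, Tendsto (fun x => D (x + u) / D x) atTop (𝓝 (Real.exp (-β * u))) := by
    intro u
    have h1 := (hDa u).div hD1 hl
    rw [mul_div_cancel_left₀ _ hl] at h1
    refine h1.congr' ?_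
    filter_upwards [ha, hD0] with x h2 h3
    simp only [Pi.div_apply]
    field_simp
  obtain ⟨C₁, x₁, hC₁, hx₁⟩ := potter_bound (g := D) (by fun_prop) hβ hD0 hratio
  obtain ⟨θ, hθ1, hθ2⟩ := exists_between hb
  have hθ0 : 0 < θ := (Real.exp_pos _).trans hθ1
  have hgeo : ∀ᶠ x in atTop, |D (x + 1)| ≤ θ * |D x| := by
    have h1 := (hratio 1).abs
    rw [mul_one, abs_of_pos (Real.exp_pos _)] at h1
    filter_upwards [h1.eventually_lt_const hθ1, hD0] with x h2 h3
    rw [abs_div, div_lt_iff₀ (abs_pos.2 h3)] at h2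
    exact h2.le
  have hDle : ∀ᶠ x in atTop, |D x| ≤ (|c * (1 - Real.exp (-β))| + 1) * |a x| := by
    filter_upwards [hD1.abs.eventually_lt_const (lt_add_one _), ha] with x h2 h3
    rw [abs_div, div_lt_iff₀ (abs_pos.2 h3)] at h2
    exact h2.le
  obtain ⟨x₂, hx₂⟩ := eventually_atTop.1 (hgeo.and hDle)
  have hpow : ∀ x, x₂ ≤ x → ∀ n : ℕ, |D (x + n)| ≤ |D x| * θ ^ n := by
    intro x hx n
    induction n with
    | zero => simp
    | succ n ih =>
      have h2 := (hx₂ (x + n) (by have : (0 : ℝ) ≤ n := by positivity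
                                  linarith)).1
      push_cast
      rw [← add_assoc]
      refine h2.trans ?_
      rw [pow_succ]
      nlinarith
  have hdist : ∀ x, x₂ ≤ x → ∀ n : ℕ,
      dist (f (x + n)) (f (x + (n + 1 : ℕ))) ≤ |D x| * θ ^ n := by
    intro x hx n
    rw [dist_comm, Real.dist_eq]
    have := hpow x hx n
    simp only [hDdef] at this ⊢
    push_cast
    rwa [← add_assoc]
  have hlim : ∀ x, x₂ ≤ x → ∃ l, Tendsto (fun n : ℕ => f (x + n)) atTop (𝓝 l) := fun x hx =>
    cauchySeq_tendsto_of_complete (cauchySeq_of_le_geometric θ _ hθ2 (hdist x hx))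
  obtain ⟨ℓ, hℓ⟩ := hlim x₂ le_rfl
  -- The limit along `x + ℕ` does not depend on `x`: two such sequences differ by an increment of
  -- `f` over a fixed length, which is of the order of `a` and so vanishes.
  have hconst : ∀ x, Tendsto (fun n : ℕ => f (x + n)) atTop (𝓝 ℓ) := by
    intro x
    have ht : Tendsto (fun n : ℕ => x₂ + (n : ℝ)) atTop atTop :=
      tendsto_atTop_add_const_left _ _ tendsto_natCast_atTop_atTop
    have h1 := ((h (x - x₂)).mul ha0).comp ht
    rw [mul_zero] at h1
    have h2 : Tendsto (fun n : ℕ => f (x + n) - f (x₂ + n)) atTop (𝓝 0) := by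
      refine h1.congr' ?_
      filter_upwards [ht.eventually ha] with n hn
      simp only [Function.comp]
      rw [div_mul_cancel₀ _ hn]
      congr 2; ring
    simpa using h2.add hℓ
  refine ⟨ℓ, C₁ * (|c * (1 - Real.exp (-β))| + 1) / (1 - θ), max x₁ x₂, ?_, fun x hx y hxy => ?_⟩
  · have : 0 < 1 - θ := by linarith
    positivity
  have hxx₂ := (le_max_right _ _).trans hx
  -- The geometric series bounds the distance of `f y` to the limit by `|D y| / (1 - θ)`; the Potter
  -- bound passes from `D y` back to `D x`, which is comparable to `a x`.
  have h2 := dist_le_of_le_geometric_of_tendsto₀ θ _ hθ2 (hdist y (hxx₂.trans hxy)) (hconst y)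
  rw [Nat.cast_zero, add_zero, Real.dist_eq] at h2
  have h3 := hx₁ x ((le_max_left _ _).trans hx) (y - x) (by linarith)
  rw [add_sub_cancel] at h3
  have h4 := (hx₂ x hxx₂).2
  have h5 : 0 < 1 - θ := by linarith
  refine h2.trans ?_
  rw [div_mul_eq_mul_div, mul_assoc]
  gcongr
  exact h3.trans (by gcongr)


/-! ### Regular variation of a survival function -/

/-- Two-sided Potter bounds from the von Mises condition. -/
lemma von_mises_bounds {F : ℝ → ℝ} (hF : ContDiff ℝ 1 F) (hpos : ∀ y, 0 < F y) {κ a b : ℝ}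
    (h : Tendsto (fun y => y * (-deriv F y) / F y) atTop (𝓝 κ)) (ha : a < κ) (hb : κ < b) :
    ∃ y₀ : ℝ, 0 < y₀ ∧ ∀ y z, y₀ ≤ y → y ≤ z →
      a * (Real.log z - Real.log y) ≤ Real.log (F y) - Real.log (F z) ∧
      Real.log (F y) - Real.log (F z) ≤ b * (Real.log z - Real.log y) := by
  obtain ⟨y₁, hy₁⟩ := eventually_atTop.1 ((h.eventually_const_lt ha).and (h.eventually_lt_const hb))
  have hdiff : ∀ x, DifferentiableAt ℝ F x := fun x => (hF.differentiable one_ne_zero) x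
  -- The von Mises ratio is minus the derivative of `log F` with respect to `log x`. Hence adding `a
  -- log x` makes `log F` decreasing, and adding `b log x` makes it increasing.
  have hderiv : ∀ c x, 0 < x → HasDerivAt (fun x => Real.log (F x) + c * Real.log x)
      (deriv F x / F x + c * x⁻¹) x := fun c x hx =>
    ((hdiff x).hasDerivAt.log (hpos x).ne').add ((Real.hasDerivAt_log hx.ne').const_mul c)
  refine ⟨max y₁ 1, by positivity, fun y z hy hyz => ?_⟩
  have hS : ∀ x ∈ Ici (max y₁ 1), 0 < x := fun x hx =>
    one_pos.trans_le ((le_max_right _ _).trans hx)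
  have hcont : ∀ c, ContinuousOn (fun x => Real.log (F x) + c * Real.log x) (Ici (max y₁ 1)) :=
    fun c x hx => (hderiv c x (hS x hx)).continuousAt.continuousWithinAt
  have hA : AntitoneOn (fun x => Real.log (F x) + a * Real.log x) (Ici (max y₁ 1)) := by
    refine antitoneOn_of_deriv_nonpos (convex_Ici _) (hcont a) ?_ ?_
    · intro x hx
      exact (hderiv a x (hS x (interior_subset hx))).differentiableAt.differentiableWithinAt
    · intro x hx
      have hx0 := hS x (interior_subset hx)
      rw [(hderiv a x hx0).deriv]
      have h1 := (hy₁ x ((le_max_left _ _).trans (interior_subset hx))).1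
      rw [lt_div_iff₀ (hpos x)] at h1
      have h2 : deriv F x / F x + a * x⁻¹ = (a * F x - x * -deriv F x) / (F x * x) := by
        have := (hpos x).ne'
        field_simp; ring
      rw [h2]
      exact div_nonpos_of_nonpos_of_nonneg (by linarith) (mul_pos (hpos x) hx0).le
  have hB : MonotoneOn (fun x => Real.log (F x) + b * Real.log x) (Ici (max y₁ 1)) := by
    refine monotoneOn_of_deriv_nonneg (convex_Ici _) (hcont b) ?_ ?_
    · intro x hx
      exact (hderiv b x (hS x (interior_subset hx))).differentiableAt.differentiableWithinAt
    · intro x hx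
      have hx0 := hS x (interior_subset hx)
      rw [(hderiv b x hx0).deriv]
      have h1 := (hy₁ x ((le_max_left _ _).trans (interior_subset hx))).2
      rw [div_lt_iff₀ (hpos x)] at h1
      have h2 : deriv F x / F x + b * x⁻¹ = (b * F x - x * -deriv F x) / (F x * x) := by
        have := (hpos x).ne'
        field_simp; ring
      rw [h2]
      exact div_nonneg (by linarith) (mul_pos (hpos x) hx0).le
  have h1 := hA hy (le_trans hy hyz : max y₁ 1 ≤ z) hyz
  have h2 := hB hy (le_trans hy hyz : max y₁ 1 ≤ z) hyz
  simp only at h1 h2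
  constructor <;> linarith

/-- Under the second-order condition, `F z ≈ exp ℓ * z ^ (-1 / γ)` with relative error, uniformly
over `z ≥ y`, of the order of the auxiliary function at `1 / F y`. -/
lemma second_order_uniform {F A : ℝ → ℝ} (hF : Continuous F) (hpos : ∀ y, 0 < F y)
    (hF0 : Tendsto F atTop (𝓝 0)) {γ ρ : ℝ} (hγ : 0 < γ) (hρ : ρ < 0)
    (hA : ∀ᶠ y in atTop, A y ≠ 0) (hA0 : Tendsto A atTop (𝓝 0))
    (h : ∀ z : ℝ, 0 < z → Tendsto (fun y => (F (z * y) / F y - z ^ (-1 / γ)) / A (1 / F y)) atTop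
      (𝓝 (z ^ (-1 / γ) * ((z ^ (ρ / γ) - 1) / (γ * ρ))))) :
    ∃ ℓ C y₀ : ℝ, 0 ≤ C ∧ 0 < y₀ ∧ ∀ y z, y₀ ≤ y → y ≤ z →
      |Real.log (F z) + Real.log z / γ - ℓ| ≤ C * |A (1 / F y)| := by
  have hinv : Tendsto (fun y => 1 / F y) atTop atTop := by
    simp only [one_div]
    exact (tendsto_nhdsWithin_iff.2 ⟨hF0, .of_forall hpos⟩).inv_tendsto_nhdsGT_zero
  have hexp := Real.tendsto_exp_atTop
  have key : ∀ u : ℝ, Tendsto (fun x => ((Real.log (F (Real.exp (x + u))) + (x + u) / γ) -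
      (Real.log (F (Real.exp x)) + x / γ)) / A (1 / F (Real.exp x))) atTop
      (𝓝 ((-(1 / (γ * ρ))) * (1 - Real.exp (-(-ρ / γ) * u)))) := by
    intro u
    set z := Real.exp u with hz
    have hz0 : 0 < z := Real.exp_pos u
    have hp : 0 < z ^ (-1 / γ) := Real.rpow_pos_of_pos hz0 _
    set v : ℝ → ℝ := fun y => F (z * y) / F y / z ^ (-1 / γ) with hv
    have h1 : Tendsto (fun y => (v y - 1) / A (1 / F y)) atTop
        (𝓝 ((z ^ (ρ / γ) - 1) / (γ * ρ))) := by
      have := (h z hz0).div_const (z ^ (-1 / γ))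
      rw [mul_div_cancel_left₀ _ hp.ne'] at this
      refine this.congr fun y => ?_
      simp only [hv]
      field_simp
    have hv1 : Tendsto v atTop (𝓝 1) := by
      have h2 := (h1.mul (hA0.comp hinv)).add_const 1
      rw [mul_zero, zero_add] at h2
      refine h2.congr' ?_
      filter_upwards [hinv.eventually hA] with y hy
      simp only [Function.comp]
      rw [div_mul_cancel₀ _ hy]; ring
    -- Writing `log v = (v - 1) * dslope log 1 v` linearizes the logarithm without a division by `v
    -- - 1`, which may vanish.
    have hlog : Tendsto (fun y => dslope Real.log 1 (v y)) atTop (𝓝 1) := by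
      have hc : ContinuousAt (dslope Real.log 1) 1 :=
        continuousAt_dslope_same.2 (Real.differentiableAt_log one_ne_zero)
      have := hc.tendsto.comp hv1
      rw [dslope_same, Real.deriv_log, inv_one] at this
      exact this
    have h3 := ((h1.mul hlog).comp hexp)
    have e : (z ^ (ρ / γ) - 1) / (γ * ρ) * 1 =
        (-(1 / (γ * ρ))) * (1 - Real.exp (-(-ρ / γ) * u)) := by
      have : z ^ (ρ / γ) = Real.exp (-(-ρ / γ) * u) := by
        rw [hz, ← Real.exp_mul]; congr 1; ring
      rw [this]; ring
    rw [e] at h3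
    refine h3.congr fun x => ?_
    have h4 := sub_smul_dslope Real.log 1 (v (Real.exp x))
    rw [smul_eq_mul, Real.log_one, sub_zero] at h4
    simp only [Function.comp]
    rw [div_mul_eq_mul_div, h4]
    congr 1
    simp only [hv]
    have e1 : z * Real.exp x = Real.exp (x + u) := by rw [hz, ← Real.exp_add]; ring_nf
    rw [e1, Real.log_div (div_pos (hpos _) (hpos _)).ne' hp.ne',
      Real.log_div (hpos _).ne' (hpos _).ne', Real.log_rpow hz0, hz, Real.log_exp]
    ring
  have hc : -(1 / (γ * ρ)) ≠ 0 := by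
    have : γ * ρ ≠ 0 := mul_ne_zero hγ.ne' hρ.ne
    simp [hγ.ne', hρ.ne]
  have hβ : 0 < -ρ / γ := div_pos (by linarith) hγ
  have hfc : Continuous (fun x => Real.log (F (Real.exp x)) + x / γ) := by
    have : Continuous fun x => Real.log (F (Real.exp x)) :=
      (hF.comp Real.continuous_exp).log fun x => (hpos _).ne'
    fun_prop
  obtain ⟨ℓ, C, x₀, hC, H⟩ := limit_of_increments hfc hβ hc
    ((hinv.comp hexp).eventually hA) (hA0.comp (hinv.comp hexp)) key
  refine ⟨ℓ, C, Real.exp x₀, hC, Real.exp_pos _, fun y z hy hyz => ?_⟩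
  have hy0 : 0 < y := (Real.exp_pos _).trans_le hy
  have hz0 : 0 < z := hy0.trans_le hyz
  have := H (Real.log y) ((Real.le_log_iff_exp_le hy0).2 hy) (Real.log z)
    (Real.log_le_log hy0 hyz)
  simpa [Real.exp_log hy0, Real.exp_log hz0] using this

/-! ### Survival and quantile functions -/

section Survival

variable {Ω₀ : Type*} [MeasurableSpace Ω₀] {P : Measure Ω₀} [IsProbabilityMeasure P]
  {Y : ℝ → Ω₀ → ℝ} {t : ℝ}

lemma survival_antitone : Antitone (survival P Y t) := fun _ _ hab =>
  measureReal_mono fun _ hω => le_trans hab hω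

lemma survival_le_one (y : ℝ) : survival P Y t y ≤ 1 := measureReal_le_one

/-- Continuity excludes atoms: `P (Y > y)` is squeezed between `P (Y ≥ y)` and its values at `z > y`
close to `y`. Weak and strict exceedances thus have the same probability. -/
lemma survival_eq_one_sub_cdf (hY : Measurable (Y t)) (hc : Continuous (survival P Y t)) (y : ℝ) :
    survival P Y t y = 1 - cdf (P.map (Y t)) y := by
  have : IsProbabilityMeasure (P.map (Y t)) := Measure.isProbabilityMeasure_map hY.aemeasurable
  have hlt : ∀ y, P.real {ω | y < Y t ω} = 1 - cdf (P.map (Y t)) y := by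
    intro y
    rw [cdf_eq_real, map_measureReal_apply hY measurableSet_Iic, ← probReal_compl_eq_one_sub
      (hY measurableSet_Iic)]
    congr 1; ext ω; simp
  have h1 : 1 - cdf (P.map (Y t)) y ≤ survival P Y t y := by
    rw [← hlt]; exact measureReal_mono fun ω (hω : y < Y t ω) => hω.le
  refine le_antisymm ?_ h1
  have h2 : ∀ z, y < z → survival P Y t z ≤ 1 - cdf (P.map (Y t)) y := by
    intro z hz
    rw [← hlt]; exact measureReal_mono fun ω hω => lt_of_lt_of_le hz hω
  exact le_of_tendsto (hc.continuousAt.tendsto.mono_left nhdsWithin_le_nhds)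
    (eventually_nhdsWithin_of_forall (s := Ioi y) h2)

lemma measure_lt_eq_survival (hY : Measurable (Y t)) (hc : Continuous (survival P Y t)) (y : ℝ) :
    P {ω | y < Y t ω} = ENNReal.ofReal (survival P Y t y) := by
  have : IsProbabilityMeasure (P.map (Y t)) := Measure.isProbabilityMeasure_map hY.aemeasurable
  rw [survival_eq_one_sub_cdf hY hc, cdf_eq_real, map_measureReal_apply hY measurableSet_Iic,
    ← probReal_compl_eq_one_sub (hY measurableSet_Iic), ofReal_measureReal]
  congr 1; ext ω; simp

lemma survival_tendsto_atTop (hY : Measurable (Y t)) (hc : Continuous (survival P Y t)) :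
    Tendsto (survival P Y t) atTop (𝓝 0) := by
  have h := (tendsto_cdf_atTop (P.map (Y t))).const_sub 1
  rw [sub_self] at h
  exact h.congr fun y => (survival_eq_one_sub_cdf hY hc y).symm

lemma survival_tendsto_atBot (hY : Measurable (Y t)) (hc : Continuous (survival P Y t)) :
    Tendsto (survival P Y t) atBot (𝓝 1) := by
  have h := (tendsto_cdf_atBot (P.map (Y t))).const_sub 1
  rw [sub_zero] at h
  exact h.congr fun y => (survival_eq_one_sub_cdf hY hc y).symm

/-- Where the survival function is zero, the von Mises ratio is zero by the convention for division,
which its positive limit forbids far out; monotonicity does the rest. -/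
lemma survival_pos {γ : ℝ → ℝ} (hγ : HeavyTails P Y γ) (ht : t ∈ treatments) (y : ℝ) :
    0 < survival P Y t y := by
  have h1 : (0 : ℝ) < 1 / γ t := one_div_pos.2 (hγ.index_pos t ht)
  obtain ⟨z, hz, hyz⟩ := (((hγ.von_mises t ht).eventually_ne h1.ne').and
    (eventually_ge_atTop y)).exists
  have hz0 : 0 < survival P Y t z :=
    lt_of_le_of_ne measureReal_nonneg fun h0 => hz (by rw [← h0, div_zero])
  exact hz0.trans_le (survival_antitone hyz)

/-- The infimum is attained because the sublevel set is closed; to its left the survival function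
exceeds `p`, and continuity gives the reverse inequality. -/
lemma survival_quantile (hY : Measurable (Y t)) (hc : Continuous (survival P Y t)) {p : ℝ}
    (hp0 : 0 < p) (hp1 : p < 1) : survival P Y t (quantile P Y t (1 - p)) = p := by
  set S := {y | survival P Y t y ≤ 1 - (1 - p)} with hS
  have hS' : S = {y | survival P Y t y ≤ p} := by rw [hS, sub_sub_cancel]
  have hclosed : IsClosed S := by rw [hS']; exact isClosed_le hc continuous_const
  obtain ⟨z, hz⟩ := ((survival_tendsto_atBot hY hc).eventually_const_lt hp1).exists
  have hbdd : BddBelow S := ⟨z, fun y hy => by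
    rw [hS'] at hy
    by_contra hlt
    exact absurd (survival_antitone (P := P) (Y := Y) (t := t) (not_le.1 hlt).le)
      (not_le.2 (lt_of_le_of_lt hy hz))⟩
  obtain ⟨w, hw⟩ := ((survival_tendsto_atTop hY hc).eventually_lt_const hp0).exists
  have hne : S.Nonempty := ⟨w, by rw [hS']; exact hw.le⟩
  have hmem : quantile P Y t (1 - p) ∈ S := hclosed.csInf_mem hne hbdd
  rw [hS'] at hmem
  refine le_antisymm hmem ?_
  refine ge_of_tendsto (hc.continuousAt.tendsto.mono_left nhdsWithin_le_nhds)
    (eventually_nhdsWithin_of_forall (s := Iio (quantile P Y t (1 - p))) fun y hy => ?_)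
  by_contra hlt
  have : y ∈ S := by rw [hS']; exact (not_le.1 hlt).le
  exact absurd (csInf_le hbdd this) (not_le.2 hy)

lemma lt_quantile_of_lt (hY : Measurable (Y t)) (hc : Continuous (survival P Y t)) {p y : ℝ}
    (hp0 : 0 < p) (hp1 : p < 1) (h : p < survival P Y t y) : y < quantile P Y t (1 - p) := by
  by_contra hle
  have := survival_antitone (P := P) (Y := Y) (t := t) (not_lt.1 hle)
  rw [survival_quantile hY hc hp0 hp1] at this
  exact absurd this (not_le.2 h)

lemma quantile_antitone (hY : Measurable (Y t)) (hc : Continuous (survival P Y t)) {p p' : ℝ}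
    (hp0 : 0 < p) (hpp : p ≤ p') (hp1 : p' < 1) :
    quantile P Y t (1 - p') ≤ quantile P Y t (1 - p) := by
  rcases hpp.eq_or_lt with rfl | hlt
  · rfl
  by_contra hle
  have := survival_antitone (P := P) (Y := Y) (t := t) (not_le.1 hle).le
  rw [survival_quantile hY hc hp0 (hlt.trans hp1),
    survival_quantile hY hc (hp0.trans hlt) hp1] at this
  linarith

/-- The tail mean above `q`, when the survival function is `exp ℓ * z ^ (-1 / γ)` above `q` up to
a relative error. -/
lemma tailMean_bounds (hY : Measurable (Y t)) (hc : Continuous (survival P Y t))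
    (hpos : ∀ y, 0 < survival P Y t y) {a γ ℓ η : ℝ} (hγ : 0 < γ) (hγ1 : γ < 1)
    (hq : 0 < quantile P Y t a)
    (h : ∀ z, quantile P Y t a ≤ z →
      |Real.log (survival P Y t z) + Real.log z / γ - ℓ| ≤ η) :
    quantile P Y t a / (1 - γ) * Real.exp (-(2 * η)) ≤ tailMean P Y t a ∧
      tailMean P Y t a ≤ quantile P Y t a / (1 - γ) * Real.exp (2 * η) := by
  set q := quantile P Y t a with hqdef
  set F := survival P Y t with hF
  have hη : 0 ≤ η := (abs_nonneg _).trans (h q le_rfl)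
  -- The factor is `2 η` because the approximation is used twice, at `z` and at `q`, which also
  -- eliminates `ℓ`.
  have hratio : ∀ z, q ≤ z → F q * (z / q) ^ (-1 / γ) * Real.exp (-(2 * η)) ≤ F z ∧
      F z ≤ F q * (z / q) ^ (-1 / γ) * Real.exp (2 * η) := by
    intro z hz
    have hz0 : 0 < z := hq.trans_le hz
    have h1 := abs_le.1 (h z hz)
    have h2 := abs_le.1 (h q le_rfl)
    have e : F q * (z / q) ^ (-1 / γ) =
        Real.exp (Real.log (F q) + (Real.log q / γ - Real.log z / γ)) := by
      rw [Real.exp_add, Real.exp_log (hpos q), Real.rpow_def_of_pos (div_pos hz0 hq),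
        Real.log_div hz0.ne' hq.ne']
      congr 2; ring
    rw [e, ← Real.exp_add, ← Real.exp_add]
    constructor
    · rw [← Real.le_log_iff_exp_le (hpos z)]; linarith
    · rw [← Real.log_le_iff_le_exp (hpos z)]; linarith
  -- The tail mean is `q` plus the mean excess, and the layer-cake formula turns the mean excess
  -- into an integral of the survival function.
  set f : Ω₀ → ℝ := fun ω => max (Y t ω - q) 0 with hf
  have hfm : Measurable f := (hY.sub_const q).max measurable_const
  have hf0 : ∀ ω, 0 ≤ f ω := fun ω => le_max_right _ _
  have hlayer : ∫⁻ ω, ENNReal.ofReal (f ω) ∂P = ∫⁻ z in Ioi q, ENNReal.ofReal (F z) := by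
    rw [lintegral_eq_lintegral_meas_le P (.of_forall hf0) hfm.aemeasurable]
    have hp := (measurePreserving_add_left (volume : Measure ℝ) q).setLIntegral_comp_preimage
      (f := fun z => ENNReal.ofReal (F z)) (measurableSet_Ioi (a := q))
      hc.measurable.ennreal_ofReal
    rw [← hp]
    have e : (fun x => q + x) ⁻¹' Ioi q = Ioi 0 := by ext x; simp
    rw [e]
    refine setLIntegral_congr_fun measurableSet_Ioi fun s hs => ?_
    simp only [mem_Ioi] at hs
    have e2 : {ω | s ≤ f ω} = {ω | q + s ≤ Y t ω} := by
      ext ω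
      simp only [mem_ofPred_eq, hf, le_max_iff, not_le.2 hs, or_false]
      constructor <;> intro <;> linarith
    simp only [e2, hF, survival]
    rw [ofReal_measureReal]
  have hexp : -1 / γ < -1 := by
    rw [div_lt_iff₀ hγ]; linarith
  have hg_int : IntegrableOn (fun z : ℝ => (z / q) ^ (-1 / γ)) (Ioi q) := by
    refine IntegrableOn.congr_fun
      (Integrable.mul_const (integrableOn_Ioi_rpow_of_lt hexp hq) ((q ^ (-1 / γ))⁻¹))
      (fun z hz => ?_) measurableSet_Ioi
    rw [Real.div_rpow (hq.trans hz).le hq.le]; rfl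
  have hg : ∫ z in Ioi q, (z / q) ^ (-1 / γ) = q * γ / (1 - γ) := by
    have e : ∫ z in Ioi q, (z / q) ^ (-1 / γ) = ∫ z in Ioi q, z ^ (-1 / γ) * (q ^ (-1 / γ))⁻¹ :=
      setIntegral_congr_fun measurableSet_Ioi fun z hz => by
        rw [Real.div_rpow (hq.trans hz).le hq.le]; rfl
    rw [e, integral_mul_const, integral_Ioi_rpow_of_lt hexp hq, Real.rpow_add hq, Real.rpow_one]
    have h1 : q ^ (-1 / γ) ≠ 0 := (Real.rpow_pos_of_pos hq _).ne'
    have h2 : 1 - γ ≠ 0 := by linarith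
    have h3 : -1 / γ + 1 = -((1 - γ) / γ) := by field_simp; ring
    rw [h3]
    field_simp
  have hlin : ∀ c : ℝ, 0 ≤ c → ∫⁻ z in Ioi q, ENNReal.ofReal (F q * (z / q) ^ (-1 / γ) * c) =
      ENNReal.ofReal (F q * (q * γ / (1 - γ)) * c) := by
    intro c hc0
    rw [← ofReal_integral_eq_lintegral_ofReal ((hg_int.const_mul _).mul_const _)]
    · rw [integral_mul_const, integral_const_mul, hg]
    · refine (ae_restrict_mem measurableSet_Ioi).mono fun z hz => ?_
      have := (hpos q).le
      have := Real.rpow_nonneg (div_nonneg (hq.trans hz).le hq.le) (-1 / γ)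
      simp only [Pi.zero_apply]
      positivity
  have hlower : ENNReal.ofReal (F q * (q * γ / (1 - γ)) * Real.exp (-(2 * η))) ≤
      ∫⁻ ω, ENNReal.ofReal (f ω) ∂P := by
    rw [hlayer, ← hlin _ (Real.exp_pos _).le]
    exact setLIntegral_mono (hc.measurable.ennreal_ofReal) fun z hz =>
      ENNReal.ofReal_le_ofReal (hratio z (le_of_lt hz)).1
  have hupper : ∫⁻ ω, ENNReal.ofReal (f ω) ∂P ≤
      ENNReal.ofReal (F q * (q * γ / (1 - γ)) * Real.exp (2 * η)) := by
    rw [hlayer, ← hlin _ (Real.exp_pos _).le]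
    refine setLIntegral_mono (by fun_prop) fun z hz =>
      ENNReal.ofReal_le_ofReal (hratio z (le_of_lt hz)).2
  have hfi : Integrable f P := by
    refine ⟨hfm.aestronglyMeasurable, ?_⟩
    rw [hasFiniteIntegral_iff_ofReal (.of_forall hf0)]
    exact hupper.trans_lt ENNReal.ofReal_lt_top
  have hg1 : 0 < 1 - γ := by linarith
  have hI0 : 0 ≤ F q * (q * γ / (1 - γ)) := by have := (hpos q).le; positivity
  have hint : ENNReal.ofReal (∫ ω, f ω ∂P) = ∫⁻ ω, ENNReal.ofReal (f ω) ∂P :=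
    ofReal_integral_eq_lintegral_ofReal hfi (.of_forall hf0)
  rw [← hint] at hlower hupper
  have hlo := (ENNReal.ofReal_le_ofReal_iff (integral_nonneg hf0)).1 hlower
  have hup := (ENNReal.ofReal_le_ofReal_iff (by positivity)).1 hupper
  set S := {ω | q < Y t ω} with hS
  have hSm : MeasurableSet S := measurableSet_lt measurable_const hY
  have hSP : P S = ENNReal.ofReal (F q) := measure_lt_eq_survival hY hc q
  have hTM : tailMean P Y t a = q + (F q)⁻¹ * ∫ ω, f ω ∂P := by
    rw [tailMean, ProbabilityTheory.cond, integral_smul_measure, ← hqdef, hSP, ENNReal.toReal_inv,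
      ENNReal.toReal_ofReal (hpos q).le, smul_eq_mul]
    have e1 : ∫ ω in S, Y t ω ∂P = ∫ ω in S, (q + f ω) ∂P :=
      setIntegral_congr_fun hSm fun ω hω => by
        have : q < Y t ω := hω
        simp only [hf]
        rw [max_eq_left (by linarith)]; ring
    have e2 : ∫ ω in S, f ω ∂P = ∫ ω, f ω ∂P :=
      setIntegral_eq_integral_of_forall_compl_eq_zero fun ω hω => by
        have : ¬ q < Y t ω := hω
        simp only [hf]
        exact max_eq_right (by linarith)
    rw [e1, integral_add (integrable_const _) hfi.integrableOn, e2, setIntegral_const,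
      measureReal_def, hSP, ENNReal.toReal_ofReal (hpos q).le, smul_eq_mul, mul_add,
      inv_mul_cancel_left₀ (hpos q).ne']
  have hF0 := hpos q
  -- The tail mean is thus bounded by `q / (1 - γ)` times a convex combination of `1` and `c`,
  -- itself at least `c` if `c ≤ 1` and at most `c` if `c ≥ 1`.
  have hsum : ∀ c : ℝ, q + (F q)⁻¹ * (F q * (q * γ / (1 - γ)) * c) =
      q * ((1 - γ) + γ * c) / (1 - γ) := by
    intro c
    have := hF0.ne'
    field_simp
  have hlo' : q * ((1 - γ) + γ * Real.exp (-(2 * η))) / (1 - γ) ≤ tailMean P Y t a := by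
    rw [hTM, ← hsum]; gcongr
  have hup' : tailMean P Y t a ≤ q * ((1 - γ) + γ * Real.exp (2 * η)) / (1 - γ) := by
    rw [hTM, ← hsum]; gcongr
  have he1 : Real.exp (-(2 * η)) ≤ 1 := Real.exp_le_one_iff.2 (by linarith)
  have he2 : 1 ≤ Real.exp (2 * η) := Real.one_le_exp (by linarith)
  constructor
  · refine le_trans ?_ hlo'
    rw [div_mul_eq_mul_div]
    gcongr
    nlinarith
  · refine hup'.trans ?_
    rw [div_mul_eq_mul_div]
    gcongr
    nlinarith

end Survival


/-! ### Weighting by the stabilized weights removes confounding -/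

/-- Conditional independence of the events `A` and `B` given `m`, integrated over an event of
`m`. -/
lemma measure_inter_of_condIndep {Ω₀ : Type*} {m mΩ : MeasurableSpace Ω₀} {P : Measure Ω₀}
    [IsProbabilityMeasure P] (hm : m ≤ mΩ) {A B C : Set Ω₀}
    (hA : MeasurableSet A) (hB : MeasurableSet B) (hC : MeasurableSet[m] C)
    (h : P[(A ∩ B).indicator (fun _ => (1 : ℝ)) | m] =ᵐ[P]
        P[A.indicator (fun _ => (1 : ℝ)) | m] * P[B.indicator (fun _ => (1 : ℝ)) | m]) :
    P (C ∩ A ∩ B) =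
      ∫⁻ ω in C ∩ A, ENNReal.ofReal ((P[B.indicator (fun _ => (1 : ℝ)) | m]) ω) ∂P := by
  set G := P[B.indicator (fun _ => (1 : ℝ)) | m] with hG
  have hGm : StronglyMeasurable[m] G := stronglyMeasurable_condExp
  have hG0 : 0 ≤ᵐ[P] G :=
    condExp_nonneg (.of_forall fun ω => indicator_nonneg (fun _ _ => zero_le_one) ω)
  have e2 : A.indicator (fun _ => (1 : ℝ)) * G = A.indicator G := by
    ext ω; by_cases hω : ω ∈ A <;> simp [hω]
  have hAint : Integrable (A.indicator (fun _ => (1 : ℝ))) P := (integrable_const _).indicator hA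
  have hAG : Integrable (A.indicator (fun _ => (1 : ℝ)) * G) P := by
    rw [e2]; exact integrable_condExp.indicator hA
  have e1 : ∫ ω in C, (A ∩ B).indicator (fun _ => (1 : ℝ)) ω ∂P =
      ∫ ω in C, (A.indicator (fun _ => (1 : ℝ)) * G) ω ∂P := by
    rw [← setIntegral_condExp hm ((integrable_const _).indicator (hA.inter hB)) hC,
      ← setIntegral_condExp hm hAG hC]
    refine integral_congr_ae (ae_restrict_of_ae ?_)
    exact h.trans (condExp_mul_of_stronglyMeasurable_right hGm hAG hAint).symm
  rw [e2, setIntegral_indicator hA, setIntegral_indicator (hA.inter hB), setIntegral_const,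
    smul_eq_mul, mul_one] at e1
  rw [inter_assoc, ← ofReal_measureReal, e1,
    ofReal_integral_eq_lintegral_ofReal integrable_condExp.integrableOn (ae_restrict_of_ae hG0)]

section Unconfounding

variable {r : ℕ} {Ω₀ : Type*} [MeasurableSpace Ω₀] {P : Measure Ω₀} [IsProbabilityMeasure P]
  {T : Ω₀ → ℝ} {X : Ω₀ → Cov r}

/-- Conditional independence: the law of `(T, X)` on an event `B` has, with respect to the law of
`(T, X)`, a density which is a function of `X`. -/
lemma exists_density_of_condIndep (hT : Measurable T) (hX : Measurable X) {B : Set Ω₀}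
    (hB : MeasurableSet B)
    (h : ∀ A : Set ℝ, MeasurableSet A →
      P[(T ⁻¹' A ∩ B).indicator (fun _ => (1 : ℝ)) | MeasurableSpace.comap X inferInstance] =ᵐ[P]
        P[(T ⁻¹' A).indicator (fun _ => (1 : ℝ)) | MeasurableSpace.comap X inferInstance] *
          P[B.indicator (fun _ => (1 : ℝ)) | MeasurableSpace.comap X inferInstance]) :
    ∃ g : Cov r → ℝ≥0∞, Measurable g ∧
      (P.restrict B).map (fun ω => (T ω, X ω)) =
        (P.withDensity (fun ω => g (X ω))).map (fun ω => (T ω, X ω)) := by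
  -- A function measurable for the sigma-algebra of `X` factors through `X`: the density is the
  -- conditional probability of `B`.
  obtain ⟨g, hg, hgG⟩ := (stronglyMeasurable_condExp (μ := P)
    (m := MeasurableSpace.comap X inferInstance)
    (f := B.indicator (fun _ => (1 : ℝ)))).measurable.exists_eq_measurable_comp
  have hTX : Measurable (fun ω => (T ω, X ω)) := hT.prodMk hX
  refine ⟨fun x => ENNReal.ofReal (g x), hg.ennreal_ofReal, Measure.ext_prod fun {A C} hA hC => ?_⟩
  have hpre : (fun ω => (T ω, X ω)) ⁻¹' A ×ˢ C = X ⁻¹' C ∩ T ⁻¹' A := by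
    ext ω; simp [and_comm]
  rw [Measure.map_apply hTX (hA.prod hC), Measure.map_apply hTX (hA.prod hC), hpre,
    Measure.restrict_apply ((hX hC).inter (hT hA)), withDensity_apply _ ((hX hC).inter (hT hA)),
    measure_inter_of_condIndep hX.comap_le (hT hA) hB ⟨C, hC, rfl⟩ (h A hA)]
  refine lintegral_congr fun ω => ?_
  rw [hgG]; rfl

/-- A version of the stabilized weight which is measurable on the whole space. -/
noncomputable def weight (fT : ℝ → ℝ) (fTX : ℝ → Cov r → ℝ) (t : ℝ) (x : Cov r) : ℝ :=
  stabWeight (treatments.indicator fT) fTX t x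

lemma measurable_weight {fT : ℝ → ℝ} {fTX : ℝ → Cov r → ℝ}
    (hfT : ContinuousOn fT treatments) (hfTX : Measurable (Function.uncurry fTX)) :
    Measurable (Function.uncurry (weight fT fTX)) := by
  have h1 : Measurable (treatments.indicator fT) := by
    refine measurable_of_restrict_of_restrict_compl (s := treatments) measurableSet_Icc ?_ ?_
    · have e : treatments.domRestrict (treatments.indicator fT) = treatments.domRestrict fT :=
        funext fun x => indicator_of_mem x.2 _
      rw [e]; exact hfT.domRestrict.measurable
    · have e : treatmentsᶜ.domRestrict (treatments.indicator fT) = fun _ => 0 :=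
        funext fun x => indicator_of_notMem x.2 _
      rw [e]; exact measurable_const
  exact (h1.comp measurable_fst).div hfTX

lemma treatment_mem_ae {P : Measure Ω₀} {fT : ℝ → ℝ} {fTX : ℝ → Cov r → ℝ} (hT : Measurable T)
    (hdens : TreatmentDensities P T X fT fTX) : ∀ᵐ ω ∂P, T ω ∈ treatments := by
  have h : ∀ᵐ s ∂(P.map T), s ∈ treatments := by
    rw [hdens.law_treatment]
    exact (withDensity_absolutelyContinuous _ _).ae_le (ae_restrict_mem measurableSet_Icc)
  exact ae_of_ae_map hT.aemeasurable h

lemma covariate_mem_ae {P : Measure Ω₀} (hX : Measurable X) : ∀ᵐ ω ∂P, X ω ∈ covSupport P X :=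
  ae_of_ae_map hX.aemeasurable Measure.support_mem_ae

/-- On any event of the sigma-algebra of the potential outcomes, weighting by the stabilized
weight makes `T` independent of the event. -/
lemma lintegral_weight_event {fT : ℝ → ℝ} {fTX : ℝ → Cov r → ℝ}
    (hT : Measurable T) (hX : Measurable X)
    (hdens : TreatmentDensities P T X fT fTX) (hfT : ContinuousOn fT treatments)
    (hpos : ∀ t ∈ treatments, ∀ x ∈ covSupport P X, 0 < fTX t x) {B : Set Ω₀}
    (hB : MeasurableSet B)
    (h : ∀ A : Set ℝ, MeasurableSet A →
      P[(T ⁻¹' A ∩ B).indicator (fun _ => (1 : ℝ)) | MeasurableSpace.comap X inferInstance] =ᵐ[P]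
        P[(T ⁻¹' A).indicator (fun _ => (1 : ℝ)) | MeasurableSpace.comap X inferInstance] *
          P[B.indicator (fun _ => (1 : ℝ)) | MeasurableSpace.comap X inferInstance])
    {φ : ℝ → ℝ≥0∞} (hφ : Measurable φ) :
    ∫⁻ ω in B, ENNReal.ofReal (weight fT fTX (T ω) (X ω)) * φ (T ω) ∂P =
      (∫⁻ s in treatments, ENNReal.ofReal (fT s) * φ s) * P B := by
  obtain ⟨g, hg, hν⟩ := exists_density_of_condIndep hT hX hB h
  have hTX : Measurable (fun ω => (T ω, X ω)) := hT.prodMk hX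
  have hPX : IsProbabilityMeasure (P.map X) := Measure.isProbabilityMeasure_map hX.aemeasurable
  set ψ : ℝ × Cov r → ℝ≥0∞ := fun z => ENNReal.ofReal (weight fT fTX z.1 z.2) * φ z.1 with hψ
  have hψm : Measurable ψ :=
    (measurable_weight hfT hdens.measurable_cond).ennreal_ofReal.mul (hφ.comp measurable_fst)
  -- Total masses in the identity of measures: the density integrates to `P B`.
  have hPB : P B = ∫⁻ x, g x ∂(P.map X) := by
    have := congrArg (fun μ => μ univ) hν
    simp only [Measure.map_apply hTX MeasurableSet.univ, preimage_univ,
      Measure.restrict_apply_univ] at this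
    rw [this, withDensity_apply _ MeasurableSet.univ, Measure.restrict_univ,
      lintegral_map hg hX]
  have hfTm : Measurable (fun p : ℝ × Cov r => ENNReal.ofReal (fTX p.1 p.2)) :=
    hdens.measurable_cond.ennreal_ofReal
  have hgm : Measurable fun z : ℝ × Cov r => g z.2 := hg.comp measurable_snd
  have hgX : Measurable fun ω => g (X ω) := hg.comp hX
  have hψTX : Measurable fun ω => ψ (T ω, X ω) := hψm.comp hTX
  have hgψ : Measurable fun z => g z.2 * ψ z := hgm.mul hψm
  calc ∫⁻ ω in B, ENNReal.ofReal (weight fT fTX (T ω) (X ω)) * φ (T ω) ∂P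
      = ∫⁻ z, ψ z ∂((P.restrict B).map (fun ω => (T ω, X ω))) := (lintegral_map hψm hTX).symm
    _ = ∫⁻ ω, g (X ω) * ψ (T ω, X ω) ∂P := by
        rw [hν, lintegral_map hψm hTX,
          lintegral_withDensity_eq_lintegral_mul _ hgX hψTX]
        rfl
    _ = ∫⁻ z, g z.2 * ψ z ∂(P.map (fun ω => (T ω, X ω))) := by
        rw [lintegral_map hgψ hTX]
    _ = ∫⁻ z, ENNReal.ofReal (fTX z.1 z.2) * (g z.2 * ψ z)
          ∂((volume.restrict treatments).prod (P.map X)) := by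
        rw [hdens.law_joint, lintegral_withDensity_eq_lintegral_mul _ hfTm hgψ]
        rfl
    _ = ∫⁻ s in treatments, ∫⁻ x, ENNReal.ofReal (fTX s x) * (g x * ψ (s, x)) ∂(P.map X) :=
        lintegral_prod _ (hfTm.mul hgψ).aemeasurable
    _ = ∫⁻ s in treatments, ENNReal.ofReal (fT s) * φ s * P B := by
        refine setLIntegral_congr_fun measurableSet_Icc fun s hs => ?_
        rw [hPB, ← lintegral_const_mul _ hg]
        refine lintegral_congr_ae ?_
        filter_upwards [show ∀ᵐ x ∂(P.map X), x ∈ covSupport P X from Measure.support_mem_ae]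
          with x hx
        have h0 := hpos s hs x hx
        -- Here confounding disappears: the weight cancels the conditional density and leaves `f_T`,
        -- which does not involve `x`. The integral over `x` then sees only `g`.
        have e : ENNReal.ofReal (fTX s x) * ENNReal.ofReal (weight fT fTX s x) =
            ENNReal.ofReal (fT s) := by
          rw [← ENNReal.ofReal_mul h0.le, weight, stabWeight, indicator_of_mem hs,
            mul_div_cancel₀ _ h0.ne']
        simp only [hψ]
        rw [← e]; ring
    _ = _ := by
        rw [lintegral_mul_const']
        exact measure_ne_top _ _

/-- A weighted version of the law of a product: if the weighted measure factorizes on rectangles,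
then integrals against it are iterated integrals. -/
lemma lintegral_of_rectangles {S : Type*} [MeasurableSpace S] {Z : Ω₀ → S} (hZ : Measurable Z)
    (hT : Measurable T) {w : Ω₀ → ℝ≥0∞} (hw : Measurable w) {L : Measure ℝ} [IsFiniteMeasure L]
    (h : ∀ A : Set ℝ, MeasurableSet A → ∀ B : Set S, MeasurableSet B →
      ∫⁻ ω in Z ⁻¹' B, w ω * A.indicator 1 (T ω) ∂P = L A * P (Z ⁻¹' B))
    {Ψ : ℝ × S → ℝ≥0∞} (hΨ : Measurable Ψ) :
    ∫⁻ ω, w ω * Ψ (T ω, Z ω) ∂P = ∫⁻ s, ∫⁻ ω, Ψ (s, Z ω) ∂P ∂L := by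
  have hTZ : Measurable (fun ω => (T ω, Z ω)) := hT.prodMk hZ
  have hΨTZ : Measurable fun ω => Ψ (T ω, Z ω) := hΨ.comp hTZ
  have : IsProbabilityMeasure (P.map Z) := Measure.isProbabilityMeasure_map hZ.aemeasurable
  have hμ : L.prod (P.map Z) = (P.withDensity w).map (fun ω => (T ω, Z ω)) := by
    refine Measure.prod_eq fun A B hA hB => ?_
    rw [Measure.map_apply hTZ (hA.prod hB), withDensity_apply _ (hTZ (hA.prod hB)),
      Measure.map_apply hZ hB, ← h A hA B hB]
    have e : (fun ω => (T ω, Z ω)) ⁻¹' A ×ˢ B = Z ⁻¹' B ∩ T ⁻¹' A := by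
      ext ω; simp [and_comm]
    rw [e, inter_comm, ← setLIntegral_indicator (hT hA)]
    refine lintegral_congr fun ω => ?_
    by_cases hω : T ω ∈ A <;> simp [indicator, hω]
  calc ∫⁻ ω, w ω * Ψ (T ω, Z ω) ∂P
      = ∫⁻ z, Ψ z ∂((P.withDensity w).map (fun ω => (T ω, Z ω))) := by
        rw [lintegral_map hΨ hTZ,
          lintegral_withDensity_eq_lintegral_mul _ hw hΨTZ]
        rfl
    _ = _ := by
        rw [← hμ, lintegral_prod _ hΨ.aemeasurable]
        refine lintegral_congr fun s => ?_
        have hΨs : Measurable fun z => Ψ (s, z) := hΨ.comp measurable_prodMk_left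
        rw [lintegral_map hΨs hZ]

/-- The process is indexed by `[0, 1]` only; projecting onto this interval extends it to the line
without changing it where the treatment lives. The measurable space is left free so that it can be
the one generated by the outcomes. -/
lemma measurable_exceedance_of_process {S : Type*} [MeasurableSpace S] {G : treatments × S → ℝ}
    (hG : Measurable G) {φ : ℝ → ℝ≥0∞} (hφ : Measurable φ) (y : ℝ) :
    Measurable (fun z : ℝ × S => φ z.1 *
      ((fun z : ℝ × S => G (projIcc (0 : ℝ) 1 zero_le_one z.1, z.2)) ⁻¹' Ioi y).indicator 1 z) := by
  have h1 : Measurable fun z : ℝ × S =>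
      ((projIcc (0 : ℝ) 1 zero_le_one z.1, z.2) : treatments × S) :=
    (continuous_projIcc.measurable.comp measurable_fst).prodMk measurable_snd
  exact (hφ.comp measurable_fst).mul (measurable_one.indicator ((hG.comp h1) measurableSet_Ioi))

/-- The weighted mean of an exceedance of the observed outcome is an average, over the treatments,
of the survival functions of the potential outcomes. -/
lemma lintegral_weight_exceedance {Y : ℝ → Ω₀ → ℝ} {fT : ℝ → ℝ} {fTX : ℝ → Cov r → ℝ}
    (hmeas : MeasurableModel T X Y) (hunconf : Unconfounded P T X Y)
    (hdens : TreatmentDensities P T X fT fTX) (hfT : ContinuousOn fT treatments)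
    (hpos : ∀ t ∈ treatments, ∀ x ∈ covSupport P X, 0 < fTX t x)
    (hc : ∀ t ∈ treatments, Continuous (survival P Y t))
    {φ : ℝ → ℝ≥0∞} (hφ : Measurable φ) (hfin : ∫⁻ s in treatments, ENNReal.ofReal (fT s) ≠ ∞)
    (y : ℝ) :
    ∫⁻ ω, ENNReal.ofReal (weight fT fTX (T ω) (X ω)) *
        (φ (T ω) * {ω | y < Y (T ω) ω}.indicator 1 ω) ∂P =
      ∫⁻ s in treatments, ENNReal.ofReal (fT s) * φ s * ENNReal.ofReal (survival P Y s y) := by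
  have hT := hmeas.treatment
  have hX := hmeas.covariate
  have hle : outcomeSigma Y ≤ (inferInstance : MeasurableSpace Ω₀) :=
    iSup₂_le fun t ht => (hmeas.outcome t ht).comap_le
  set w : Ω₀ → ℝ≥0∞ := fun ω => ENNReal.ofReal (weight fT fTX (T ω) (X ω)) with hw
  have hwm : Measurable w :=
    ((measurable_weight hfT hdens.measurable_cond).comp (hT.prodMk hX)).ennreal_ofReal
  have hfTm : AEMeasurable (fun s => ENNReal.ofReal (fT s)) (volume.restrict treatments) :=
    (hfT.aemeasurable measurableSet_Icc).ennreal_ofReal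
  set L : Measure ℝ := (volume.restrict treatments).withDensity
    (fun s => ENNReal.ofReal (fT s)) with hL
  have : IsFiniteMeasure L := isFiniteMeasure_withDensity hfin
  have hrect : ∀ A : Set ℝ, MeasurableSet A → ∀ B : Set Ω₀, MeasurableSet[outcomeSigma Y] B →
      ∫⁻ ω in id ⁻¹' B, w ω * A.indicator 1 (T ω) ∂P = L A * P (id ⁻¹' B) := by
    intro A hA B hB
    rw [preimage_id, lintegral_weight_event hT hX hdens hfT hpos (hle B hB)
      (fun A hA => hunconf _ _ ⟨A, hA, rfl⟩ hB) (measurable_one.indicator hA), hL,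
      withDensity_apply _ hA, ← lintegral_indicator hA]
    congr 1
    refine lintegral_congr fun s => ?_
    by_cases hs : s ∈ A <;> simp [hs]
  set Y' : ℝ × Ω₀ → ℝ := fun z => Y (projIcc (0 : ℝ) 1 zero_le_one z.1) z.2 with hY'
  have hproj : ∀ s ∈ treatments, ((projIcc (0 : ℝ) 1 zero_le_one s : treatments) : ℝ) = s :=
    fun s hs => by rw [projIcc_of_mem zero_le_one hs]
  set Ψ : ℝ × Ω₀ → ℝ≥0∞ := fun z => φ z.1 * (Y' ⁻¹' Ioi y).indicator 1 z with hΨ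
  have hΨm := @measurable_exceedance_of_process Ω₀ (outcomeSigma Y) _ hmeas.process φ hφ y
  -- The second coordinate is the sample point itself, seen through the smaller sigma-algebra of the
  -- potential outcomes: unconfoundedness and joint measurability of the process hold for that one.
  have key := @lintegral_of_rectangles Ω₀ _ P _ T Ω₀ (outcomeSigma Y) id
    (measurable_id'' hle) hT w hwm L _ hrect Ψ hΨm
  have e1 : ∫⁻ ω, w ω * (φ (T ω) * {ω | y < Y (T ω) ω}.indicator 1 ω) ∂P =
      ∫⁻ ω, w ω * Ψ (T ω, id ω) ∂P := by
    refine lintegral_congr_ae ?_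
    filter_upwards [treatment_mem_ae hT hdens] with ω hω
    simp only [hΨ, hY', indicator, mem_preimage, mem_Ioi, mem_ofPred_eq, id, hproj _ hω,
      Pi.one_apply]
  rw [e1, key, hL]
  have e2 : ∀ s ∈ treatments, ∫⁻ ω, Ψ (s, id ω) ∂P = φ s * ENNReal.ofReal (survival P Y s y) := by
    intro s hs
    have e3 : ∀ ω, Ψ (s, id ω) = φ s * {ω | y < Y s ω}.indicator 1 ω := by
      intro ω
      simp only [hΨ, hY', indicator, mem_preimage, mem_Ioi, mem_ofPred_eq, id, hproj _ hs,
        Pi.one_apply]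
    have hYs := hmeas.outcome s hs
    have hm : MeasurableSet {ω | y < Y s ω} := measurableSet_lt measurable_const hYs
    rw [lintegral_congr e3, lintegral_const_mul _ (measurable_one.indicator hm),
      lintegral_indicator_one hm, measure_lt_eq_survival hYs (hc s hs)]
  rw [lintegral_withDensity_eq_lintegral_mul_non_measurable₀ _ hfTm
    (.of_forall fun s => ENNReal.ofReal_lt_top)]
  refine setLIntegral_congr_fun measurableSet_Icc fun s hs => ?_
  simp only [Pi.mul_apply]
  rw [e2 s hs, mul_assoc]

end Unconfounding


/-! ### Kernel means -/

/-- Half of the mass of the kernel, at least, falls into the support of the treatment. -/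
lemma kernel_mass {K : ℝ → ℝ} (hK : IsSmoothingKernel K) {t h : ℝ} (ht : t ∈ treatments)
    (hh : 0 < h) (hh2 : h ≤ 1 / 2) :
    ENNReal.ofReal (h / 2) ≤ ∫⁻ s in treatments, ENNReal.ofReal (K ((s - t) / h)) := by
  have hKi : Integrable K := by
    by_contra hn
    have := hK.integral_one
    rw [integral_undef hn] at this
    exact zero_ne_one this
  have hpos : ∫ u in Ioi (0 : ℝ), K u = 1 / 2 := by
    have h1 := integral_comp_abs (f := K)
    have h2 : (fun x => K |x|) = K := by
      ext x
      rcases abs_choice x with h | h <;> rw [h]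
      exact hK.symmetric x
    rw [h2, hK.integral_one] at h1
    linarith
  have hneg : ∫ u in Iic (0 : ℝ), K u = 1 / 2 := by
    have h1 := integral_add_compl (measurableSet_Ioi (a := (0 : ℝ))) hKi
    rw [compl_Ioi, hK.integral_one, hpos] at h1
    linarith
  -- By symmetry each half of the kernel has mass `1 / 2`. As `h ≤ 1 / 2`, the right half stays
  -- inside `[0, 1]` if `t ≤ 1 / 2`, and the left half if `t ≥ 1 / 2`.
  have key : ∀ S : Set ℝ, MeasurableSet S → ∫ u in S, K u = 1 / 2 →
      (∀ s, (s - t) / h ∈ S → (s - t) / h ∈ Icc (-1 : ℝ) 1 → s ∈ treatments) →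
      ENNReal.ofReal (h / 2) ≤ ∫⁻ s in treatments, ENNReal.ofReal (K ((s - t) / h)) := by
    intro S hS hS1 hS2
    have hg : Integrable (S.indicator K) := hKi.indicator hS
    have hgh : Integrable (fun s => S.indicator K ((s - t) / h)) :=
      (hg.comp_div hh.ne').comp_sub_right t
    have hval : ∫ s, S.indicator K ((s - t) / h) = h / 2 := by
      rw [integral_sub_right_eq_self (fun s => S.indicator K (s / h)) t,
        Measure.integral_comp_div, integral_indicator hS, hS1, abs_of_pos hh, smul_eq_mul]
      ring
    rw [← hval, ofReal_integral_eq_lintegral_ofReal hgh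
      (.of_forall fun s => indicator_nonneg (fun u _ => hK.nonneg u) _),
      ← lintegral_indicator measurableSet_Icc]
    refine lintegral_mono fun s => ?_
    by_cases hs : (s - t) / h ∈ S
    · rw [indicator_of_mem hs]
      by_cases h0 : K ((s - t) / h) = 0
      · simp [h0]
      · rw [indicator_of_mem (hS2 s hs (hK.support h0))]
    · rw [indicator_of_notMem hs]; simp
  rcases le_total t (1 / 2) with h2 | h2
  · refine key (Ioi 0) measurableSet_Ioi hpos fun s hs1 hs2 => ?_
    have h3 : 0 < (s - t) / h := hs1
    have h4 := hs2.2
    rw [div_le_one hh] at h4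
    have h5 := (div_pos_iff_of_pos_right hh).1 h3
    exact ⟨by linarith [ht.1], by linarith⟩
  · refine key (Iic 0) measurableSet_Iic hneg fun s hs1 hs2 => ?_
    have h3 : (s - t) / h ≤ 0 := hs1
    have h4 := hs2.1
    rw [le_div_iff₀ hh] at h4
    rw [div_le_iff₀ hh] at h3
    exact ⟨by linarith, by linarith [ht.2]⟩

section Means

variable {r : ℕ} {Ω₀ : Type*} [MeasurableSpace Ω₀] {P : Measure Ω₀} [IsProbabilityMeasure P]
  {T : Ω₀ → ℝ} {X : Ω₀ → Cov r} {Y : ℝ → Ω₀ → ℝ} {fT : ℝ → ℝ} {fTX : ℝ → Cov r → ℝ}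
  {K : ℝ → ℝ}

/-- The contribution of one observation to the kernel estimator, with the true weights and with
the indicator of `E` at the outcome. -/
noncomputable def contribution (fT : ℝ → ℝ) (fTX : ℝ → Cov r → ℝ) (K : ℝ → ℝ) (t h : ℝ)
    (E : Set ℝ) (o : ℝ × Cov r × ℝ) : ℝ :=
  weight fT fTX o.1 o.2.1 * E.indicator 1 o.2.2 * K ((o.1 - t) / h)

lemma measurable_contribution (hfT : ContinuousOn fT treatments)
    (hfTX : Measurable (Function.uncurry fTX)) (hK : Measurable K) (t h : ℝ) {E : Set ℝ}
    (hE : MeasurableSet E) : Measurable (contribution fT fTX K t h E) := by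
  have h1 : Measurable fun o : ℝ × Cov r × ℝ => weight fT fTX o.1 o.2.1 :=
    (measurable_weight hfT hfTX).comp (measurable_fst.prodMk measurable_snd.fst)
  have h2 : Measurable fun o : ℝ × Cov r × ℝ => E.indicator (1 : ℝ → ℝ) o.2.2 :=
    (measurable_one.indicator hE).comp measurable_snd.snd
  exact (h1.mul h2).mul (hK.comp ((measurable_fst.sub_const t).div_const h))

/-- The true weights and densities are bounded. -/
lemma exists_weight_bounds {P : Measure Ω₀} {κ : Kernel (ℝ × Cov r) ℝ} (hoverlap : Overlap P X fT fTX)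
    (hreg : RegularLaw P T X Y fT κ) :
    (∀ t ∈ treatments, ∀ x ∈ covSupport P X, 0 < fTX t x) ∧
    ∃ η B : ℝ, 0 < η ∧ 0 < B ∧ ∀ t ∈ treatments, η ≤ fT t ∧ fT t ≤ B ∧
      ∀ x ∈ covSupport P X, weight fT fTX t x = stabWeight fT fTX t x ∧
        η ≤ weight fT fTX t x ∧ weight fT fTX t x ≤ B := by
  obtain ⟨η₁, η₂, h1, h2⟩ := hoverlap.weight_bounds
  obtain ⟨η₃, η₄, h3, h4⟩ := hreg.density_bounds
  refine ⟨fun t ht x hx => ?_, min η₁ η₃, max 1 (max η₂ η₄), lt_min h1 h3, by positivity,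
    fun t ht => ⟨(min_le_right _ _).trans (h4 t ht).1,
      (h4 t ht).2.trans ((le_max_right _ _).trans (le_max_right _ _)), fun x hx => ?_⟩⟩
  · have h5 : 0 < fT t / fTX t x := h1.trans_le (h2 t ht x hx).1
    exact (div_pos_iff_of_pos_left (h3.trans_le (h4 t ht).1)).1 h5
  · have e : weight fT fTX t x = stabWeight fT fTX t x := by
      rw [weight, stabWeight, indicator_of_mem ht, stabWeight]
    rw [e]
    exact ⟨rfl, (min_le_left _ _).trans (h2 t ht x hx).1,
      (h2 t ht x hx).2.trans ((le_max_left _ _).trans (le_max_right _ _))⟩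

lemma lintegral_contribution_univ (hmeas : MeasurableModel T X Y) (hunconf : Unconfounded P T X Y)
    (hdens : TreatmentDensities P T X fT fTX) (hfT : ContinuousOn fT treatments)
    (hpos : ∀ t ∈ treatments, ∀ x ∈ covSupport P X, 0 < fTX t x) (hK : IsSmoothingKernel K)
    (t h : ℝ) :
    ∫⁻ ω, ENNReal.ofReal (contribution fT fTX K t h univ (observation T X Y ω)) ∂P =
      ∫⁻ s in treatments, ENNReal.ofReal (fT s) * ENNReal.ofReal (K ((s - t) / h)) := by
  have hφ : Measurable fun s => ENNReal.ofReal (K ((s - t) / h)) :=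
    (hK.measurable.comp ((measurable_id.sub_const t).div_const h)).ennreal_ofReal
  have key := lintegral_weight_event hmeas.treatment hmeas.covariate hdens hfT hpos
    MeasurableSet.univ (fun A hA => hunconf _ _ ⟨A, hA, rfl⟩ MeasurableSet.univ) hφ
  rw [measure_univ, mul_one, Measure.restrict_univ] at key
  rw [← key]
  refine lintegral_congr fun ω => ?_
  rw [← ENNReal.ofReal_mul' (hK.nonneg _)]
  simp [contribution, observation]

lemma lintegral_contribution_Ioi (hmeas : MeasurableModel T X Y) (hunconf : Unconfounded P T X Y)
    (hdens : TreatmentDensities P T X fT fTX) (hfT : ContinuousOn fT treatments)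
    (hpos : ∀ t ∈ treatments, ∀ x ∈ covSupport P X, 0 < fTX t x) (hK : IsSmoothingKernel K)
    (hc : ∀ t ∈ treatments, Continuous (survival P Y t))
    (hfin : ∫⁻ s in treatments, ENNReal.ofReal (fT s) ≠ ∞) (t h y : ℝ) :
    ∫⁻ ω, ENNReal.ofReal (contribution fT fTX K t h (Ioi y) (observation T X Y ω)) ∂P =
      ∫⁻ s in treatments, ENNReal.ofReal (fT s) * ENNReal.ofReal (K ((s - t) / h)) *
        ENNReal.ofReal (survival P Y s y) := by
  have hφ : Measurable fun s => ENNReal.ofReal (K ((s - t) / h)) :=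
    (hK.measurable.comp ((measurable_id.sub_const t).div_const h)).ennreal_ofReal
  rw [← lintegral_weight_exceedance hmeas hunconf hdens hfT hpos hc hφ hfin y]
  refine lintegral_congr fun ω => ?_
  by_cases hω : y < Y (T ω) ω
  · rw [contribution, observation, ENNReal.ofReal_mul' (hK.nonneg _)]
    simp [hω]
  · simp [contribution, observation, hω]

/-- Means of the contributions: the mean with an exceedance of `y` is the mean without it times
the survival function at `y`, up to the oscillation in the treatment. -/
lemma exists_contribution_mean_bounds {κ : Kernel (ℝ × Cov r) ℝ} (hmeas : MeasurableModel T X Y)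
    (hunconf : Unconfounded P T X Y) (hdens : TreatmentDensities P T X fT fTX)
    (hoverlap : Overlap P X fT fTX) (hreg : RegularLaw P T X Y fT κ) (hK : IsSmoothingKernel K)
    (hobs : AEMeasurable (observation T X Y) P)
    (hc : ∀ t ∈ treatments, Continuous (survival P Y t)) :
    ∃ η B : ℝ, 0 < η ∧ 0 < B ∧
      (∀ t ∈ treatments, ∀ x ∈ covSupport P X,
        weight fT fTX t x = stabWeight fT fTX t x ∧ η ≤ weight fT fTX t x) ∧
      (∀ t h : ℝ, ∀ E : Set ℝ, ∀ᵐ ω ∂P,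
        0 ≤ contribution fT fTX K t h E (observation T X Y ω) ∧
          contribution fT fTX K t h E (observation T X Y ω) ≤ B) ∧
      ∀ t ∈ treatments, ∀ h : ℝ, 0 < h → h ≤ 1 / 2 →
        η * h ≤ ∫ ω, contribution fT fTX K t h univ (observation T X Y ω) ∂P ∧
        ∀ y β : ℝ, 0 < survival P Y t y →
          (∀ s ∈ treatments, |s - t| ≤ h → 0 < survival P Y s y ∧
            |Real.log (survival P Y s y / survival P Y t y)| ≤ β) →
          survival P Y t y * Real.exp (-β) *
              (∫ ω, contribution fT fTX K t h univ (observation T X Y ω) ∂P) ≤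
            ∫ ω, contribution fT fTX K t h (Ioi y) (observation T X Y ω) ∂P ∧
          ∫ ω, contribution fT fTX K t h (Ioi y) (observation T X Y ω) ∂P ≤
            survival P Y t y * Real.exp β *
              (∫ ω, contribution fT fTX K t h univ (observation T X Y ω) ∂P) := by
  obtain ⟨hpos, η, B, hη, hB, hb⟩ := exists_weight_bounds hoverlap hreg
  obtain ⟨C, hC⟩ := hK.bounded
  have hC0 : 0 ≤ C := (hK.nonneg 0).trans (hC 0)
  have hfT : ContinuousOn fT treatments := hreg.smooth_density.continuousOn
  have hTm := treatment_mem_ae hmeas.treatment hdens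
  have hXm := covariate_mem_ae (P := P) hmeas.covariate
  have hbd : ∀ t h : ℝ, ∀ E : Set ℝ, ∀ᵐ ω ∂P,
      0 ≤ contribution fT fTX K t h E (observation T X Y ω) ∧
        contribution fT fTX K t h E (observation T X Y ω) ≤ B * (C + 1) := by
    intro t h E
    filter_upwards [hTm, hXm] with ω h1 h2
    obtain ⟨-, h4, h5⟩ := (hb _ h1).2.2 _ h2
    have h6 := hK.nonneg ((T ω - t) / h)
    have h7 := hC ((T ω - t) / h)
    have h8 : 0 ≤ weight fT fTX (T ω) (X ω) := hη.le.trans h4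
    have h9 : 0 ≤ E.indicator (1 : ℝ → ℝ) (Y (T ω) ω) :=
      indicator_nonneg (fun _ _ => zero_le_one) _
    have h10 : E.indicator (1 : ℝ → ℝ) (Y (T ω) ω) ≤ 1 :=
      indicator_apply_le' (fun _ => le_rfl) (fun _ => zero_le_one)
    simp only [contribution, observation]
    refine ⟨by positivity, ?_⟩
    calc _ ≤ B * 1 * C := by gcongr
      _ ≤ B * (C + 1) := by nlinarith
  have hfin : ∫⁻ s in treatments, ENNReal.ofReal (fT s) ≠ ∞ := by
    refine ne_of_lt (lt_of_le_of_lt (setLIntegral_mono (g := fun _ => ENNReal.ofReal B)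
      measurable_const fun s hs => ENNReal.ofReal_le_ofReal (hb s hs).2.1) ?_)
    rw [setLIntegral_const]
    exact ENNReal.mul_lt_top ENNReal.ofReal_lt_top (by simp [treatments])
  -- The factor `1 / 2` is the kernel mass guaranteed at a boundary treatment; `C + 1` replaces `C`
  -- to have a positive bound.
  refine ⟨η / 2, B * (C + 1), by positivity, by positivity, ?_, hbd, fun t ht h hh hh2 => ?_⟩
  · intro s hs x hx
    obtain ⟨h3, h4, -⟩ := (hb s hs).2.2 x hx
    exact ⟨h3, by linarith⟩
  set D : ℝ≥0∞ := ∫⁻ s in treatments, ENNReal.ofReal (fT s) * ENNReal.ofReal (K ((s - t) / h))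
    with hD
  have hD1 := lintegral_contribution_univ hmeas hunconf hdens hfT hpos hK t h
  have hDlow : ENNReal.ofReal (η / 2 * h) ≤ D := by
    calc ENNReal.ofReal (η / 2 * h) = ENNReal.ofReal η * ENNReal.ofReal (h / 2) := by
          rw [← ENNReal.ofReal_mul hη.le]; congr 1; ring
      _ ≤ ENNReal.ofReal η * ∫⁻ s in treatments, ENNReal.ofReal (K ((s - t) / h)) := by
          gcongr; exact kernel_mass hK ht hh hh2
      _ = ∫⁻ s in treatments, ENNReal.ofReal η * ENNReal.ofReal (K ((s - t) / h)) := by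
          rw [lintegral_const_mul' _ _ ENNReal.ofReal_ne_top]
      _ ≤ D := by
          refine setLIntegral_mono' measurableSet_Icc fun s hs => ?_
          gcongr
          exact (hb s hs).1
  have hI : ∀ E : Set ℝ, MeasurableSet E →
      ENNReal.ofReal (∫ ω, contribution fT fTX K t h E (observation T X Y ω) ∂P) =
        ∫⁻ ω, ENNReal.ofReal (contribution fT fTX K t h E (observation T X Y ω)) ∂P := by
    intro E hE
    refine ofReal_integral_eq_lintegral_ofReal ?_ ((hbd t h E).mono fun ω hω => hω.1)
    have hm := (measurable_contribution hfT hdens.measurable_cond hK.measurable t h hE).comp_aemeasurable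
      hobs
    refine Integrable.of_bound hm.aestronglyMeasurable (B * (C + 1)) ((hbd t h E).mono fun ω hω => ?_)
    rw [Real.norm_eq_abs, abs_le]
    exact ⟨by linarith [hω.1, hω.2, hω.1.trans hω.2], hω.2⟩
  have hI0 : ∀ E : Set ℝ, 0 ≤ ∫ ω, contribution fT fTX K t h E (observation T X Y ω) ∂P :=
    fun E => integral_nonneg_of_ae ((hbd t h E).mono fun ω hω => hω.1)
  have hID := (hI univ MeasurableSet.univ).trans hD1
  refine ⟨(ENNReal.ofReal_le_ofReal_iff (hI0 _)).1 (hDlow.trans hID.ge), fun y β hy hosc => ?_⟩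
  -- Only treatments within the bandwidth carry kernel mass, so the oscillation bound applies
  -- wherever the integrand is nonzero.
  have hcase : ∀ s, K ((s - t) / h) ≠ 0 → |s - t| ≤ h := by
    intro s hs
    have := abs_le.2 (hK.support hs)
    rwa [abs_div, abs_of_pos hh, div_le_one hh] at this
  have hexp : ∀ s ∈ treatments, |s - t| ≤ h →
      survival P Y t y * Real.exp (-β) ≤ survival P Y s y ∧
        survival P Y s y ≤ survival P Y t y * Real.exp β := by
    intro s hs hst
    obtain ⟨h1, h2⟩ := hosc s hs hst
    rw [abs_le, Real.log_div h1.ne' hy.ne'] at h2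
    have e : survival P Y t y = Real.exp (Real.log (survival P Y t y)) := (Real.exp_log hy).symm
    rw [e, ← Real.exp_add, ← Real.exp_add, ← Real.le_log_iff_exp_le h1,
      ← Real.log_le_iff_le_exp h1]
    constructor <;> linarith [h2.1, h2.2]
  have hlin : ∀ c : ℝ, 0 ≤ c → ENNReal.ofReal (c *
      ∫ ω, contribution fT fTX K t h univ (observation T X Y ω) ∂P) = ∫⁻ s in treatments,
        ENNReal.ofReal (fT s) * ENNReal.ofReal (K ((s - t) / h)) * ENNReal.ofReal c := by
    intro c hc0
    rw [ENNReal.ofReal_mul hc0, hID, mul_comm, lintegral_mul_const' _ _ ENNReal.ofReal_ne_top]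
  have hIy := (hI (Ioi y) measurableSet_Ioi).trans
    (lintegral_contribution_Ioi hmeas hunconf hdens hfT hpos hK hc hfin t h y)
  have he1 := Real.exp_pos β
  have he2 := Real.exp_pos (-β)
  constructor
  · refine (ENNReal.ofReal_le_ofReal_iff (hI0 _)).1 ?_
    rw [hlin _ (by positivity), hIy]
    refine setLIntegral_mono' measurableSet_Icc fun s hs => ?_
    by_cases h0 : K ((s - t) / h) = 0
    · simp [h0]
    · gcongr
      exact (hexp s hs (hcase s h0)).1
  · refine (ENNReal.ofReal_le_ofReal_iff (mul_nonneg (by positivity) (hI0 _))).1 ?_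
    rw [hlin _ (by positivity), hIy]
    refine setLIntegral_mono' measurableSet_Icc fun s hs => ?_
    by_cases h0 : K ((s - t) / h) = 0
    · simp [h0]
    · gcongr
      exact (hexp s hs (hcase s h0)).2

end Means

/-! ### A Chebyshev bound -/

/-- Chebyshev's inequality, in relative form, for sums of independent bounded nonnegative random
variables with common mean. -/
lemma chebyshev_sum {Ω : Type*} [MeasurableSpace Ω] {P : Measure Ω} [IsProbabilityMeasure P]
    {V : ℕ → Ω → ℝ} (hV : ∀ i, AEMeasurable (V i) P) (hind : iIndepFun V P) {B m ε : ℝ}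
    (hb : ∀ i, ∀ᵐ ω ∂P, 0 ≤ V i ω ∧ V i ω ≤ B) (hm : ∀ i, ∫ ω, V i ω ∂P = m) (hm0 : 0 < m)
    (hε : 0 < ε) {N : ℕ} (hN : 0 < N) :
    P {ω | ε * (N * m) ≤ |∑ i ∈ Finset.range N, V i ω - N * m|} ≤
      ENNReal.ofReal (B / (ε ^ 2 * (N * m))) := by
  have hbd : ∀ i, ∀ᵐ ω ∂P, ‖V i ω‖ ≤ B := fun i => (hb i).mono fun ω hω => by
    rw [Real.norm_eq_abs, abs_of_nonneg hω.1]; exact hω.2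
  have hL : ∀ i, MemLp (V i) 2 P := fun i => MemLp.of_bound (hV i).aestronglyMeasurable B (hbd i)
  have hI : ∀ i, Integrable (V i) P := fun i => (hL i).integrable one_le_two
  -- From `0 ≤ V ≤ B` follows `V ^ 2 ≤ B V`. A variance linear in the mean is what makes the
  -- relative bound effective for rare exceedances.
  have hvar : ∀ i, variance (V i) P ≤ B * m := by
    intro i
    refine (variance_le_expectation_sq (hV i).aestronglyMeasurable).trans ?_
    rw [← hm i, ← integral_const_mul]
    refine integral_mono_ae (hL i).integrable_sq ((hI i).const_mul B) ?_
    filter_upwards [hb i] with ω hω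
    simp only [Pi.pow_apply]
    nlinarith [hω.1, hω.2]
  have hNm : (0 : ℝ) < N * m := by positivity
  have hS : MemLp (∑ i ∈ Finset.range N, V i) 2 P := memLp_finsetSum' _ fun i _ => hL i
  have hmean : ∫ ω, (∑ i ∈ Finset.range N, V i) ω ∂P = N * m := by
    simp only [Finset.sum_apply]
    rw [integral_finsetSum _ fun i _ => hI i]
    simp [hm]
  have hch := meas_ge_le_variance_div_sq hS (mul_pos hε hNm)
  rw [hmean] at hch
  simp only [Finset.sum_apply] at hch
  refine hch.trans (ENNReal.ofReal_le_ofReal ?_)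
  rw [IndepFun.variance_sum (fun i _ => hL i) fun i _ j _ hij => hind.indepFun hij]
  have hsum : ∑ i ∈ Finset.range N, variance (V i) P ≤ N * (B * m) := by
    refine (Finset.sum_le_sum fun i _ => hvar i).trans ?_
    simp
  calc _ ≤ N * (B * m) / (ε * (N * m)) ^ 2 := by gcongr
    _ = _ := by field_simp

/-! ### Deterministic bounds on the estimators -/

/-- Because `(1 + 2 u) (1 - u) ≥ 1` on this range. Factors `1 - u` become exponentials, so that
successive perturbations add up. -/
lemma exp_neg_two_mul_le {u : ℝ} (hu0 : 0 ≤ u) (hu : u ≤ 1 / 2) : Real.exp (-(2 * u)) ≤ 1 - u := by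
  rw [Real.exp_neg, inv_le_comm₀ (Real.exp_pos _) (by linarith)]
  refine le_trans ?_ (Real.add_one_le_exp (2 * u))
  rw [inv_le_comm₀ (by linarith) (by linarith), inv_eq_one_div, div_le_iff₀ (by linarith)]
  nlinarith

/-- Perturbation of a ratio of weighted sums: weights within a factor `1 ± u`, and sums within a
factor `1 ± ε` of `A` and `D`. -/
lemma ratio_sum_bounds {N : ℕ} {w p a b : ℕ → ℝ} {u ε A D : ℝ}
    (hu0 : 0 ≤ u) (hu : u ≤ 1 / 2) (hε0 : 0 ≤ ε) (hε : ε ≤ 1 / 2) (hA : 0 < A) (hD : 0 < D)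
    (ha : ∀ i < N, 0 ≤ a i) (hb : ∀ i < N, 0 ≤ b i)
    (hw : ∀ i < N, |w i - p i| ≤ u * p i)
    (hSA : |∑ i ∈ Finset.range N, p i * a i - A| ≤ ε * A)
    (hSD : |∑ i ∈ Finset.range N, p i * b i - D| ≤ ε * D) :
    Real.exp (-(3 * u + 3 * ε)) * (A / D) ≤
        (∑ i ∈ Finset.range N, w i * a i) / ∑ i ∈ Finset.range N, w i * b i ∧
      (∑ i ∈ Finset.range N, w i * a i) / ∑ i ∈ Finset.range N, w i * b i ≤
        Real.exp (3 * u + 3 * ε) * (A / D) := by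
  -- Each sum has exponent `u + ε` above and `2 u + 2 ε` below; a quotient uses one of each, hence
  -- `3 u + 3 ε`.
  have key : ∀ (c : ℕ → ℝ) (M : ℝ), 0 < M → (∀ i < N, 0 ≤ c i) →
      |∑ i ∈ Finset.range N, p i * c i - M| ≤ ε * M →
      Real.exp (-(2 * u + 2 * ε)) * M ≤ ∑ i ∈ Finset.range N, w i * c i ∧
      ∑ i ∈ Finset.range N, w i * c i ≤ Real.exp (u + ε) * M := by
    intro c M hM hc hS
    have h1 := abs_le.1 hS
    have h2 : (1 - u) * ∑ i ∈ Finset.range N, p i * c i ≤ ∑ i ∈ Finset.range N, w i * c i := by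
      rw [Finset.mul_sum]
      refine Finset.sum_le_sum fun i hi => ?_
      have h3 := abs_le.1 (hw i (Finset.mem_range.1 hi))
      rw [← mul_assoc]
      exact mul_le_mul_of_nonneg_right (by linarith) (hc i (Finset.mem_range.1 hi))
    have h2' : ∑ i ∈ Finset.range N, w i * c i ≤ (1 + u) * ∑ i ∈ Finset.range N, p i * c i := by
      rw [Finset.mul_sum]
      refine Finset.sum_le_sum fun i hi => ?_
      have h3 := abs_le.1 (hw i (Finset.mem_range.1 hi))
      rw [← mul_assoc]
      exact mul_le_mul_of_nonneg_right (by linarith) (hc i (Finset.mem_range.1 hi))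
    have e1 := exp_neg_two_mul_le hu0 hu
    have e2 := exp_neg_two_mul_le hε0 hε
    have e3 := Real.add_one_le_exp u
    have e4 := Real.add_one_le_exp ε
    constructor
    · rw [neg_add, Real.exp_add, mul_assoc]
      refine le_trans ?_ h2
      gcongr
      · linarith
      · nlinarith
    · rw [Real.exp_add, mul_assoc]
      refine h2'.trans ?_
      gcongr
      · nlinarith
      · linarith
      · nlinarith
  obtain ⟨hA1, hA2⟩ := key a A hA ha hSA
  obtain ⟨hD1, hD2⟩ := key b D hD hb hSD
  have hDpos : 0 < ∑ i ∈ Finset.range N, w i * b i :=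
    lt_of_lt_of_le (mul_pos (Real.exp_pos _) hD) hD1
  constructor
  · rw [le_div_iff₀ hDpos]
    calc _ ≤ Real.exp (-(3 * u + 3 * ε)) * (A / D) * (Real.exp (u + ε) * D) := by gcongr
      _ = Real.exp (-(2 * u + 2 * ε)) * A := by
          have : Real.exp (-(2 * u + 2 * ε)) =
            Real.exp (-(3 * u + 3 * ε)) * Real.exp (u + ε) := by
            rw [← Real.exp_add]; congr 1; ring
          rw [this]; field_simp
      _ ≤ _ := hA1
  · rw [div_le_iff₀ hDpos]
    calc _ ≤ Real.exp (u + ε) * A := hA2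
      _ = Real.exp (3 * u + 3 * ε) * (A / D) * (Real.exp (-(2 * u + 2 * ε)) * D) := by
          have : Real.exp (u + ε) =
            Real.exp (3 * u + 3 * ε) * Real.exp (-(2 * u + 2 * ε)) := by
            rw [← Real.exp_add]; congr 1; ring
          rw [this]; field_simp
      _ ≤ _ := by gcongr

lemma survivalHat_antitone {K : ℝ → ℝ} (hK : ∀ u, 0 ≤ K u) {h : ℝ} {N : ℕ} {w T Y : ℕ → ℝ}
    (hw : ∀ i < N, 0 ≤ w i) (t : ℝ) : Antitone (survivalHat K h N w T Y t) := by
  intro y z hyz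
  have hnn : ∀ i ∈ Finset.range N, 0 ≤ w i * K ((T i - t) / h) := fun i hi =>
    mul_nonneg (hw i (Finset.mem_range.1 hi)) (hK _)
  refine div_le_div_of_nonneg_right (Finset.sum_le_sum fun i hi => ?_) (Finset.sum_nonneg hnn)
  have h1 := hw i (Finset.mem_range.1 hi)
  have h2 := hK ((T i - t) / h)
  gcongr
  split_ifs <;> linarith

/-- Monotonicity localizes the estimated quantile from two values of the estimated survival
function, so no uniform convergence over levels is needed. -/
lemma quantileHat_mem_Icc {K : ℝ → ℝ} (hK : ∀ u, 0 ≤ K u) {h : ℝ} {N : ℕ} {w T Y : ℕ → ℝ}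
    (hw : ∀ i < N, 0 ≤ w i) {t p y z : ℝ} (hy : p < survivalHat K h N w T Y t y)
    (hz : survivalHat K h N w T Y t z ≤ p) :
    quantileHat K h N w T Y t (1 - p) ∈ Icc y z := by
  have hlow : y ∈ lowerBounds {z | survivalHat K h N w T Y t z ≤ 1 - (1 - p)} := by
    intro x hx
    rw [sub_sub_cancel] at hx
    by_contra hlt
    exact absurd (survivalHat_antitone hK hw t (not_le.1 hlt).le) (not_le.2 (lt_of_le_of_lt hx hy))
  have hmem : z ∈ {z | survivalHat K h N w T Y t z ≤ 1 - (1 - p)} := by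
    rw [sub_sub_cancel]; exact hz
  exact ⟨le_csInf ⟨z, hmem⟩ hlow, csInf_le ⟨y, hlow⟩ hmem⟩


/-! ### Consistency of the intermediate quantile estimator -/

section Rates

variable {Ω₀ : Type*} [MeasurableSpace Ω₀] {P : Measure Ω₀} [IsProbabilityMeasure P]
  {Y : ℝ → Ω₀ → ℝ} {t : ℝ} {α h k δ : ℕ → ℝ}

lemma ExtremeRates.fraction_mem (hr : ExtremeRates α h k δ) :
    ∀ᶠ N : ℕ in atTop, 0 < k N ∧ 0 < N ∧ 0 < k N / N ∧ k N / N < 1 := by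
  filter_upwards [hr.threshold.eventually_gt_atTop 0, eventually_gt_atTop 0,
    hr.threshold_fraction.eventually_lt_const one_pos] with N h1 h2 h3
  exact ⟨h1, h2, div_pos h1 (by exact_mod_cast h2), h3⟩

lemma ExtremeRates.tendsto_sqrt (hr : ExtremeRates α h k δ) :
    Tendsto (fun N => Real.sqrt (k N * h N)) atTop atTop :=
  Real.tendsto_sqrt_atTop.comp hr.effective_size

lemma ExtremeRates.tendsto_abs_log (hr : ExtremeRates α h k δ) :
    Tendsto (fun N : ℕ => |Real.log (k N / N)|) atTop atTop := by
  refine tendsto_abs_atBot_atTop.comp (Real.tendsto_log_nhdsGT_zero.comp ?_)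
  exact tendsto_nhdsWithin_iff.2 ⟨hr.threshold_fraction, hr.fraction_mem.mono fun N hN => hN.2.2.1⟩

lemma ExtremeRates.tendsto_sqrt_mul_weight (hr : ExtremeRates α h k δ) (hδ : ∀ N, 0 ≤ δ N) :
    Tendsto (fun N => Real.sqrt (k N * h N) * δ N) atTop (𝓝 0) := by
  have h1 := (Real.continuous_sqrt.tendsto 0).comp hr.weight_rate
  rw [Real.sqrt_zero] at h1
  refine h1.congr' (hr.fraction_mem.mono fun N hN => ?_)
  have := hr.bandwidth_pos N
  simp only [Function.comp]
  rw [Real.sqrt_mul (mul_pos hN.1 this).le, Real.sqrt_sq (hδ N)]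

lemma quantile_tendsto_atTop (hY : Measurable (Y t)) (hc : Continuous (survival P Y t))
    (hpos : ∀ y, 0 < survival P Y t y) {p : ℕ → ℝ} (hp0 : ∀ᶠ N in atTop, 0 < p N)
    (hp : Tendsto p atTop (𝓝 0)) :
    Tendsto (fun N => quantile P Y t (1 - p N)) atTop atTop := by
  refine tendsto_atTop.2 fun c => ?_
  filter_upwards [hp0, hp.eventually_lt_const one_pos, hp.eventually_lt_const (hpos c)]
    with N h1 h2 h3
  exact (lt_quantile_of_lt hY hc h1 h2 h3).le

/-- Near the intermediate quantile the survival function varies with the treatment by a factor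
which is negligible at the rate `√(k h)`. -/
lemma exists_oscillation_bound {γ : ℝ → ℝ} (hγ : HeavyTails P Y γ) (ht : t ∈ treatments)
    (hY : Measurable (Y t)) {A : ℝ → ℝ → ℝ} (hr : ExtremeRates α h k δ)
    (hb : NegligibleBias P Y A h k t) {x : ℕ → ℝ} (hx : Tendsto x atTop (𝓝 0)) :
    ∃ β : ℕ → ℝ, Tendsto (fun N => Real.sqrt (k N * h N) * β N) atTop (𝓝 0) ∧
      ∀ᶠ N : ℕ in atTop, ∀ y ∈ Icc (quantile P Y t (1 - k N / N) * Real.exp (-x N))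
          (quantile P Y t (1 - k N / N) * Real.exp (x N)),
        ∀ s ∈ treatments, |s - t| ≤ h N →
          |Real.log (survival P Y s y / survival P Y t y)| ≤ β N := by
  obtain ⟨b, hb01, -, hlim⟩ := hb.oscillation
  have hc : Continuous (survival P Y t) := (hγ.smooth_outcome t ht).continuous
  have hpos : ∀ y, 0 < survival P Y t y := survival_pos hγ ht
  have hκ : (0 : ℝ) < 1 / γ t := one_div_pos.2 (hγ.index_pos t ht)
  obtain ⟨y₀, hy₀, hvm⟩ := von_mises_bounds (hγ.smooth_outcome t ht) hpos (hγ.von_mises t ht)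
    (half_lt_self hκ) (lt_add_one _)
  set a := 1 / γ t / 2 with ha
  have ha0 : 0 < a := by positivity
  set q : ℕ → ℝ := fun N => quantile P Y t (1 - k N / N) with hq
  have hqT : Tendsto q atTop atTop := quantile_tendsto_atTop hY hc hpos
    (hr.fraction_mem.mono fun N hN => hN.2.2.1) hr.threshold_fraction
  set w : ℕ → ℝ≥0∞ := fun N => oscillation P Y t (b * q N) (h N) with hw
  have hlog := hr.tendsto_abs_log
  -- The oscillation is measured relative to `log y`. The von Mises condition gives `log q ≤ |log (k
  -- / N)| / a + log y₀`, and the extra `2` absorbs `log y₀` and `x N`.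
  refine ⟨fun N => (1 / a + 2) * ((w N).toReal * |Real.log (k N / N)|), ?_, ?_⟩
  · have h1 := ((ENNReal.tendsto_toReal ENNReal.zero_ne_top).comp hlim).const_mul (1 / a + 2)
    rw [ENNReal.toReal_zero, mul_zero] at h1
    refine h1.congr fun N => ?_
    simp only [Function.comp, ENNReal.toReal_mul, ENNReal.toReal_ofReal (Real.sqrt_nonneg _),
      ENNReal.toReal_ofReal (abs_nonneg _), hw, hq]
    ring
  have hexp1 : ∀ᶠ N in atTop, b < Real.exp (-x N) := by
    have h1 : Tendsto (fun N => Real.exp (-x N)) atTop (𝓝 1) := by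
      have := (Real.continuous_exp.tendsto _).comp hx.neg
      rwa [neg_zero, Real.exp_zero] at this
    exact h1.eventually_const_lt hb01.2
  filter_upwards [hexp1, hqT.eventually_ge_atTop y₀, hqT.eventually_gt_atTop (1 / b),
    hlim.eventually_lt_const one_pos, hr.tendsto_sqrt.eventually_gt_atTop 0,
    hlog.eventually_ge_atTop (|Real.log y₀| + 1),
    hx.eventually_lt_const one_pos, hr.fraction_mem] with N h1 h2 h3 h4 h5 h6 h7 h8 y hy s hs hst
  have hq0 : 0 < q N := hy₀.trans_le h2
  have hby : b * q N ≤ y := by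
    refine le_trans ?_ hy.1
    rw [mul_comm]
    exact mul_le_mul_of_nonneg_left h1.le hq0.le
  have hy1 : 1 < y := by
    refine lt_of_lt_of_le ?_ hby
    rw [div_lt_iff₀ hb01.1] at h3
    linarith
  have hlogy : 0 < Real.log y := Real.log_pos hy1
  -- Finiteness must be checked, since `toReal` sends `∞` to `0`; an infinite oscillation would make
  -- the product in the bias condition infinite.
  have hwfin : w N ≠ ∞ := by
    intro htop
    have h9 : 0 < |Real.log (k N / N)| := lt_of_lt_of_le (by positivity) h6
    have : ENNReal.ofReal (Real.sqrt (k N * h N)) * w N * ENNReal.ofReal |Real.log (k N / N)|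
        = ∞ := by
      rw [htop, ENNReal.mul_top (ENNReal.ofReal_pos.2 h5).ne', ENNReal.top_mul
        (ENNReal.ofReal_pos.2 h9).ne']
    exact absurd h4 (by rw [this]; simp)
  have hle : ENNReal.ofReal (|Real.log (survival P Y s y / survival P Y t y)| / Real.log y)
      ≤ w N := by
    simp only [hw, oscillation]
    exact le_iSup₂_of_le y hby (le_iSup₂_of_le (f := fun s (_ : s ∈ treatments ∧ |s - t| ≤ h N) =>
      ENNReal.ofReal (|Real.log (survival P Y s y / survival P Y t y)| / Real.log y))
      s ⟨hs, hst⟩ le_rfl)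
  rw [ENNReal.ofReal_le_iff_le_toReal hwfin, div_le_iff₀ hlogy] at hle
  have hlogq : a * (Real.log (q N) - Real.log y₀) ≤ |Real.log (k N / N)| := by
    have h9 := (hvm y₀ (q N) le_rfl h2).1
    have h10 : survival P Y t (q N) = k N / N := survival_quantile hY hc h8.2.2.1 h8.2.2.2
    have h11 : Real.log (survival P Y t y₀) ≤ 0 :=
      Real.log_nonpos (hpos _).le (survival_le_one _)
    rw [h10] at h9
    linarith [neg_abs_le (Real.log (k N / N))]
  have hlogy2 : Real.log y ≤ (1 / a + 2) * |Real.log (k N / N)| := by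
    have h9 : Real.log y ≤ Real.log (q N) + x N := by
      have := Real.log_le_log (by linarith) hy.2
      rwa [Real.log_mul hq0.ne' (Real.exp_pos _).ne', Real.log_exp] at this
    have h10 : Real.log (q N) - Real.log y₀ ≤ 1 / a * |Real.log (k N / N)| := by
      rw [one_div, ← div_eq_inv_mul, le_div_iff₀ ha0]; linarith
    have := le_abs_self (Real.log y₀)
    have := abs_nonneg (Real.log y₀)
    linarith
  calc _ ≤ (w N).toReal * Real.log y := hle
    _ ≤ (w N).toReal * ((1 / a + 2) * |Real.log (k N / N)|) := by gcongr
    _ = _ := by ring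

end Rates


section Sample

variable {r : ℕ} {Ω₀ : Type*} [MeasurableSpace Ω₀] {P₀ : Measure Ω₀} [IsProbabilityMeasure P₀]
  {T : Ω₀ → ℝ} {X : Ω₀ → Cov r} {Y : ℝ → Ω₀ → ℝ} {fT : ℝ → ℝ} {fTX : ℝ → Cov r → ℝ}
  {K : ℝ → ℝ} {Ω : Type*} [MeasurableSpace Ω] {P : Measure Ω} [IsProbabilityMeasure P]
  {Ts : ℕ → Ω → ℝ} {Xs : ℕ → Ω → Cov r} {Ys : ℕ → Ω → ℝ}

/-- Chebyshev's inequality for the kernel sums of an i.i.d. sample. -/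
lemma measure_kernel_sum_deviation {P₀ : Measure Ω₀} (hfT : ContinuousOn fT treatments)
    (hfTX : Measurable (Function.uncurry fTX)) (hK : Measurable K)
    (hindep : iIndepFun (fun i ω => (Ts i ω, Xs i ω, Ys i ω)) P)
    (hident : ∀ i, IdentDistrib (fun ω => (Ts i ω, Xs i ω, Ys i ω)) (observation T X Y) P P₀)
    {t h B ε : ℝ} {E : Set ℝ} (hE : MeasurableSet E)
    (hb : ∀ᵐ ω ∂P₀, 0 ≤ contribution fT fTX K t h E (observation T X Y ω) ∧
      contribution fT fTX K t h E (observation T X Y ω) ≤ B)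
    (hm0 : 0 < ∫ ω, contribution fT fTX K t h E (observation T X Y ω) ∂P₀) (hε : 0 < ε)
    {N : ℕ} (hN : 0 < N) :
    P {ω | ε * (N * ∫ ω, contribution fT fTX K t h E (observation T X Y ω) ∂P₀) ≤
        |∑ i ∈ Finset.range N, contribution fT fTX K t h E (Ts i ω, Xs i ω, Ys i ω) -
          N * ∫ ω, contribution fT fTX K t h E (observation T X Y ω) ∂P₀|} ≤
      ENNReal.ofReal
        (B / (ε ^ 2 * (N * ∫ ω, contribution fT fTX K t h E (observation T X Y ω) ∂P₀))) := by
  have hm := measurable_contribution hfT hfTX hK t h hE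
  have hid : ∀ i, IdentDistrib (fun ω => contribution fT fTX K t h E (Ts i ω, Xs i ω, Ys i ω))
      (fun ω => contribution fT fTX K t h E (observation T X Y ω)) P P₀ := fun i =>
    (hident i).comp hm
  refine chebyshev_sum (fun i => (hid i).aemeasurable_fst)
    (hindep.comp (fun _ => contribution fT fTX K t h E) fun _ => hm) (fun i => ?_)
    (fun i => (hid i).integral_eq) hm0 hε hN
  exact (hid i).symm.ae_snd (p := fun v => 0 ≤ v ∧ v ≤ B) measurableSet_Icc hb

/-- The intermediate quantile estimator, for a given sample, under bounds on the deviations of the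
kernel sums and of the weights. -/
lemma quantileHat_mem_of_deviation (hK : ∀ u, 0 ≤ K u) {t h : ℝ} {N : ℕ} {τ : ℕ → ℝ}
    {ξ : ℕ → Cov r} {υ w : ℕ → ℝ} {u ε β c p y z D Ay Az Fy Fz : ℝ}
    (hu0 : 0 ≤ u) (hu : u ≤ 1 / 2) (hε0 : 0 ≤ ε) (hε : ε ≤ 1 / 2) (hD : 0 < D)
    (hAy : 0 < Ay) (hAz : 0 < Az) (hp : 0 < p)
    (hweight : ∀ i < N, 0 ≤ weight fT fTX (τ i) (ξ i))
    (hw : ∀ i < N, |w i - weight fT fTX (τ i) (ξ i)| ≤ u * weight fT fTX (τ i) (ξ i))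
    (hSD : |∑ i ∈ Finset.range N, contribution fT fTX K t h univ (τ i, ξ i, υ i) - D| ≤ ε * D)
    (hSy : |∑ i ∈ Finset.range N, contribution fT fTX K t h (Ioi y) (τ i, ξ i, υ i) - Ay| ≤ ε * Ay)
    (hSz : |∑ i ∈ Finset.range N, contribution fT fTX K t h (Ioi z) (τ i, ξ i, υ i) - Az| ≤ ε * Az)
    (hAD : Fy * Real.exp (-β) * D ≤ Ay) (hAD' : Az ≤ Fz * Real.exp β * D)
    (hFy : p * Real.exp c ≤ Fy) (hFz : Fz ≤ p * Real.exp (-c)) (hc : 3 * u + 3 * ε + β < c) :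
    quantileHat K h N w τ υ t (1 - p) ∈ Icc y z := by
  have hwpos : ∀ i < N, 0 ≤ w i := fun i hi => by
    have h1 := (abs_le.1 (hw i hi)).1
    have h2 := hweight i hi
    nlinarith
  have hsum : ∀ x : ℝ, ∑ i ∈ Finset.range N, contribution fT fTX K t h (Ioi x) (τ i, ξ i, υ i) =
      ∑ i ∈ Finset.range N, weight fT fTX (τ i) (ξ i) *
        ((if x < υ i then 1 else 0) * K ((τ i - t) / h)) := by
    intro x
    refine Finset.sum_congr rfl fun i _ => ?_
    rw [contribution, mul_assoc]
    simp [indicator]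
  have hsumD : ∑ i ∈ Finset.range N, contribution fT fTX K t h univ (τ i, ξ i, υ i) =
      ∑ i ∈ Finset.range N, weight fT fTX (τ i) (ξ i) * K ((τ i - t) / h) := by
    simp [contribution]
  have hhat : ∀ x : ℝ, survivalHat K h N w τ υ t x = (∑ i ∈ Finset.range N, w i *
      ((if x < υ i then 1 else 0) * K ((τ i - t) / h))) /
        ∑ i ∈ Finset.range N, w i * K ((τ i - t) / h) := by
    intro x
    simp only [survivalHat, mul_assoc]
  rw [hsumD] at hSD
  rw [hsum] at hSy hSz
  have hnn : ∀ x : ℝ, ∀ i < N, 0 ≤ (if x < υ i then (1 : ℝ) else 0) * K ((τ i - t) / h) :=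
    fun x i _ => mul_nonneg (by split_ifs <;> norm_num) (hK _)
  have by1 := (ratio_sum_bounds hu0 hu hε0 hε hAy hD (hnn y) (fun i _ => hK _) hw hSy hSD).1
  have bz1 := (ratio_sum_bounds hu0 hu hε0 hε hAz hD (hnn z) (fun i _ => hK _) hw hSz hSD).2
  refine quantileHat_mem_Icc hK hwpos ?_ ?_
  -- The gain `exp c` from moving away from the quantile beats the losses due to weights, sampling
  -- and oscillation, whose exponents sum to less than `c`.
  · rw [hhat]
    refine lt_of_lt_of_le ?_ by1
    have h1 : p * Real.exp c * Real.exp (-β) ≤ Ay / D := by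
      rw [le_div_iff₀ hD]
      exact le_trans (by gcongr) hAD
    calc p < p * Real.exp (c - β - (3 * u + 3 * ε)) := by
          rw [lt_mul_iff_one_lt_right hp, Real.one_lt_exp_iff]; linarith
      _ = Real.exp (-(3 * u + 3 * ε)) * (p * Real.exp c * Real.exp (-β)) := by
          have : c - β - (3 * u + 3 * ε) = -(3 * u + 3 * ε) + c + -β := by ring
          rw [this, Real.exp_add, Real.exp_add]; ring
      _ ≤ _ := by gcongr
  · rw [hhat]
    refine bz1.trans ?_
    have h1 : Az / D ≤ p * Real.exp (-c) * Real.exp β := by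
      rw [div_le_iff₀ hD]
      exact hAD'.trans (by gcongr)
    calc _ ≤ Real.exp (3 * u + 3 * ε) * (p * Real.exp (-c) * Real.exp β) := by gcongr
      _ = p * Real.exp (3 * u + 3 * ε + -c + β) := by
          rw [Real.exp_add (3 * u + 3 * ε + -c) β, Real.exp_add (3 * u + 3 * ε) (-c)]; ring
      _ ≤ p := by
          rw [mul_le_iff_le_one_right hp, Real.exp_le_one_iff]; linarith

/-- Bounds on a survival function at a relative distance `exp (± x)` of a point `q`. -/
lemma survival_near {F : ℝ → ℝ} (hpos : ∀ y, 0 < F y) {a b y₀ q x : ℝ}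
    (hx : 0 ≤ x)
    (hvm : ∀ y z, y₀ ≤ y → y ≤ z →
      a * (Real.log z - Real.log y) ≤ Real.log (F y) - Real.log (F z) ∧
      Real.log (F y) - Real.log (F z) ≤ b * (Real.log z - Real.log y))
    (hq0 : 0 < q) (hq : y₀ ≤ q * Real.exp (-x)) :
    F q * Real.exp (a * x) ≤ F (q * Real.exp (-x)) ∧
      F (q * Real.exp x) ≤ F q * Real.exp (-(a * x)) ∧
      F q * Real.exp (-(b * x)) ≤ F (q * Real.exp x) := by
  have hle1 : q * Real.exp (-x) ≤ q :=
    mul_le_of_le_one_right hq0.le (Real.exp_le_one_iff.2 (by linarith))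
  have hle2 : q ≤ q * Real.exp x := le_mul_of_one_le_right hq0.le (Real.one_le_exp hx)
  have hlog1 : Real.log (q * Real.exp (-x)) = Real.log q - x := by
    rw [Real.log_mul hq0.ne' (Real.exp_pos _).ne', Real.log_exp]; ring
  have hlog2 : Real.log (q * Real.exp x) = Real.log q + x := by
    rw [Real.log_mul hq0.ne' (Real.exp_pos _).ne', Real.log_exp]
  have hv1 := hvm _ _ hq hle1
  have hv2 := hvm _ _ (hq.trans hle1) hle2
  rw [hlog1] at hv1
  rw [hlog2] at hv2
  have hlog : ∀ c, Real.log (F q * Real.exp c) = Real.log (F q) + c := fun c => by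
    rw [Real.log_mul (hpos q).ne' (Real.exp_pos _).ne', Real.log_exp]
  have hp : ∀ c, 0 < F q * Real.exp c := fun c => mul_pos (hpos q) (Real.exp_pos c)
  refine ⟨?_, ?_, ?_⟩
  · rw [← Real.log_le_log_iff (hp _) (hpos _), hlog]; linarith [hv1.1]
  · rw [← Real.log_le_log_iff (hpos _) (hp _), hlog]; linarith [hv2.1]
  · rw [← Real.log_le_log_iff (hp _) (hpos _), hlog]; linarith [hv2.2]

/-- For large `N`: bounds on the means of the contributions near the intermediate quantile, and on
the deviations of the kernel sums. -/
lemma eventually_deviation_bounds {κ : Kernel (ℝ × Cov r) ℝ} {γ : ℝ → ℝ} {A : ℝ → ℝ → ℝ}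
    (hmeas : MeasurableModel T X Y) (hγ : HeavyTails P₀ Y γ)
    (hdens : TreatmentDensities P₀ T X fT fTX) (hreg : RegularLaw P₀ T X Y fT κ)
    (hindep : iIndepFun (fun i ω => (Ts i ω, Xs i ω, Ys i ω)) P)
    (hident : ∀ i, IdentDistrib (fun ω => (Ts i ω, Xs i ω, Ys i ω)) (observation T X Y) P P₀)
    (hK : IsSmoothingKernel K) {δ α h k : ℕ → ℝ} (hr : ExtremeRates α h k δ) {t : ℝ}
    (ht : t ∈ treatments) (hbias : NegligibleBias P₀ Y A h k t) {x : ℕ → ℝ}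
    (hx : Tendsto x atTop (𝓝 0)) (hx0 : ∀ᶠ N in atTop, 0 < x N)
    (hxs : Tendsto (fun N => x N * Real.sqrt (k N * h N)) atTop atTop) {η B : ℝ} (hη : 0 < η)
    (hB : 0 < B)
    (hbd : ∀ t h : ℝ, ∀ E : Set ℝ, ∀ᵐ ω ∂P₀,
        0 ≤ contribution fT fTX K t h E (observation T X Y ω) ∧
          contribution fT fTX K t h E (observation T X Y ω) ≤ B)
    (hmean : ∀ t ∈ treatments, ∀ h : ℝ, 0 < h → h ≤ 1 / 2 →
        η * h ≤ ∫ ω, contribution fT fTX K t h univ (observation T X Y ω) ∂P₀ ∧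
        ∀ y β : ℝ, 0 < survival P₀ Y t y →
          (∀ s ∈ treatments, |s - t| ≤ h → 0 < survival P₀ Y s y ∧
            |Real.log (survival P₀ Y s y / survival P₀ Y t y)| ≤ β) →
          survival P₀ Y t y * Real.exp (-β) *
              (∫ ω, contribution fT fTX K t h univ (observation T X Y ω) ∂P₀) ≤
            ∫ ω, contribution fT fTX K t h (Ioi y) (observation T X Y ω) ∂P₀ ∧
          ∫ ω, contribution fT fTX K t h (Ioi y) (observation T X Y ω) ∂P₀ ≤
            survival P₀ Y t y * Real.exp β *
              (∫ ω, contribution fT fTX K t h univ (observation T X Y ω) ∂P₀))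
    {q : ℕ → ℝ} (hq : q = fun N : ℕ => quantile P₀ Y t (1 - k N / N))
    {m : ℕ → Set ℝ → ℝ} (hm : m = fun N E =>
      ∫ ω, contribution fT fTX K t (h N) E (observation T X Y ω) ∂P₀) :
    ∃ a : ℝ, 0 < a ∧ ∃ β : ℕ → ℝ, ∀ᶠ N : ℕ in atTop,
      0 < x N ∧ a * x N / 12 ≤ 1 / 2 ∧ β N ≤ a * x N / 4 ∧ 0 < N ∧ 0 < k N / N ∧
      survival P₀ Y t (q N * Real.exp (-x N)) * Real.exp (-β N) * m N univ ≤
        m N (Ioi (q N * Real.exp (-x N))) ∧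
      m N (Ioi (q N * Real.exp (x N))) ≤
        survival P₀ Y t (q N * Real.exp (x N)) * Real.exp (β N) * m N univ ∧
      k N / N * Real.exp (a * x N) ≤ survival P₀ Y t (q N * Real.exp (-x N)) ∧
      survival P₀ Y t (q N * Real.exp (x N)) ≤ k N / N * Real.exp (-(a * x N)) ∧
      ∀ E ∈ ({univ, Ioi (q N * Real.exp (-x N)), Ioi (q N * Real.exp (x N))} : Set (Set ℝ)),
        0 < m N E ∧ P {ω | a * x N / 12 * (N * m N E) ≤
            |∑ i ∈ Finset.range N, contribution fT fTX K t (h N) E (Ts i ω, Xs i ω, Ys i ω) -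
              N * m N E|} ≤
          ENNReal.ofReal (B * 576 / (η * a ^ 2) *
            ((x N * Real.sqrt (k N * h N)) ^ 2)⁻¹) := by
  have hY := hmeas.outcome t ht
  have hc : Continuous (survival P₀ Y t) := (hγ.smooth_outcome t ht).continuous
  have hpos : ∀ y, 0 < survival P₀ Y t y := survival_pos hγ ht
  have hfT : ContinuousOn fT treatments := hreg.smooth_density.continuousOn
  have hκ : (0 : ℝ) < 1 / γ t := one_div_pos.2 (hγ.index_pos t ht)
  obtain ⟨y₀, hy₀, hvm⟩ := von_mises_bounds (hγ.smooth_outcome t ht) hpos (hγ.von_mises t ht)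
    (half_lt_self hκ) (lt_add_one _)
  obtain ⟨a, ha⟩ : ∃ a, a = 1 / γ t / 2 := ⟨_, rfl⟩
  obtain ⟨b, hb⟩ : ∃ b, b = 1 / γ t + 1 := ⟨_, rfl⟩
  rw [← ha, ← hb] at hvm
  have ha0 : 0 < a := by rw [ha]; positivity
  obtain ⟨β, hβ, hosc⟩ := exists_oscillation_bound hγ ht hY hr hbias hx
  have hqT : Tendsto q atTop atTop := by
    rw [hq]
    exact quantile_tendsto_atTop hY hc hpos
      (hr.fraction_mem.mono fun N hN => hN.2.2.1) hr.threshold_fraction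
  have hax : ∀ᶠ N in atTop, a * x N / 12 ≤ 1 / 6 := by
    have h1 := (hx.const_mul a).div_const 12
    rw [mul_zero, zero_div] at h1
    exact h1.eventually_le_const (by norm_num)
  have hbx : ∀ᶠ N in atTop, b * x N ≤ Real.log 2 := by
    have h1 := hx.const_mul b
    rw [mul_zero] at h1
    exact h1.eventually_le_const (Real.log_pos one_lt_two)
  refine ⟨a, ha0, β, ?_⟩
  filter_upwards [hx0, hax, hbx, hr.fraction_mem, hosc, hqT.eventually_ge_atTop (2 * y₀),
    hx.eventually_le_const (Real.log_pos one_lt_two), hβ.eventually_lt_const one_pos,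
    hxs.eventually_ge_atTop (4 / a), hr.tendsto_sqrt.eventually_gt_atTop 0,
    hr.bandwidth.eventually_le_const (show (0 : ℝ) < 1 / 2 by norm_num)]
    with N h1 h2 h3 h4 h5 h6 h7 h8 h9 h10 h11
  clear hax hbx hosc hβ hqT
  obtain ⟨hk0, hN0, hp0, hp1⟩ := h4
  have hh0 := hr.bandwidth_pos N
  have hNR : (0 : ℝ) < N := by exact_mod_cast hN0
  have hq0 : 0 < q N := by linarith
  have hFq : survival P₀ Y t (q N) = k N / N := by
    rw [hq]; exact survival_quantile hY hc hp0 hp1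
  -- Eventually `√(k h) β ≤ 1`, while `a x √(k h) / 4 ≥ 1`.
  have hβx : β N ≤ a * x N / 4 := by
    rw [div_le_iff₀ ha0] at h9
    refine le_of_mul_le_mul_right ?_ h10
    linarith
  have hehalf : 1 / 2 ≤ Real.exp (-x N) := by
    rw [← Real.log_le_iff_le_exp (by norm_num), one_div, Real.log_inv]; linarith
  have hy1 : y₀ ≤ q N * Real.exp (-x N) := by
    have := mul_le_mul_of_nonneg_left hehalf hq0.le
    linarith
  obtain ⟨hF1, hF2, hF3⟩ := survival_near hpos h1.le hvm hq0 hy1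
  rw [hFq] at hF1 hF2 hF3
  replace hF3 : k N / N / 2 ≤ survival P₀ Y t (q N * Real.exp (x N)) := by
    refine le_trans ?_ hF3
    have : 1 / 2 ≤ Real.exp (-(b * x N)) := by
      rw [← Real.log_le_iff_le_exp (by norm_num), one_div, Real.log_inv]; linarith
    have := mul_le_mul_of_nonneg_left this hp0.le
    linarith
  have hF4 : k N / N / 2 ≤ survival P₀ Y t (q N * Real.exp (-x N)) := by
    refine le_trans ?_ hF1
    have := mul_le_mul_of_nonneg_left (Real.one_le_exp (mul_pos ha0 h1).le) hp0.le
    linarith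
  have hle : q N * Real.exp (-x N) ≤ q N * Real.exp (x N) := by
    gcongr; linarith
  have hE := hmean t ht (h N) hh0 h11
  have hmu : η * h N ≤ m N univ := by rw [hm]; exact hE.1
  have hmE : ∀ y, y ∈ Icc (q N * Real.exp (-x N)) (q N * Real.exp (x N)) →
      survival P₀ Y t y * Real.exp (-β N) * m N univ ≤ m N (Ioi y) ∧
        m N (Ioi y) ≤ survival P₀ Y t y * Real.exp (β N) * m N univ := by
    intro y hy
    rw [hq] at hy
    rw [hm]
    exact hE.2 y (β N) (hpos y) fun s hs hst => ⟨survival_pos hγ hs _, h5 y hy s hs hst⟩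
  have hm1 := hmE (q N * Real.exp (-x N)) ⟨le_rfl, hle⟩
  have hm2 := hmE (q N * Real.exp (x N)) ⟨hle, le_rfl⟩
  clear hE hmE h5
  have heβ : 1 / 2 ≤ Real.exp (-β N) := by
    have := Real.add_one_le_exp (-β N)
    linarith
  -- Near the quantile the survival function is at least half of `k / N`, the oscillation costs at
  -- most another factor `2`, and the kernel mean is at least `η h`: the expected sums are of order
  -- `k h`.
  have hgen : ∀ f : ℝ, k N / N / 2 ≤ f → ∀ v, f * Real.exp (-β N) * m N univ ≤ v →
      η * (k N * h N) / 4 ≤ N * v := by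
    intro f hf v hv
    have h12 : k N / N / 2 * (1 / 2) * (η * h N) ≤ v := by
      refine le_trans ?_ hv
      have : 0 ≤ f := le_trans (by positivity) hf
      gcongr
    calc η * (k N * h N) / 4 = N * (k N / N / 2 * (1 / 2) * (η * h N)) := by field_simp; norm_num
      _ ≤ N * v := by gcongr
  have hlow : ∀ E ∈ ({univ, Ioi (q N * Real.exp (-x N)), Ioi (q N * Real.exp (x N))} :
      Set (Set ℝ)), η * (k N * h N) / 4 ≤ N * m N E := by
    rintro E (rfl | rfl | rfl)
    · refine hgen 1 (by linarith) _ ?_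
      rw [one_mul]
      refine mul_le_of_le_one_left (le_trans (by positivity) hmu) ?_
      -- No sign of `β N` is given; `exp (-β) ≤ exp β` is read off from the two bounds on one mean.
      have h13 := (hm1.1.trans hm1.2)
      have h14 : 0 < m N univ := lt_of_lt_of_le (by positivity) hmu
      have h15 := le_of_mul_le_mul_right h13 h14
      have h16 := le_of_mul_le_mul_left h15 (hpos _)
      rw [Real.exp_le_exp] at h16
      exact Real.exp_le_one_iff.2 (by linarith)
    · exact hgen _ hF4 _ hm1.1
    · exact hgen _ hF3 _ hm2.1
  refine ⟨h1, by linarith, hβx, hN0, hp0, hm1.1, hm2.2, hF1, hF2, fun E hE => ?_⟩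
  have hl := hlow E hE
  have hkh : 0 < η * (k N * h N) / 4 := by positivity
  have hm0 : 0 < m N E := pos_of_mul_pos_right (hkh.trans_le hl) hNR.le
  refine ⟨hm0, ?_⟩
  have hEm : MeasurableSet E := by
    rcases hE with rfl | rfl | rfl
    exacts [MeasurableSet.univ, measurableSet_Ioi, measurableSet_Ioi]
  have hax0 : 0 < a * x N / 12 := by positivity
  rw [hm] at hm0 hl ⊢
  refine (measure_kernel_sum_deviation hfT hdens.measurable_cond hK.measurable hindep hident hEm
    (hbd t (h N) E) hm0 hax0 hN0).trans (ENNReal.ofReal_le_ofReal ?_)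
  -- The constant is `576 = 12 ^ 2 * 4`.
  calc _ ≤ B / ((a * x N / 12) ^ 2 * (η * (k N * h N) / 4)) := by gcongr
    _ = _ := by
      have h12 : (Real.sqrt (k N * h N)) ^ 2 = k N * h N := Real.sq_sqrt (by positivity)
      rw [mul_pow, h12]
      have := h1.ne'
      field_simp
      norm_num

/-- The intermediate quantile estimator is consistent, in relative error, at every rate slower
than `1 / √(k h)`. -/
theorem quantileHat_consistent {κ : Kernel (ℝ × Cov r) ℝ} {γ : ℝ → ℝ} {A : ℝ → ℝ → ℝ}
    (hmeas : MeasurableModel T X Y) (hγ : HeavyTails P₀ Y γ) (hunconf : Unconfounded P₀ T X Y)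
    (hdens : TreatmentDensities P₀ T X fT fTX) (hoverlap : Overlap P₀ X fT fTX)
    (hreg : RegularLaw P₀ T X Y fT κ)
    (hindep : iIndepFun (fun i ω => (Ts i ω, Xs i ω, Ys i ω)) P)
    (hident : ∀ i, IdentDistrib (fun ω => (Ts i ω, Xs i ω, Ys i ω)) (observation T X Y) P P₀)
    (hK : IsSmoothingKernel K) {piHat : ℕ → Ω → ℝ → Cov r → ℝ}
    {δ : ℕ → ℝ} (hδ : ∀ N, 0 ≤ δ N)
    (hpi : IsBigOp P (fun N ω => ⨆ i : Fin N, |piHat N ω (Ts i ω) (Xs i ω) -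
        stabWeight fT fTX (Ts i ω) (Xs i ω)|) δ)
    {α h k : ℕ → ℝ} (hr : ExtremeRates α h k δ) {t : ℝ} (ht : t ∈ treatments)
    (hbias : NegligibleBias P₀ Y A h k t) {x : ℕ → ℝ} (hx : Tendsto x atTop (𝓝 0))
    (hx0 : ∀ᶠ N in atTop, 0 < x N)
    (hxs : Tendsto (fun N => x N * Real.sqrt (k N * h N)) atTop atTop) :
    Tendsto (fun N : ℕ => P {ω | quantileHat K (h N) N (fun i => piHat N ω (Ts i ω) (Xs i ω))
        (fun i => Ts i ω) (fun i => Ys i ω) t (1 - k N / N) ∉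
          Icc (quantile P₀ Y t (1 - k N / N) * Real.exp (-x N))
            (quantile P₀ Y t (1 - k N / N) * Real.exp (x N))}) atTop (𝓝 0) := by
  have hcs : ∀ t ∈ treatments, Continuous (survival P₀ Y t) := fun t ht =>
    (hγ.smooth_outcome t ht).continuous
  obtain ⟨η, B, hη, hB, hwη, hbd, hmean⟩ := exists_contribution_mean_bounds hmeas hunconf hdens
    hoverlap hreg hK (hident 0).aemeasurable_snd hcs
  set q : ℕ → ℝ := fun N => quantile P₀ Y t (1 - k N / N) with hq
  set m : ℕ → Set ℝ → ℝ := fun N E =>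
    ∫ ω, contribution fT fTX K t (h N) E (observation T X Y ω) ∂P₀ with hm
  obtain ⟨a, ha0, β, hdet⟩ := eventually_deviation_bounds hmeas hγ hdens hreg hindep hident hK hr
    ht hbias hx hx0 hxs hη hB hbd hmean hq hm
  set s : ℕ → ℝ := fun N => Real.sqrt (k N * h N) with hs
  set dev : ℕ → Set ℝ → Set Ω := fun N E => {ω | a * x N / 12 * (N * m N E) ≤
    |∑ i ∈ Finset.range N, contribution fT fTX K t (h N) E (Ts i ω, Xs i ω, Ys i ω) -
      N * m N E|} with hdev
  -- the weights
  have hae : ∀ᵐ ω ∂P, ∀ i, Ts i ω ∈ treatments ∧ Xs i ω ∈ covSupport P₀ X := by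
    refine ae_all_iff.2 fun i => ?_
    refine (hident i).symm.ae_snd (p := fun o => o.1 ∈ treatments ∧ o.2.1 ∈ covSupport P₀ X) ?_ ?_
    · exact (measurable_fst measurableSet_Icc).inter
        (measurable_snd.fst Measure.isClosed_support.measurableSet)
    · exact (treatment_mem_ae hmeas.treatment hdens).and (covariate_mem_ae hmeas.covariate)
  refine ENNReal.tendsto_nhds_zero.2 fun ε hε => ?_
  -- A finite positive `e` below `ε`, shared equally by four exceptional events: one for the weights
  -- and three for the kernel sums.
  obtain ⟨e, he0, heε⟩ := ENNReal.lt_iff_exists_nnreal_btwn.1 hε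
  have he : (0 : ℝ) < e := by exact_mod_cast he0
  obtain ⟨M, hM⟩ := hpi (e / 4) (by positivity)
  have hdevlim : Tendsto (fun N => B * 576 / (η * a ^ 2) * ((x N * s N) ^ 2)⁻¹) atTop (𝓝 0) := by
    have h1 : Tendsto (fun N => ((x N * s N) ^ 2)⁻¹) atTop (𝓝 0) :=
      ((tendsto_pow_atTop two_ne_zero).comp hxs).inv_tendsto_atTop
    simpa using h1.const_mul (B * 576 / (η * a ^ 2))
  have hulim := (hr.tendsto_sqrt_mul_weight hδ).const_mul (|M| / η)
  rw [mul_zero] at hulim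
  filter_upwards [hdet, hM, hdevlim.eventually_le_const (show (0 : ℝ) < e / 4 by positivity),
    hulim.eventually_le_const one_pos, hxs.eventually_ge_atTop (12 / a),
    hr.tendsto_sqrt.eventually_gt_atTop 0] with N hN hMN hdN huN hxN hsN
  obtain ⟨hx1, hax, hβx, hN0, hp0, hm1, hm2, hF1, hF2, hE⟩ := hN
  -- The weight error is negligible against `x` because `√(k h) δ → 0` and `x √(k h) → ∞`. With
  -- sampling error `a x / 12` as well and `β ≤ a x / 4`, the exponents total at most `3 a x / 4 < a
  -- x`.
  have hu : |M| / η * δ N ≤ a * x N / 12 := by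
    rw [div_le_iff₀ ha0] at hxN
    have h12 : |M| / η * δ N * s N ≤ a * x N / 12 * s N := by
      simp only [hs]
      linarith
    exact le_of_mul_le_mul_right h12 hsN
  have hu0 : 0 ≤ |M| / η * δ N := mul_nonneg (by positivity) (hδ N)
  set bad := {ω | M * δ N < ⨆ i : Fin N, |piHat N ω (Ts i ω) (Xs i ω) -
    stabWeight fT fTX (Ts i ω) (Xs i ω)|} with hbad
  have hE1 := hE univ (by simp)
  have hE2 := hE (Ioi (q N * Real.exp (-x N))) (by simp)
  have hE3 := hE (Ioi (q N * Real.exp (x N))) (by simp)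
  have hNR : (0 : ℝ) < N := by exact_mod_cast hN0
  have hsub : ∀ᵐ ω ∂P, ω ∈ {ω | quantileHat K (h N) N (fun i => piHat N ω (Ts i ω) (Xs i ω))
        (fun i => Ts i ω) (fun i => Ys i ω) t (1 - k N / N) ∉
          Icc (q N * Real.exp (-x N)) (q N * Real.exp (x N))} →
      ω ∈ ((bad ∪ dev N univ) ∪ dev N (Ioi (q N * Real.exp (-x N)))) ∪
        dev N (Ioi (q N * Real.exp (x N))) := by
    filter_upwards [hae] with ω hω hnot
    by_contra hgood
    have hgood' : ω ∉ ((bad ∪ dev N univ) ∪ dev N (Ioi (q N * Real.exp (-x N)))) ∪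
        dev N (Ioi (q N * Real.exp (x N))) := hgood
    simp only [mem_union, not_or] at hgood'
    obtain ⟨⟨⟨g1, g2⟩, g3⟩, g4⟩ := hgood'
    simp only [hbad, hdev, mem_ofPred_eq, not_lt, not_le] at g1 g2 g3 g4
    refine hnot ?_
    -- The lower bound `η` on the true weights turns the absolute error into a relative one; `|M|`
    -- replaces `M`, whose sign is unknown.
    have hbound : ∀ i < N, |piHat N ω (Ts i ω) (Xs i ω) - weight fT fTX (Ts i ω) (Xs i ω)| ≤
        |M| / η * δ N * weight fT fTX (Ts i ω) (Xs i ω) := by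
      intro i hi
      obtain ⟨h1, h2⟩ := hwη _ (hω i).1 _ (hω i).2
      rw [h1] at h2 ⊢
      have h3 := le_ciSup (f := fun i : Fin N => |piHat N ω (Ts i ω) (Xs i ω) -
        stabWeight fT fTX (Ts i ω) (Xs i ω)|) (Set.finite_range _).bddAbove ⟨i, hi⟩
      simp only at h3
      have h4 : M * δ N ≤ |M| * δ N := mul_le_mul_of_nonneg_right (le_abs_self M) (hδ N)
      have h5 : |M| * δ N = |M| / η * δ N * η := by field_simp
      have h6 : |M| / η * δ N * η ≤ |M| / η * δ N * stabWeight fT fTX (Ts i ω) (Xs i ω) := by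
        gcongr
      linarith
    refine quantileHat_mem_of_deviation (fT := fT) (fTX := fTX) (ξ := fun i => Xs i ω) hK.nonneg
      (u := |M| / η * δ N) (ε := a * x N / 12) (β := β N) (c := a * x N) (p := k N / N)
      (D := N * m N univ) (Ay := N * m N (Ioi (q N * Real.exp (-x N))))
      (Az := N * m N (Ioi (q N * Real.exp (x N))))
      (Fy := survival P₀ Y t (q N * Real.exp (-x N)))
      (Fz := survival P₀ Y t (q N * Real.exp (x N))) hu0 (hu.trans hax) (by positivity) hax
      (mul_pos hNR hE1.1) (mul_pos hNR hE2.1) (mul_pos hNR hE3.1) hp0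
      (fun i _ => hη.le.trans (hwη _ (hω i).1 _ (hω i).2).2) hbound g2.le g3.le g4.le ?_ ?_ hF1 hF2
      ?_
    · nlinarith
    · nlinarith
    · have := mul_pos ha0 hx1
      linarith
  refine (measure_mono_ae hsub).trans ?_
  have hdN' := ENNReal.ofReal_le_ofReal hdN
  refine (measure_union_le _ _).trans ((add_le_add ((measure_union_le _ _).trans
    (add_le_add ((measure_union_le _ _).trans (add_le_add hMN (hE1.2.trans hdN')))
      (hE2.2.trans hdN'))) (hE3.2.trans hdN')).trans ?_)
  rw [← ENNReal.ofReal_add (by positivity) (by positivity),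
    ← ENNReal.ofReal_add (by positivity) (by positivity),
    ← ENNReal.ofReal_add (by positivity) (by positivity)]
  refine le_trans (le_of_eq ?_) heε.le
  rw [← ENNReal.ofReal_coe_nnreal]
  congr 1; ring

end Sample


/-! ### Weak convergence of asymptotically constant processes -/

section Weak

variable {Ω Ω' S : Type*} [MeasurableSpace Ω] [MeasurableSpace Ω'] {P : Measure Ω}
  {P' : Measure Ω'}

/-- The function `g + ρ` is an integrable majorant of `f`, and every majorant dominates `g - ρ`;
measurability of `f` plays no role. -/
lemma abs_outerExpectation_sub_le [IsProbabilityMeasure P] {f g ρ : Ω → ℝ} (hg : Integrable g P)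
    (hρ : Integrable ρ P) (h : ∀ ω, |f ω - g ω| ≤ ρ ω) :
    |outerExpectation P f - ∫ ω, g ω ∂P| ≤ ∫ ω, ρ ω ∂P := by
  have hlow : ∀ c ∈ {c | ∃ g : Ω → ℝ, Integrable g P ∧ (∀ ω, f ω ≤ g ω) ∧ c = ∫ ω, g ω ∂P},
      ∫ ω, g ω ∂P - ∫ ω, ρ ω ∂P ≤ c := by
    rintro c ⟨u, hu, hfu, rfl⟩
    rw [← integral_sub hg hρ]
    refine integral_mono (hg.sub hρ) hu fun ω => ?_
    have := (abs_le.1 (h ω)).1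
    have := hfu ω
    linarith
  have hmem : ∫ ω, g ω ∂P + ∫ ω, ρ ω ∂P ∈
      {c | ∃ g : Ω → ℝ, Integrable g P ∧ (∀ ω, f ω ≤ g ω) ∧ c = ∫ ω, g ω ∂P} := by
    refine ⟨fun ω => g ω + ρ ω, hg.add hρ, fun ω => ?_, (integral_add hg hρ).symm⟩
    have := (abs_le.1 (h ω)).2
    linarith
  rw [abs_le]
  constructor
  · have := le_csInf ⟨_, hmem⟩ hlow
    rw [outerExpectation]
    linarith
  · have := csInf_le ⟨_, hlow⟩ hmem
    rw [outerExpectation]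
    linarith

lemma memℓp_const (v : ℝ × ℝ) : Memℓp (fun _ : S => v) ⊤ :=
  memℓp_infty ⟨‖v‖, by rintro _ ⟨i, rfl⟩; rfl⟩

/-- Constant functions, as bounded functions. -/
def constLInf (S : Type*) (v : ℝ × ℝ) : LInf S := ⟨fun _ => v, memℓp_const v⟩

lemma toLInf_of_memℓp {f : S → ℝ × ℝ} (hf : Memℓp f ⊤) : toLInf f = ⟨f, hf⟩ := dif_pos hf

lemma toLInf_const (v : ℝ × ℝ) : toLInf (fun _ : S => v) = constLInf S v :=
  toLInf_of_memℓp (memℓp_const v)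

lemma dist_toLInf_constLInf_le {f : S → ℝ × ℝ} (hf : Memℓp f ⊤) {v : ℝ × ℝ} {E : ℝ} (hE : 0 ≤ E)
    (h : ∀ i, ‖f i - v‖ ≤ E) : dist (constLInf S v) (toLInf f) ≤ E := by
  rw [dist_comm, dist_eq_norm, toLInf_of_memℓp hf]
  exact lp.norm_le_of_forall_le hE h

lemma continuous_constLInf : Continuous (constLInf S) := by
  refine LipschitzWith.continuous (K := 1) (LipschitzWith.of_dist_le_mul fun v w => ?_)
  rw [NNReal.coe_one, one_mul, dist_comm, ← toLInf_const v]
  rw [dist_comm v w]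
  refine dist_toLInf_constLInf_le (memℓp_const v) dist_nonneg fun i => ?_
  rw [dist_comm, dist_eq_norm]

/-- Tightness of a sequence which converges in distribution. -/
lemma exists_eventually_measure_norm_ge_le [IsProbabilityMeasure P] [IsProbabilityMeasure P']
    {G : ℕ → Ω → ℝ × ℝ} {Γ : Ω' → ℝ × ℝ}
    (hG : TendstoInDistribution G atTop Γ (fun _ => P) P') {ε : ℝ≥0∞} (hε : 0 < ε) :
    ∃ M : ℝ, 0 < M ∧ ∀ᶠ N in atTop, P {ω | M ≤ ‖G N ω‖} < ε := by
  -- The shift by `1` makes the threshold positive. Tightness comes from the portmanteau inequality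
  -- for these closed sets, which decrease to the empty set.
  set F : ℕ → Set (ℝ × ℝ) := fun n => {v | (n : ℝ) + 1 ≤ ‖v‖} with hF
  have hFc : ∀ n, IsClosed (F n) := fun n => isClosed_le continuous_const continuous_norm
  have hlim : Tendsto (fun n => P'.map Γ (F n)) atTop (𝓝 0) := by
    have : IsProbabilityMeasure (P'.map Γ) :=
      Measure.isProbabilityMeasure_map hG.aemeasurable_limit
    have hemp : ⋂ n, F n = ∅ := by
      refine eq_empty_of_forall_notMem fun v hv => ?_
      obtain ⟨n, hn⟩ := exists_nat_gt ‖v‖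
      have : (n : ℝ) + 1 ≤ ‖v‖ := mem_iInter.1 hv n
      linarith
    have := tendsto_measure_iInter_atTop (μ := P'.map Γ) (s := F)
      (fun n => (hFc n).measurableSet.nullMeasurableSet)
      (fun a b hab v (hv : (b : ℝ) + 1 ≤ ‖v‖) => by
        have : (a : ℝ) ≤ b := by exact_mod_cast hab
        exact le_trans (by linarith) hv) ⟨0, measure_ne_top _ _⟩
    rwa [hemp, measure_empty] at this
  obtain ⟨n, hn⟩ := (hlim.eventually_lt_const hε).exists
  refine ⟨n + 1, by positivity, ?_⟩
  have hls := ProbabilityMeasure.limsup_measure_closed_le_of_tendsto hG.tendsto (hFc n)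
  have hev := eventually_lt_of_limsup_lt (lt_of_le_of_lt hls hn)
  filter_upwards [hev] with N hN
  have e : P.map (G N) (F n) = P {ω | (n : ℝ) + 1 ≤ ‖G N ω‖} :=
    Measure.map_apply_of_aemeasurable (hG.forall_aemeasurable N) (hFc n).measurableSet
  rw [← e]
  exact hN

/-- Processes which are uniformly close, in outer probability, to random constants converging in
distribution converge weakly to the limiting constant process. -/
theorem weakConvLInf_of_approx_const [IsProbabilityMeasure P] [IsProbabilityMeasure P']
    {Z : ℕ → Ω → S → ℝ × ℝ} {G : ℕ → Ω → ℝ × ℝ} {Γ : Ω' → ℝ × ℝ}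
    (hG : TendstoInDistribution G atTop Γ (fun _ => P) P')
    (hZ : ∀ᶠ N in atTop, ∀ ω, Memℓp (Z N ω) ⊤)
    (happ : ∀ M : ℝ, 0 < M → ∃ (E : ℕ → ℝ) (bad : ℕ → Set Ω), Tendsto E atTop (𝓝 0) ∧
      Tendsto (fun N => P (bad N)) atTop (𝓝 0) ∧
      ∀ᶠ N in atTop, ∀ ω, ω ∉ bad N → ‖G N ω‖ ≤ M → ∀ i, ‖Z N ω i - G N ω‖ ≤ E N) :
    WeakConvLInf P P' Z (fun ω' _ => Γ ω') where
  bounded := hZ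
  bounded_limit ω := memℓp_const _
  measurable_limit := by
    simp only [toLInf_const]
    exact continuous_constLInf.comp_aestronglyMeasurable hG.aemeasurable_limit.aestronglyMeasurable
  tendsto φ := by
    simp only [toLInf_const]
    set ψ : BoundedContinuousFunction (ℝ × ℝ) ℝ := φ.compContinuous ⟨_, continuous_constLInf⟩
      with hψ
    have hψv : ∀ v, ψ v = φ (constLInf S v) := fun v => rfl
    have hint : Tendsto (fun N => ∫ ω, ψ (G N ω) ∂P) atTop (𝓝 (∫ ω', ψ (Γ ω') ∂P')) := by
      have h1 := (ProbabilityMeasure.tendsto_iff_forall_integral_tendsto.1 hG.tendsto) ψ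
      simp only [ProbabilityMeasure.coe_mk] at h1
      rw [integral_map hG.aemeasurable_limit ψ.continuous.aestronglyMeasurable] at h1
      refine h1.congr fun N => ?_
      rw [integral_map (hG.forall_aemeasurable N) ψ.continuous.aestronglyMeasurable]
    refine tendsto_of_tendsto_of_dist hint ?_
    refine Metric.tendsto_nhds.2 fun ε hε => ?_
    set B := ‖φ‖ with hB
    have hB0 : 0 ≤ B := norm_nonneg _
    -- The exceptional set has probability at most `2 e` and the functionals differ there by at most
    -- `2 B`: a contribution `4 e B ≤ ε / 4`.
    set e := ε / (16 * (B + 1)) with he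
    have he0 : 0 < e := by positivity
    obtain ⟨M, hM0, hM⟩ := exists_eventually_measure_norm_ge_le hG (ENNReal.ofReal_pos.2 he0)
    obtain ⟨E, bad, hE, hbad, hclose⟩ := happ M hM0
    -- The functional is merely continuous, but the constants bounded by `M` form a compact set,
    -- near which it is uniformly continuous.
    have hcomp : IsCompact (constLInf S '' Metric.closedBall 0 M) :=
      (isCompact_closedBall _ _).image continuous_constLInf
    have hunif := hcomp.uniformContinuousAt_of_continuousAt φ
      (fun a _ => φ.continuous.continuousAt) (Metric.dist_mem_uniformity (show 0 < ε / 4 by positivity))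
    obtain ⟨d, hd0, hd⟩ := Metric.mem_uniformity_dist.1 hunif
    have hEabs := hE.abs
    rw [abs_zero] at hEabs
    filter_upwards [hM, hclose, hZ, hEabs.eventually_lt_const hd0,
      hbad.eventually_lt_const (ENNReal.ofReal_pos.2 he0)] with N h1 h2 h3 h4 h5
    -- The exceptional sets need not be measurable; a measurable hull has the same measure.
    set W := toMeasurable P ({ω | M ≤ ‖G N ω‖} ∪ bad N) with hW
    have hWm : MeasurableSet W := measurableSet_toMeasurable _ _
    have hPW : P.real W ≤ 2 * e := by
      refine ENNReal.toReal_le_of_le_ofReal (by positivity) ?_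
      rw [hW, measure_toMeasurable, two_mul, ENNReal.ofReal_add he0.le he0.le]
      exact (measure_union_le _ _).trans (add_le_add h1.le h5.le)
    have hφB : ∀ f, |φ f| ≤ B := fun f => φ.norm_coe_le_norm f
    have hdiff : ∀ ω, |φ (toLInf (Z N ω)) - ψ (G N ω)| ≤
        ε / 4 + W.indicator (fun _ => 2 * B) ω := by
      intro ω
      by_cases hω : ω ∈ W
      · rw [indicator_of_mem hω]
        have h6 := abs_sub (φ (toLInf (Z N ω))) (ψ (G N ω))
        have h7 := hφB (toLInf (Z N ω))
        have h8 := hφB (constLInf S (G N ω))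
        rw [hψv] at h6 ⊢
        linarith
      · rw [indicator_of_notMem hω, add_zero]
        have hω' : ω ∉ {ω | M ≤ ‖G N ω‖} ∪ bad N := fun hmem => hω (subset_toMeasurable _ _ hmem)
        simp only [mem_union, mem_ofPred_eq, not_or, not_le] at hω'
        have h6 := dist_toLInf_constLInf_le (h3 ω) (abs_nonneg (E N)) fun i =>
          (h2 ω hω'.2 hω'.1.le i).trans (le_abs_self _)
        have h7 := hd (lt_of_le_of_lt h6 h4) ⟨G N ω, by simpa using hω'.1.le, rfl⟩
        have h8 : dist (φ (constLInf S (G N ω))) (φ (toLInf (Z N ω))) < ε / 4 := h7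
        rw [dist_comm, Real.dist_eq] at h8
        exact h8.le
    have hg : Integrable (fun ω => ψ (G N ω)) P := by
      refine Integrable.of_bound ?_ B (.of_forall fun ω => hφB _)
      exact ψ.continuous.comp_aestronglyMeasurable (hG.forall_aemeasurable N).aestronglyMeasurable
    have hρ : Integrable (fun ω => ε / 4 + W.indicator (fun _ => 2 * B) ω) P :=
      (integrable_const _).add ((integrable_const _).indicator hWm)
    have key := abs_outerExpectation_sub_le hg hρ hdiff
    rw [integral_add (integrable_const _) ((integrable_const _).indicator hWm),
      integral_indicator_const _ hWm, integral_const, probReal_univ, one_smul, smul_eq_mul] at key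
    rw [Real.dist_0_eq_abs, dist_comm, Real.dist_eq, abs_abs]
    have h6 : P.real W * (2 * B) ≤ 2 * e * (2 * B) :=
      mul_le_mul_of_nonneg_right hPW (by positivity)
    have h7 : 2 * e * (2 * B) ≤ ε / 4 := by
      rw [he, mul_div_assoc', div_mul_eq_mul_div, div_le_iff₀ (by positivity)]
      nlinarith
    linarith

end Weak


/-! ### The extrapolated tail mean -/

/-- The ratio equals `k h / (N h (1 - α))`, whose numerator diverges while its denominator stays
bounded. -/
lemma ExtremeRates.tendsto_log_ratio {α h k δ : ℕ → ℝ} (hr : ExtremeRates α h k δ) :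
    Tendsto (fun N : ℕ => Real.log (k N / (N * (1 - α N)))) atTop atTop := by
  refine Real.tendsto_log_atTop.comp ?_
  obtain ⟨c, hc0, hc⟩ := hr.extreme
  have hc1 : 0 < c + 1 := by linarith
  refine tendsto_atTop_mono' _ ?_ (hr.effective_size.atTop_div_const hc1)
  filter_upwards [hr.fraction_mem, hc.eventually_le_const (lt_add_one c)] with N h1 h2
  have h3 := hr.bandwidth_pos N
  have h4 := (hr.level_mem N).2
  have h5 : (0 : ℝ) < N := by exact_mod_cast h1.2.1
  have h6 : 0 < 1 - α N := by linarith
  calc k N * h N / (c + 1) ≤ k N * h N / (N * h N * (1 - α N)) := by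
        have := h1.1
        gcongr
    _ = _ := by field_simp

/-- Logarithm of the extrapolation factor at the level `1 - υ (1 - a)`. -/
lemma log_ratio_mem {k a Δ₀ υ : ℝ} {N : ℕ} (hk : 0 < k) (hN : 0 < N) (ha : a < 1) (hΔ : 0 < Δ₀)
    (hυ : υ ∈ Icc Δ₀ 1) (hl : -Real.log Δ₀ ≤ Real.log (k / (N * (1 - a)))) :
    Real.log (k / (N * (1 - a))) ≤ Real.log (k / (N * (υ * (1 - a)))) ∧
      Real.log (k / (N * (υ * (1 - a)))) ≤ 2 * Real.log (k / (N * (1 - a))) := by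
  have hNR : (0 : ℝ) < N := by exact_mod_cast hN
  have ha' : 0 < 1 - a := by linarith
  have hυ0 : 0 < υ := hΔ.trans_le hυ.1
  have e : k / (N * (υ * (1 - a))) = k / (N * (1 - a)) / υ := by field_simp
  rw [e, Real.log_div (by positivity) hυ0.ne']
  have h1 := Real.log_le_log hΔ hυ.1
  have h2 := Real.log_nonpos hυ0.le hυ.2
  constructor <;> linarith

section Expansion

variable {Ω₀ : Type*} [MeasurableSpace Ω₀] {P : Measure Ω₀} [IsProbabilityMeasure P]
  {Y : ℝ → Ω₀ → ℝ} {t : ℝ} {α h k δ : ℕ → ℝ}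

/-- The tail mean at extreme levels is extrapolated from the intermediate quantile, with a
relative error which is negligible at the rate `√(k h)`. -/
lemma exists_tailMean_expansion {γ ρ : ℝ → ℝ} {A : ℝ → ℝ → ℝ} (hY : Measurable (Y t))
    (ht : t ∈ treatments) (hγ : HeavyTails P Y γ) (hγ2 : γ t < 1 / 2)
    (hsecond : SecondOrder P Y γ ρ A) (hr : ExtremeRates α h k δ)
    (hb : NegligibleBias P Y A h k t) {Δ₀ : ℝ} (hΔ₀ : 0 < Δ₀) :
    ∃ η : ℕ → ℝ, Tendsto (fun N => Real.sqrt (k N * h N) * η N) atTop (𝓝 0) ∧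
      ∀ᶠ N : ℕ in atTop, 0 < quantile P Y t (1 - k N / N) ∧ ∀ υ ∈ Icc Δ₀ 1,
        0 < tailMean P Y t (1 - υ * (1 - α N)) ∧
        |Real.log (tailMean P Y t (1 - υ * (1 - α N))) -
          (Real.log (quantile P Y t (1 - k N / N)) +
            γ t * Real.log (k N / (N * (υ * (1 - α N)))) - Real.log (1 - γ t))| ≤ η N := by
  have hc : Continuous (survival P Y t) := (hγ.smooth_outcome t ht).continuous
  have hpos : ∀ y, 0 < survival P Y t y := survival_pos hγ ht
  have hγ0 := hγ.index_pos t ht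
  have hγ1 : 0 < 1 - γ t := by linarith
  have hA : ∀ᶠ y in atTop, A t y ≠ 0 := by
    rcases hsecond.eventual_sign t ht with h | h
    · exact h.mono fun y hy => hy.ne'
    · exact h.mono fun y hy => hy.ne
  obtain ⟨ℓ, C, y₀, hC, hy₀, H⟩ := second_order_uniform hc hpos (survival_tendsto_atTop hY hc) hγ0
    (hsecond.rho_neg t ht) hA (hsecond.tendsto_zero t ht) (hsecond.limit t ht)
  have hqT := quantile_tendsto_atTop hY hc hpos
    (hr.fraction_mem.mono fun N hN => hN.2.2.1) hr.threshold_fraction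
  -- Of the three errors, two come from `tailMean_bounds`, and one from comparing the extreme with
  -- the intermediate quantile, where `γ t < 1 / 2` halves an error of `2 e`.
  refine ⟨fun N => 3 * (C * |A t (N / k N)|), ?_, ?_⟩
  · have h1 := hb.second_order.abs.const_mul (3 * C)
    rw [abs_zero, mul_zero] at h1
    refine h1.congr fun N => ?_
    rw [abs_mul, abs_of_nonneg (Real.sqrt_nonneg _)]; ring
  filter_upwards [hr.fraction_mem, hqT.eventually_ge_atTop y₀,
    hr.tendsto_log_ratio.eventually_gt_atTop 0] with N h1 h2 h3
  obtain ⟨hk0, hN0, hp0, hp1⟩ := h1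
  have hNR : (0 : ℝ) < N := by exact_mod_cast hN0
  set q := quantile P Y t (1 - k N / N) with hq
  have hq0 : 0 < q := hy₀.trans_le h2
  refine ⟨hq0, fun υ hυ => ?_⟩
  have hα : 0 < 1 - α N := by linarith [(hr.level_mem N).2]
  have hυ0 : 0 < υ := hΔ₀.trans_le hυ.1
  set p := υ * (1 - α N) with hp
  have hppos : 0 < p := by positivity
  have hpk : p ≤ k N / N := by
    have h4 : 1 < k N / (N * (1 - α N)) := by
      by_contra hle
      exact absurd (Real.log_nonpos (by positivity) (not_lt.1 hle)) (not_le.2 h3)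
    rw [lt_div_iff₀ (by positivity)] at h4
    rw [le_div_iff₀ hNR]
    nlinarith [hυ.2, mul_pos hNR hα]
  set q' := quantile P Y t (1 - p) with hq'
  have hqq' : q ≤ q' := quantile_antitone hY hc hppos hpk hp1
  have hFq : survival P Y t q = k N / N := survival_quantile hY hc hp0 hp1
  have hFq' : survival P Y t q' = p := survival_quantile hY hc hppos (hpk.trans_lt hp1)
  set e := C * |A t (N / k N)| with he
  -- The bound is anchored at the intermediate quantile, where `1 / F = N / k`; all extreme levels
  -- lie above it, so one error serves every `υ`.
  have H' : ∀ z, q ≤ z → |Real.log (survival P Y t z) + Real.log z / γ t - ℓ| ≤ e := by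
    intro z hz
    have := H q z h2 hz
    rwa [hFq, one_div_div] at this
  obtain ⟨b1, b2⟩ := tailMean_bounds hY hc hpos hγ0 (by linarith) (hq0.trans_le hqq')
    fun z hz => H' z (hqq'.trans hz)
  rw [← hq'] at b1 b2
  have hq'0 : 0 < q' := hq0.trans_le hqq'
  have hTM : 0 < tailMean P Y t (1 - p) := lt_of_lt_of_le (by positivity) b1
  refine ⟨hTM, ?_⟩
  have c1 := Real.log_le_log (by positivity) b1
  have c2 := Real.log_le_log hTM b2
  rw [Real.log_mul (by positivity) (Real.exp_pos _).ne', Real.log_exp,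
    Real.log_div hq'0.ne' hγ1.ne'] at c1 c2
  have d1 := abs_le.1 (H' q le_rfl)
  have d2 := abs_le.1 (H' q' hqq')
  rw [hFq] at d1
  rw [hFq'] at d2
  have hR : Real.log (k N / (N * p)) = Real.log (k N / N) - Real.log p := by
    rw [← div_div, Real.log_div hp0.ne' hppos.ne']
  rw [hR]
  have e1 : |Real.log q' - Real.log q - γ t * (Real.log (k N / N) - Real.log p)| ≤ e := by
    have e2 : Real.log q' - Real.log q - γ t * (Real.log (k N / N) - Real.log p) =
        γ t * ((Real.log p + Real.log q' / γ t - ℓ) -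
          (Real.log (k N / N) + Real.log q / γ t - ℓ)) := by
      field_simp; ring
    rw [e2, abs_mul, abs_of_pos hγ0]
    have e3 : |(Real.log p + Real.log q' / γ t - ℓ) -
          (Real.log (k N / N) + Real.log q / γ t - ℓ)| ≤ 2 * e := by
      rw [abs_le]; constructor <;> linarith
    have e4 : 0 ≤ e := by positivity
    calc _ ≤ 1 / 2 * (2 * e) := by gcongr
      _ = e := by ring
  have e5 := abs_le.1 e1
  rw [abs_le]
  constructor <;> linarith

end Expansion

/-- First-order expansion of the normalized relative error. -/
lemma error_approx {s L ℓ e G v M : ℝ} (hs : 0 < s) (hℓ : 0 < ℓ) (hL : ℓ ≤ L) (hL2 : L ≤ 2 * ℓ)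
    (hG : |G| ≤ M) (hv : |v - L * G / s| ≤ e) (hsmall : 2 * ℓ * M / s + e ≤ 1) :
    |s / L * (Real.exp v - 1) - G| ≤ s / ℓ * ((2 * ℓ * M / s + e) ^ 2 + e) := by
  have hL0 : 0 < L := hℓ.trans_le hL
  have h1 : |L * G / s| ≤ 2 * ℓ * M / s := by
    rw [abs_div, abs_mul, abs_of_pos hL0, abs_of_pos hs]
    gcongr
  have h2 : |v| ≤ 2 * ℓ * M / s + e := by
    have := abs_add_le (v - L * G / s) (L * G / s)
    rw [sub_add_cancel] at this
    linarith
  have h3 := Real.abs_exp_sub_one_sub_id_le (h2.trans hsmall)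
  have h4 : v ^ 2 ≤ (2 * ℓ * M / s + e) ^ 2 := by
    rw [← sq_abs]; gcongr
  have h5 : s / L * (Real.exp v - 1) - G =
      s / L * ((Real.exp v - 1 - v) + (v - L * G / s)) := by
    field_simp; ring
  rw [h5, abs_mul, abs_of_pos (div_pos hs hL0)]
  have h6 := abs_add_le (Real.exp v - 1 - v) (v - L * G / s)
  gcongr
  linarith

lemma abs_log_sub_log_le {a b c : ℝ} (hc : 0 < c) (ha : c ≤ a) (hb : c ≤ b) :
    |Real.log a - Real.log b| ≤ |a - b| / c := by
  have key : ∀ a b : ℝ, c ≤ a → c ≤ b → Real.log a - Real.log b ≤ |a - b| / c := by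
    intro a b ha hb
    have ha0 := hc.trans_le ha
    have hb0 := hc.trans_le hb
    rw [← Real.log_div ha0.ne' hb0.ne']
    calc _ ≤ a / b - 1 := Real.log_le_sub_one_of_pos (div_pos ha0 hb0)
      _ = (a - b) / b := by field_simp
      _ ≤ |a - b| / b := by gcongr; exact le_abs_self _
      _ ≤ |a - b| / c := by gcongr
  rw [abs_le]
  constructor
  · have := key b a hb ha
    rw [abs_sub_comm] at this
    linarith
  · exact key a b ha hb

/-- The logarithm of the ratio of the estimated and the true tail mean. -/
lemma exists_log_ratio {Q R g γ TM q x η s G M : ℝ} (hq : 0 < q)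
    (hQ : Q ∈ Icc (q * Real.exp (-x)) (q * Real.exp x)) (hR : 0 < R) (hγ : γ < 1 / 2)
    (hs : 0 < s) (hg : s * (g - γ) = G) (hG : |G| ≤ M) (hM : M / s ≤ 1 / 4) (hTM : 0 < TM)
    (hη : |Real.log TM - (Real.log q + γ * Real.log R - Real.log (1 - γ))| ≤ η) :
    ∃ v, Q * R ^ g / (1 - g) / TM = Real.exp v ∧
      |v - Real.log R * G / s| ≤ x + η + 4 * M / s := by
  have hQ0 : 0 < Q := lt_of_lt_of_le (by positivity) hQ.1
  have hgγ : g - γ = G / s := by rw [← hg]; field_simp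
  have hgs : |g - γ| ≤ M / s := by
    rw [hgγ, abs_div, abs_of_pos hs]; gcongr
  have h1 := abs_le.1 (hgs.trans hM)
  -- Since `γ < 1 / 2` and `|g - γ| ≤ 1 / 4`, both `1 - γ` and `1 - g` are at least `1 / 4`, where
  -- the logarithm has Lipschitz constant `4`.
  have hg1 : 1 / 4 ≤ 1 - g := by linarith
  have hg0 : 0 < 1 - g := by linarith
  have hRg : 0 < R ^ g := Real.rpow_pos_of_pos hR g
  refine ⟨Real.log (Q * R ^ g / (1 - g) / TM), (Real.exp_log (by positivity)).symm, ?_⟩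
  rw [Real.log_div (by positivity) hTM.ne', Real.log_div (by positivity) hg0.ne',
    Real.log_mul hQ0.ne' hRg.ne', Real.log_rpow hR]
  have h2 : Real.log q - x ≤ Real.log Q := by
    have := Real.log_le_log (by positivity) hQ.1
    rw [Real.log_mul hq.ne' (Real.exp_pos _).ne', Real.log_exp] at this
    linarith
  have h3 : Real.log Q ≤ Real.log q + x := by
    have := Real.log_le_log hQ0 hQ.2
    rwa [Real.log_mul hq.ne' (Real.exp_pos _).ne', Real.log_exp] at this
  have h4 : |Real.log (1 - γ) - Real.log (1 - g)| ≤ 4 * M / s := by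
    refine (abs_log_sub_log_le (by norm_num : (0 : ℝ) < 1 / 4) (by linarith) hg1).trans ?_
    have : 1 - γ - (1 - g) = g - γ := by ring
    rw [this, mul_div_assoc]
    linarith
  have h5 : Real.log R * G / s = g * Real.log R - γ * Real.log R := by
    rw [mul_div_assoc, ← hgγ]; ring
  rw [h5]
  have h6 := abs_le.1 hη
  have h7 := abs_le.1 h4
  rw [abs_le]
  constructor <;> linarith

section TailMean

variable {Ω₀ : Type*} [MeasurableSpace Ω₀] {P₀ : Measure Ω₀} [IsProbabilityMeasure P₀]
  {Y : ℝ → Ω₀ → ℝ} {t : ℝ} {α h k δ : ℕ → ℝ} {γ ρ : ℝ → ℝ} {A : ℝ → ℝ → ℝ}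

/-- The sample paths of the normalized error are bounded. -/
lemma eventually_tailMeanError_bounded (hY : Measurable (Y t))
    (ht : t ∈ treatments) (hγ : HeavyTails P₀ Y γ) (hγ2 : γ t < 1 / 2)
    (hsecond : SecondOrder P₀ Y γ ρ A) (hr : ExtremeRates α h k δ)
    (hb : NegligibleBias P₀ Y A h k t) {Δ₀ : ℝ} (hΔ₀ : 0 < Δ₀) :
    ∀ᶠ N : ℕ in atTop, ∀ Q g : ℝ, ∃ C : ℝ, ∀ υ ∈ Icc Δ₀ 1,
      |tailMeanError (h N) N (k N) (α N)
        (fun a => Q * (k N / (N * (1 - a))) ^ g / (1 - g)) (tailMean P₀ Y t) υ| ≤ C := by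
  obtain ⟨η, -, hη⟩ := exists_tailMean_expansion hY ht hγ hγ2 hsecond hr hb hΔ₀
  filter_upwards [hη, hr.fraction_mem, hr.tendsto_log_ratio.eventually_gt_atTop 0,
    hr.tendsto_log_ratio.eventually_ge_atTop (-Real.log Δ₀)] with N h1 h2 h3 h4 Q g
  obtain ⟨hk0, hN0, -, -⟩ := h2
  have hNR : (0 : ℝ) < N := by exact_mod_cast hN0
  have hα : 0 < 1 - α N := by linarith [(hr.level_mem N).2]
  set ℓ := Real.log (k N / (N * (1 - α N))) with hℓ
  set q := quantile P₀ Y t (1 - k N / N) with hq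
  -- The bound is for fixed `N` and arbitrary estimates, as boundedness is required of every sample
  -- path. If `g = 1`, both quotients by `1 - g` are zero by convention.
  refine ⟨Real.sqrt (k N * h N) / ℓ * (|Q| * Real.exp (|g| * (2 * ℓ)) / |1 - g| *
    Real.exp (Real.log (1 - γ t) - Real.log q + η N) + 1), fun υ hυ => ?_⟩
  obtain ⟨hTM, hb1⟩ := h1.2 υ hυ
  obtain ⟨hL1, hL2⟩ := log_ratio_mem hk0 hN0 (by linarith) hΔ₀ hυ h4
  rw [← hℓ] at hL1 hL2
  have hυ0 : 0 < υ := hΔ₀.trans_le hυ.1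
  simp only [tailMeanError, sub_sub_cancel, mul_assoc (N : ℝ) υ]
  set R := k N / (N * (υ * (1 - α N))) with hR
  have hR0 : 0 < R := by positivity
  have hL0 : 0 < Real.log R := h3.trans_le hL1
  have hRg : R ^ g ≤ Real.exp (|g| * (2 * ℓ)) := by
    rw [Real.rpow_def_of_pos hR0, Real.exp_le_exp, mul_comm]
    have := le_abs_self g
    have := abs_nonneg g
    nlinarith
  have hinv : (tailMean P₀ Y t (1 - υ * (1 - α N)))⁻¹ ≤
      Real.exp (Real.log (1 - γ t) - Real.log q + η N) := by
    rw [← Real.exp_log (inv_pos.2 hTM), Real.exp_le_exp, Real.log_inv]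
    have h5 := (abs_le.1 hb1).1
    have h6 : 0 ≤ γ t * Real.log R := mul_nonneg (hγ.index_pos t ht).le hL0.le
    linarith
  rw [abs_mul, abs_of_nonneg (div_nonneg (Real.sqrt_nonneg _) hL0.le)]
  have habs : |Q * R ^ g / (1 - g) / tailMean P₀ Y t (1 - υ * (1 - α N)) - 1| ≤
      |Q| * Real.exp (|g| * (2 * ℓ)) / |1 - g| *
        Real.exp (Real.log (1 - γ t) - Real.log q + η N) + 1 := by
    refine (abs_sub _ _).trans ?_
    rw [abs_one, abs_div, abs_div, abs_mul, abs_of_pos (Real.rpow_pos_of_pos hR0 g),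
      abs_of_pos hTM, div_eq_mul_inv _ (tailMean P₀ Y t (1 - υ * (1 - α N)))]
    gcongr
  gcongr

/-- The normalized error is uniformly close to the normalized error of the tail index estimator,
outside events of vanishing outer probability. -/
lemma exists_tailMeanError_approx {Ω : Type*} [MeasurableSpace Ω] {P : Measure Ω}
    (hY : Measurable (Y t))
    (ht : t ∈ treatments) (hγ : HeavyTails P₀ Y γ) (hγ2 : γ t < 1 / 2)
    (hsecond : SecondOrder P₀ Y γ ρ A) (hr : ExtremeRates α h k δ)
    (hb : NegligibleBias P₀ Y A h k t) {Δ₀ : ℝ} (hΔ₀ : 0 < Δ₀) {Q g : ℕ → Ω → ℝ}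
    (hQ : ∀ x : ℕ → ℝ, Tendsto x atTop (𝓝 0) → (∀ᶠ N in atTop, 0 < x N) →
      Tendsto (fun N => x N * Real.sqrt (k N * h N)) atTop atTop →
      Tendsto (fun N : ℕ => P {ω | Q N ω ∉ Icc (quantile P₀ Y t (1 - k N / N) * Real.exp (-x N))
        (quantile P₀ Y t (1 - k N / N) * Real.exp (x N))}) atTop (𝓝 0))
    (M : ℝ) :
    ∃ (E : ℕ → ℝ) (bad : ℕ → Set Ω), Tendsto E atTop (𝓝 0) ∧
      Tendsto (fun N => P (bad N)) atTop (𝓝 0) ∧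
      ∀ᶠ N : ℕ in atTop, ∀ ω, ω ∉ bad N → |Real.sqrt (k N * h N) * (g N ω - γ t)| ≤ M →
        ∀ υ ∈ Icc Δ₀ 1, |tailMeanError (h N) N (k N) (α N)
          (fun a => Q N ω * (k N / (N * (1 - a))) ^ (g N ω) / (1 - g N ω)) (tailMean P₀ Y t) υ -
            Real.sqrt (k N * h N) * (g N ω - γ t)| ≤ E N := by
  obtain ⟨η, hη0, hη⟩ := exists_tailMean_expansion hY ht hγ hγ2 hsecond hr hb hΔ₀
  set s : ℕ → ℝ := fun N => Real.sqrt (k N * h N) with hs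
  set ℓ : ℕ → ℝ := fun N => Real.log (k N / (N * (1 - α N))) with hℓ
  have hsT : Tendsto s atTop atTop := hr.tendsto_sqrt
  have hℓT : Tendsto ℓ atTop atTop := hr.tendsto_log_ratio
  have hsℓ : Tendsto (fun N => ℓ N / s N) atTop (𝓝 0) := by
    have := hr.extrapolation.inv_tendsto_atTop
    refine this.congr fun N => ?_
    simp only [Pi.inv_apply, inv_div, hs, hℓ]
  have hs0 := hsT.eventually_gt_atTop 0
  have hℓ0 := hℓT.eventually_gt_atTop 0
  have hℓinv : Tendsto (fun N => (ℓ N)⁻¹) atTop (𝓝 0) := hℓT.inv_tendsto_atTop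
  -- The rate is chosen between two requirements: `x s = √ℓ → ∞`, so the quantile estimator is
  -- consistent at rate `x`, and `x s / ℓ = 1 / √ℓ → 0`, so its error is negligible after
  -- normalization.
  set x : ℕ → ℝ := fun N => Real.sqrt (ℓ N) / s N with hx
  have hsqℓ : Tendsto (fun N => Real.sqrt (ℓ N)) atTop atTop := Real.tendsto_sqrt_atTop.comp hℓT
  have hxs : Tendsto (fun N => x N * s N) atTop atTop := by
    refine hsqℓ.congr' ?_
    filter_upwards [hs0] with N h1
    simp only [hx]
    field_simp
  have hx0 : Tendsto x atTop (𝓝 0) := by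
    refine squeeze_zero' (.of_forall fun N => div_nonneg (Real.sqrt_nonneg _)
      (Real.sqrt_nonneg _)) ?_ hsℓ
    filter_upwards [hs0, hℓT.eventually_ge_atTop 1] with N h1 h2
    simp only [hx]
    gcongr
    exact Real.sqrt_le_self_iff.2 (Or.inr h2)
  have hxpos : ∀ᶠ N in atTop, 0 < x N := by
    filter_upwards [hs0, hℓ0] with N h1 h2
    exact div_pos (Real.sqrt_pos.2 h2) h1
  set e : ℕ → ℝ := fun N => x N + η N + 4 * M / s N with he
  have hse : Tendsto (fun N => s N / ℓ N * e N) atTop (𝓝 0) := by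
    have h1 : Tendsto (fun N => (Real.sqrt (ℓ N))⁻¹ + s N * η N * (ℓ N)⁻¹ + 4 * M * (ℓ N)⁻¹)
        atTop (𝓝 (0 + 0 * 0 + 4 * M * 0)) :=
      (hsqℓ.inv_tendsto_atTop.add (hη0.mul hℓinv)).add (hℓinv.const_mul _)
    have e0 : (0 : ℝ) + 0 * 0 + 4 * M * 0 = 0 := by ring
    rw [e0] at h1
    refine h1.congr' ?_
    filter_upwards [hs0, hℓ0] with N h2 h3
    have h4 : Real.sqrt (ℓ N) / ℓ N = (Real.sqrt (ℓ N))⁻¹ := by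
      rw [Real.sqrt_div_self]
    simp only [he, hx]
    rw [← h4]
    field_simp
  -- This bounds the logarithm of the ratio. It tends to zero while `s b / ℓ` stays bounded, so the
  -- quadratic remainder `s b ^ 2 / ℓ` vanishes.
  set b : ℕ → ℝ := fun N => 2 * ℓ N * M / s N + e N with hbdef
  have hbℓ : Tendsto (fun N => s N / ℓ N * b N) atTop (𝓝 (2 * M)) := by
    have h1 := hse.const_add (2 * M)
    rw [add_zero] at h1
    refine h1.congr' ?_
    filter_upwards [hs0, hℓ0] with N h2 h3
    simp only [hbdef]
    field_simp
  have hb0 : Tendsto b atTop (𝓝 0) := by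
    have h1 := hbℓ.mul hsℓ
    rw [mul_zero] at h1
    refine h1.congr' ?_
    filter_upwards [hs0, hℓ0] with N h2 h3
    field_simp
  refine ⟨fun N => s N / ℓ N * (b N ^ 2 + e N), fun N => {ω | Q N ω ∉
    Icc (quantile P₀ Y t (1 - k N / N) * Real.exp (-x N))
      (quantile P₀ Y t (1 - k N / N) * Real.exp (x N))}, ?_, hQ x hx0 hxpos hxs, ?_⟩
  · have h1 := (hbℓ.mul hb0).add hse
    rw [mul_zero, add_zero] at h1
    refine h1.congr fun N => ?_
    ring
  have hMs : Tendsto (fun N => M / s N) atTop (𝓝 0) := hsT.const_div_atTop M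
  filter_upwards [hη, hs0, hℓ0, hr.fraction_mem, hℓT.eventually_ge_atTop (-Real.log Δ₀),
    hb0.eventually_le_const one_pos, hMs.eventually_le_const (show (0 : ℝ) < 1 / 4 by norm_num)]
    with N h1 h2 h3 h4 h5 h6 h7 ω hω hG υ hυ
  have hω' : Q N ω ∈ Icc (quantile P₀ Y t (1 - k N / N) * Real.exp (-x N))
      (quantile P₀ Y t (1 - k N / N) * Real.exp (x N)) := by
    by_contra hn
    exact hω hn
  obtain ⟨hk0, hN0, -, -⟩ := h4
  have hNR : (0 : ℝ) < N := by exact_mod_cast hN0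
  have hα : 0 < 1 - α N := by linarith [(hr.level_mem N).2]
  have hυ0 : 0 < υ := hΔ₀.trans_le hυ.1
  obtain ⟨hL1, hL2⟩ := log_ratio_mem hk0 hN0 (by linarith) hΔ₀ hυ h5
  obtain ⟨hTM, hη1⟩ := h1.2 υ hυ
  have hR0 : 0 < k N / (N * (υ * (1 - α N))) := by positivity
  obtain ⟨v, hv1, hv2⟩ := exists_log_ratio h1.1 hω' hR0 hγ2 h2 rfl hG h7 hTM hη1
  simp only [tailMeanError, sub_sub_cancel, mul_assoc (N : ℝ) υ]
  rw [hv1]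
  exact error_approx h2 h3 hL1 hL2 hG hv2 h6

end TailMean

end ExtremeTE

/-! ### Joint convergence at two treatments -/

theorem mainTheorem5 {r : ℕ}
    -- population: treatment, covariates, potential outcomes
    {Ω₀ : Type*} [MeasurableSpace Ω₀] (P₀ : Measure Ω₀) [IsProbabilityMeasure P₀]
    (T : Ω₀ → ℝ) (X : Ω₀ → ExtremeTE.Cov r) (Y : ℝ → Ω₀ → ℝ)
    (hmeas : ExtremeTE.MeasurableModel T X Y)
    (γ : ℝ → ℝ) (hγ : ExtremeTE.HeavyTails P₀ Y γ)
    (hunconf : ExtremeTE.Unconfounded P₀ T X Y)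
    (fT : ℝ → ℝ) (fTX : ℝ → ExtremeTE.Cov r → ℝ)
    (hdens : ExtremeTE.TreatmentDensities P₀ T X fT fTX)
    (hoverlap : ExtremeTE.Overlap P₀ X fT fTX)
    (κ : Kernel (ℝ × ExtremeTE.Cov r) ℝ) (hreg : ExtremeTE.RegularLaw P₀ T X Y fT κ)
    (ρ : ℝ → ℝ) (A : ℝ → ℝ → ℝ) (hsecond : ExtremeTE.SecondOrder P₀ Y γ ρ A)
    (hγ_half : ∀ t ∈ ExtremeTE.treatments, γ t < 1 / 2)
    -- random sample
    {Ω : Type*} [MeasurableSpace Ω] (P : Measure Ω) [IsProbabilityMeasure P]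
    (Ts : ℕ → Ω → ℝ) (Xs : ℕ → Ω → ExtremeTE.Cov r) (Ys : ℕ → Ω → ℝ)
    (hindep : iIndepFun (fun i ω => (Ts i ω, Xs i ω, Ys i ω)) P)
    (hident : ∀ i, IdentDistrib (fun ω => (Ts i ω, Xs i ω, Ys i ω))
      (ExtremeTE.observation T X Y) P P₀)
    -- kernel, weight estimator and rates
    (K : ℝ → ℝ) (hK : ExtremeTE.IsSmoothingKernel K)
    (piHat : ℕ → Ω → ℝ → ExtremeTE.Cov r → ℝ)
    (δ : ℕ → ℝ) (hδ_nonneg : ∀ N, 0 ≤ δ N) (hδ : Tendsto δ atTop (𝓝 0))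
    (hpi : ExtremeTE.IsBigOp P
      (fun N ω => ⨆ i : Fin N, |piHat N ω (Ts i ω) (Xs i ω) -
        ExtremeTE.stabWeight fT fTX (Ts i ω) (Xs i ω)|) δ)
    (α h k : ℕ → ℝ) (hrates : ExtremeTE.ExtremeRates α h k δ)
    (hbias : ∀ t ∈ ExtremeTE.treatments, ExtremeTE.NegligibleBias P₀ Y A h k t)
    -- tail index estimator and its limit
    (γHat : ℕ → ℝ → Ω → ℝ)
    {Ω' : Type*} [MeasurableSpace Ω'] (P' : Measure Ω') [IsProbabilityMeasure P']
    (Γ : ℝ → Ω' → ℝ)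
    (hΓ_indep : ∀ t₁ ∈ ExtremeTE.treatments, ∀ t₂ ∈ ExtremeTE.treatments, t₁ ≠ t₂ →
      IndepFun (Γ t₁) (Γ t₂) P')
    (hΓ : ∀ t₁ ∈ ExtremeTE.treatments, ∀ t₂ ∈ ExtremeTE.treatments, t₁ ≠ t₂ →
      TendstoInDistribution
        (fun (N : ℕ) ω => (Real.sqrt (k N * h N) * (γHat N t₁ ω - γ t₁),
          Real.sqrt (k N * h N) * (γHat N t₂ ω - γ t₂)))
        atTop (fun ω' => (Γ t₁ ω', Γ t₂ ω')) (fun _ => P) P')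
    (Δ₀ : ℝ) (hΔ₀ : Δ₀ ∈ Ioo (0 : ℝ) 1)
    -- normalized relative error of the tail mean estimator
    (M : ℕ → ℝ → Ω → ℝ → ℝ)
    (hM : ∀ N t ω υ, M N t ω υ =
      ExtremeTE.tailMeanError (h N) N (k N) (α N)
        (ExtremeTE.tailMeanHat K (h N) N (fun i => piHat N ω (Ts i ω) (Xs i ω))
          (fun i => Ts i ω) (fun i => Ys i ω) (k N) (γHat N t ω) t)
        (ExtremeTE.tailMean P₀ Y t) υ) :
    ∀ t₁ ∈ ExtremeTE.treatments, ∀ t₂ ∈ ExtremeTE.treatments, t₁ ≠ t₂ →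
      ExtremeTE.WeakConvLInf P P'
        (fun N ω (υ : Icc Δ₀ 1) => (M N t₁ ω υ, M N t₂ ω υ))
        (fun ω' (_ : Icc Δ₀ 1) => (Γ t₁ ω', Γ t₂ ω')) ∧
      IndepFun (Γ t₁) (Γ t₂) P' := by
  intro t₁ ht₁ t₂ ht₂ hne
  have hbdd := fun t (ht : t ∈ ExtremeTE.treatments) =>
    ExtremeTE.eventually_tailMeanError_bounded (hmeas.outcome t ht) ht hγ (hγ_half t ht) hsecond
      hrates (hbias t ht) hΔ₀.1
  have happ := fun t (ht : t ∈ ExtremeTE.treatments) =>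
    ExtremeTE.exists_tailMeanError_approx (g := fun N ω => γHat N t ω) (hmeas.outcome t ht) ht hγ
      (hγ_half t ht) hsecond hrates (hbias t ht) hΔ₀.1
      (fun x hx hx0 hxs => ExtremeTE.quantileHat_consistent hmeas hγ hunconf hdens hoverlap hreg
        hindep hident hK hδ_nonneg hpi hrates ht (hbias t ht) hx hx0 hxs)
  refine ⟨ExtremeTE.weakConvLInf_of_approx_const (hΓ t₁ ht₁ t₂ ht₂ hne) ?_ fun B _ => ?_,
    hΓ_indep t₁ ht₁ t₂ ht₂ hne⟩
  · filter_upwards [hbdd t₁ ht₁, hbdd t₂ ht₂] with N h₁ h₂ ω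
    obtain ⟨C₁, hC₁⟩ := h₁ (ExtremeTE.quantileHat K (h N) N
      (fun i => piHat N ω (Ts i ω) (Xs i ω)) (fun i => Ts i ω) (fun i => Ys i ω) t₁ (1 - k N / N))
      (γHat N t₁ ω)
    obtain ⟨C₂, hC₂⟩ := h₂ (ExtremeTE.quantileHat K (h N) N
      (fun i => piHat N ω (Ts i ω) (Xs i ω)) (fun i => Ts i ω) (fun i => Ys i ω) t₂ (1 - k N / N))
      (γHat N t₂ ω)
    refine memℓp_infty ⟨max C₁ C₂, ?_⟩
    rintro _ ⟨υ, rfl⟩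
    simp only [hM]
    exact max_le_max (hC₁ υ υ.2) (hC₂ υ υ.2)
  · obtain ⟨E₁, bad₁, hE₁, hbad₁, hclose₁⟩ := happ t₁ ht₁ B
    obtain ⟨E₂, bad₂, hE₂, hbad₂, hclose₂⟩ := happ t₂ ht₂ B
    -- The norm on `ℝ × ℝ` is the maximum of the coordinates: a bound on the pair bounds each
    -- coordinate, and the two approximation errors combine by a maximum.
    refine ⟨fun N => max (E₁ N) (E₂ N), fun N => bad₁ N ∪ bad₂ N, by simpa using hE₁.max hE₂,
      ?_, ?_⟩
    · refine tendsto_of_tendsto_of_tendsto_of_le_of_le tendsto_const_nhds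
        (by simpa using hbad₁.add hbad₂) (fun _ => zero_le) fun N => measure_union_le _ _
    · filter_upwards [hclose₁, hclose₂] with N h₁ h₂ ω hω hG υ
      rw [mem_union, not_or] at hω
      simp only [hM]
      exact max_le_max (h₁ ω hω.1 ((norm_fst_le _).trans hG) υ υ.2)
        (h₂ ω hω.2 ((norm_snd_le _).trans hG) υ υ.2)
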